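/- **Theorem (turning point $x=1$).** Let $H_n$ be the (physicists') Hermite polynomials. Let $f(z)=z^2-2z+\tfrac12\ln z$ on $\mathbb C\setminus(-\infty,0]$ (principal logarithm), and let $w(z)=[f(z)-f(1/2)]^{1/3}$ be the branch of the cube root that is analytic on $\mathbb C\setminus(-\infty,0]$ with $w(z)=(4/3)^{1/3}e^{-2\pi i/3}(z-\tfrac12)+\mathcal O((z-\tfrac12)^2)$ as $z\to\tfrac12$, extended continuously to the two sides $\arg z=\pm\pi$ of the cut $(-\infty,0)$. Let $\Gamma_*$ be the contour that runs along the upper side $\arg z=\pi$ of the cut from $-\infty$ to $0$ and returns along the lower side $\arg z=-\pi$ from $0$ to $-\infty$, and for $j\ge1$ put $$D_j=\left(\frac43\right)^{j/3}\frac{e^{-2\pi ij/3}}{2^{3/2}\pi i}\int_{\Gamma_*}\frac{z^{-1/2}}{w(z)^j}\,dz,$$ where the integral converges absolutely. Then the $D_j$ are rational numbers, and they are given by $$D_j=\frac{(-1)^{j-1}}{\Gamma(j/3)}\int_0^{+\infty}e^{-s}s^{j/3-1}Q_j(s)\,ds\qquad(j\ge1),$$ where $Q_j$ are the polynomials with rational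 coefficients defined by $Q_1(t)=1$ and $$Q_{j+1}(t)=\frac1{2^j}\binom{2j}{j}-3\sum_{k=0}^{j-1}\frac{2^{k+1}}{k+4}\int_0^tQ_{j-k}(s)\,ds\qquad(j\ge1).$$ Let $n\ge0$ be an integer and $N=2n+1$. Then for every integer $p\ge3$, $$H_n(\sqrt N)=\frac{2^{n+1}n!\,e^{3N/4}}{3\pi N^{n/2}}\left\{\sum_{j=1}^{p-1}\left(\frac34\right)^{j/3}D_j\sin\left(\frac{2\pi j}3\right)\frac{\Gamma(j/3)}{N^{j/3}}+\varepsilon_p(N)\right\},$$ where $\varepsilon_p(N)$ is real and $$|\varepsilon_p(N)|\le\frac{\widetilde C_p}{N^{p/3}},\qquad \widetilde C_p=\left|\left(\frac34\right)^{p/3}D_p\sin\left(\frac{2\pi p}3\right)\right|\Gamma\left(\frac p3\right)+\frac1{2^{3/2}\pi}\,\frac{C_{p+1}\,\Gamma((p+1)/3)}{N^{1/3}},$$ $$C_{p+1}=\frac{12}\pi\left\{\frac2{(\pi/2)^{(p-2)/3}}+\frac6{4p-11}\right\}.$$ In particular, if $p\ge3$ is not divisible by $3$, then $\widetilde C_p\to\left|(3/4)^{p/3}D_p\sin(2\pi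 p/3)\right|\Gamma(p/3)$ as $N\to+\infty$. -/

import Mathlib

open Set Filter Topology MeasureTheory Polynomial

namespace HermiteTurningPoint

noncomputable section

/-- The (physicists') Hermite polynomial `H_n(x) = 2^(n/2) He_n(√2 x)`, where `He_n` is the
probabilists' Hermite polynomial of Mathlib. -/
def hermiteH (n : ℕ) (x : ℝ) : ℝ :=
  Real.sqrt 2 ^ n * aeval (Real.sqrt 2 * x) (hermite n)

/-! ### The phase function and its cube root

Functions of `z` in the plane cut along the negative real axis, including the two sides of the cut,
are written in the coordinate `L = ln z`, so `z = e^L` with `-π ≤ Im L ≤ π`. The upper and the lower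
side of the cut are the lines `Im L = π` and `Im L = -π`. -/

/-- The phase function `f(z) = z^2 - 2 z + (ln z) / 2` at `z = e^L`. -/
def phase (L : ℂ) : ℂ :=
  Complex.exp L ^ 2 - 2 * Complex.exp L + L / 2

/-- The logarithm of the saddle point `z = 1/2`. -/
def saddleLog : ℂ := -(Real.log 2 : ℂ)

/-- The quotient `(f(z) - f(1/2)) / (z - 1/2)^3` at `z = e^L`. -/
def cubicQuot (L : ℂ) : ℂ :=
  (phase L - phase saddleLog) / (Complex.exp L - 1 / 2) ^ 3

/-- The cube root `w(z) = (f(z) - f(1/2))^(1/3)` at `z = e^L`, for the branch with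
`w(z) ~ (4/3)^(1/3) e^(-2πi/3) (z - 1/2)` at `z = 1/2`. The principal cube root of the quotient is
the right branch everywhere, see `cubeRoot_cube`, `continuousOn_cubeRoot`,
`differentiableOn_cubeRoot` and `hasDerivAt_cubeRoot_log` below. -/
def cubeRoot (L : ℂ) : ℂ :=
  Complex.exp (-(2 * Real.pi * Complex.I / 3)) * (Complex.exp L - 1 / 2) *
    cubicQuot L ^ (1 / 3 : ℂ)

/-- The point of argument `π` and modulus `s` on the upper side of the cut. -/
def upperCut (s : ℝ) : ℂ := (Real.log s : ℂ) + Real.pi * Complex.I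

/-- The point of argument `-π` and modulus `s` on the lower side of the cut. -/
def lowerCut (s : ℝ) : ℂ := (Real.log s : ℂ) - Real.pi * Complex.I

/-- The integral `∫ h(z) dz` over the contour that runs along the upper side of the cut from `-∞`
to `0` and back along the lower side from `0` to `-∞`. Here `h` is a function of `L = ln z`, and
`z = s e^(±πi)`, `dz = -ds`. -/
def cutIntegral (h : ℂ → ℂ) : ℂ :=
  (∫ s in Ioi (0 : ℝ), h (upperCut s)) - ∫ s in Ioi (0 : ℝ), h (lowerCut s)

/-- Absolute convergence of `cutIntegral h`. -/
def CutIntegrable (h : ℂ → ℂ) : Prop :=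
  IntegrableOn (fun s : ℝ => h (upperCut s)) (Ioi 0) ∧
    IntegrableOn (fun s : ℝ => h (lowerCut s)) (Ioi 0)

/-- The function `z^(-1/2) / w(z)^j` at `z = e^L`. -/
def coeffIntegrand (j : ℕ) (L : ℂ) : ℂ :=
  Complex.exp (-L / 2) / cubeRoot L ^ j

/-- The coefficient
`D_j = (4/3)^(j/3) e^(-2πij/3) / (2^(3/2) π i) ∫ z^(-1/2) / w(z)^j dz` of the expansion. -/
def coeffD (j : ℕ) : ℂ :=
  (((4 / 3 : ℝ) ^ ((j : ℝ) / 3) : ℝ) : ℂ) * Complex.exp (-(2 * Real.pi * Complex.I * j / 3)) /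
      ((((2 : ℝ) ^ (3 / 2 : ℝ) : ℝ) : ℂ) * Real.pi * Complex.I) *
    cutIntegral (coeffIntegrand j)

/-! ### The recurrence -/

/-- The polynomial `∫_0^t p(s) ds` in `t`. -/
def primitive (p : ℚ[X]) : ℚ[X] :=
  p.sum fun i a => monomial (i + 1) (a / ((i : ℚ) + 1))

/-- The polynomials with `Q_1 = 1` and, for `j ≥ 1`,
`Q_{j+1}(t) = 2^(-j) binom(2j, j) - 3 ∑_{k=0}^{j-1} 2^(k+1) / (k+4) ∫_0^t Q_{j-k}(s) ds`
(the formula gives `Q_1 = 1` for `j = 0`; the value at index `0` is not used). -/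
def recQ : ℕ → ℚ[X]
  | 0 => 0
  | j + 1 => C (((2 * j).choose j : ℚ) / 2 ^ j) -
      3 * ∑ k ∈ Finset.range j, C ((2 : ℚ) ^ (k + 1) / ((k : ℚ) + 4)) * primitive (recQ (j - k))
  termination_by j => j
  decreasing_by omega

/-! ### The error bound -/

/-- The constant `C_q = (12/π) (2 / (π/2)^(q/3 - 1) + 6 / (4q - 15))`. -/
def constC (q : ℕ) : ℝ :=
  12 / Real.pi * (2 / (Real.pi / 2) ^ ((q : ℝ) / 3 - 1) + 6 / (4 * (q : ℝ) - 15))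

/-- The absolute value `|(3/4)^(p/3) D_p sin(2πp/3)| Γ(p/3)`, for coefficients `D_p = d p`. -/
def omittedTerm (d : ℕ → ℚ) (p : ℕ) : ℝ :=
  |(3 / 4 : ℝ) ^ ((p : ℝ) / 3) * (d p : ℝ) * Real.sin (2 * Real.pi * p / 3)| *
    Real.Gamma ((p : ℝ) / 3)

/-- The constant
`|(3/4)^(p/3) D_p sin(2πp/3)| Γ(p/3) + C_{p+1} Γ((p+1)/3) / (2^(3/2) π N^(1/3))`
of the error bound, for coefficients `D_p = d p`. -/
def errorConst (d : ℕ → ℚ) (p : ℕ) (N : ℝ) : ℝ :=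
  omittedTerm d p +
    1 / ((2 : ℝ) ^ (3 / 2 : ℝ) * Real.pi) *
      (constC (p + 1) * Real.Gamma (((p : ℝ) + 1) / 3) / N ^ (1 / 3 : ℝ))

/-! ### The definitions are the intended ones -/

theorem derivative_primitive (p : ℚ[X]) : derivative (primitive p) = p := by
  conv_rhs => rw [← p.sum_monomial_eq]
  rw [primitive, Polynomial.sum_def, Polynomial.sum_def, derivative_sum]
  refine Finset.sum_congr rfl fun i _ => ?_
  rw [derivative_monomial]
  have : ((i : ℚ) + 1) ≠ 0 := by positivity
  push_cast
  congr 1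
  field_simp

theorem eval_zero_primitive (p : ℚ[X]) : (primitive p).eval 0 = 0 := by
  simp [primitive, Polynomial.sum_def, eval_finsetSum]

theorem exp_saddleLog : Complex.exp saddleLog = 1 / 2 := by
  rw [saddleLog, Complex.exp_neg, ← Complex.ofReal_exp, Real.exp_log (by norm_num)]
  norm_num

theorem saddleLog_im : saddleLog.im = 0 := by
  rw [saddleLog, Complex.neg_im, Complex.ofReal_im, neg_zero]

theorem eq_saddleLog {L : ℂ} (hL : |L.im| ≤ Real.pi) (h : Complex.exp L = 1 / 2) :
    L = saddleLog := by
  have hpi := Real.pi_pos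
  have him : L.im = 0 := by
    rw [← exp_saddleLog, Complex.exp_eq_exp_iff_exists_int] at h
    obtain ⟨n, hn⟩ := h
    have h1 := congrArg Complex.im hn
    have h2 : L.im = n * (2 * Real.pi) := by
      simpa [saddleLog_im] using h1
    rw [h2] at hL ⊢
    rcases eq_or_ne n 0 with rfl | h0
    · simp
    · have : (1 : ℝ) ≤ |(n : ℝ)| := by exact_mod_cast Int.one_le_abs h0
      rw [abs_mul, abs_of_pos (by positivity : (0 : ℝ) < 2 * Real.pi)] at hL
      nlinarith
  refine Complex.exp_inj_of_neg_pi_lt_of_le_pi (by rw [him]; linarith) (by rw [him]; linarith)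
    ?_ ?_ (h.trans exp_saddleLog.symm)
  · rw [saddleLog_im]; linarith
  · rw [saddleLog_im]; linarith

/-- `w(z)^3 = f(z) - f(1/2)`, on both sides of the cut too. -/
theorem cubeRoot_cube {L : ℂ} (hL : |L.im| ≤ Real.pi) :
    cubeRoot L ^ 3 = phase L - phase saddleLog := by
  by_cases h : Complex.exp L = 1 / 2
  · rw [eq_saddleLog hL h]; simp [cubeRoot, exp_saddleLog]
  · have h' : Complex.exp L - 1 / 2 ≠ 0 := sub_ne_zero.mpr h
    have h3 : (cubicQuot L ^ (1 / 3 : ℂ)) ^ 3 = cubicQuot L := by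
      have := Complex.cpow_nat_inv_pow (cubicQuot L) (n := 3) (by norm_num)
      simpa only [Nat.cast_ofNat, one_div] using this
    have he : Complex.exp (-(2 * Real.pi * Complex.I / 3)) ^ 3 = 1 := by
      rw [← Complex.exp_nat_mul, Complex.exp_eq_one_iff]
      exact ⟨-1, by push_cast; ring⟩
    rw [cubeRoot, mul_pow, mul_pow, h3, he, cubicQuot, one_mul, mul_div_cancel₀ _ (pow_ne_zero 3 h')]

theorem one_add_mem_slitPlane {L : ℂ} (h1 : -Real.pi < L.im) (h2 : L.im < Real.pi) {t : ℝ}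
    (ht : t ∈ Icc (0 : ℝ) 1) : 1 + (2 * Complex.exp L - 1) * t ∈ Complex.slitPlane := by
  have hm : 2 * Complex.exp L ∈ Complex.slitPlane := by
    by_contra hn
    rw [Complex.mem_slitPlane_iff, not_or, not_lt, not_not] at hn
    obtain ⟨hr, hi⟩ := hn
    simp [Complex.exp_re, Complex.exp_im] at hr hi
    have hs := (Real.sin_eq_zero_iff_of_lt_of_lt h1 h2).mp hi
    rw [hs, Real.cos_zero] at hr
    linarith [Real.exp_pos L.re]
  have := Complex.starConvex_one_slitPlane hm (sub_nonneg.mpr ht.2) ht.1 (by ring)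
  convert this using 1
  simp
  ring

/-- In the open strip, the quotient is a Stieltjes-type integral. -/
theorem cubicQuot_eq_integral {L : ℂ} (h : Complex.exp L ≠ 1 / 2) (h1 : -Real.pi < L.im)
    (h2 : L.im < Real.pi) :
    cubicQuot L = 4 * ∫ t in (0 : ℝ)..1, (t : ℂ) ^ 2 / (1 + (2 * Complex.exp L - 1) * t) := by
  set a : ℂ := 2 * Complex.exp L - 1 with ha
  have ha0 : a ≠ 0 := by
    intro h0; apply h; rw [ha] at h0; linear_combination h0 / 2
  have hmem : ∀ t ∈ Icc (0 : ℝ) 1, 1 + a * t ∈ Complex.slitPlane :=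
    fun t ht => one_add_mem_slitPlane h1 h2 ht
  have hder : ∀ t ∈ uIcc (0 : ℝ) 1, HasDerivAt
      (fun t : ℝ => (t : ℂ) ^ 2 / (2 * a) - t / a ^ 2 + Complex.log (1 + a * t) / a ^ 3)
      ((t : ℂ) ^ 2 / (1 + a * t)) t := by
    intro t ht
    rw [uIcc_of_le zero_le_one] at ht
    have hm := hmem t ht
    have hn := Complex.slitPlane_ne_zero hm
    have e0 : HasDerivAt (fun z : ℂ => z) 1 (t : ℂ) := hasDerivAt_id _
    have e1 := (((e0.pow 2).div_const (2 * a)).sub (e0.div_const (a ^ 2))).add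
      ((((e0.const_mul a).const_add 1).clog hm).div_const (a ^ 3))
    refine e1.comp_ofReal.congr_deriv ?_
    generalize hu : 1 + a * (t : ℂ) = u at hn ⊢
    have htu : (t : ℂ) = (u - 1) / a := by rw [← hu]; field_simp; ring
    rw [htu]
    push_cast
    field_simp
    ring
  have hcont : ContinuousOn (fun t : ℝ => (t : ℂ) ^ 2 / (1 + a * t)) (uIcc 0 1) := by
    rw [uIcc_of_le zero_le_one]
    refine ContinuousOn.div (by fun_prop) (by fun_prop)
      fun t ht => Complex.slitPlane_ne_zero (hmem t ht)
  rw [intervalIntegral.integral_eq_sub_of_hasDerivAt hder hcont.intervalIntegrable]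
  have hlog : Complex.log (1 + a * (1 : ℝ)) = L + Real.log 2 := by
    rw [← Complex.log_exp (x := L + Real.log 2)
      (by rw [Complex.add_im, Complex.ofReal_im, add_zero]; exact h1)
      (by rw [Complex.add_im, Complex.ofReal_im, add_zero]; exact h2.le),
      Complex.exp_add, ← Complex.ofReal_exp, Real.exp_log (by norm_num), ha]
    congr 1; push_cast; ring
  rw [hlog, cubicQuot, phase, phase, exp_saddleLog, saddleLog]
  have hE : Complex.exp L = (1 + a) / 2 := by rw [ha]; ring
  rw [hE]
  have : (1 + a) / 2 - 1 / 2 = a / 2 := by ring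
  rw [this]
  simp only [Complex.ofReal_one, Complex.ofReal_zero, mul_zero, add_zero, Complex.log_one]
  field_simp
  ring

/-- The quotient avoids the branch cut of the principal cube root. -/
theorem cubicQuot_mem_slitPlane {L : ℂ} (hL : |L.im| ≤ Real.pi) (h : Complex.exp L ≠ 1 / 2) :
    cubicQuot L ∈ Complex.slitPlane := by
  by_cases hb : |L.im| = Real.pi
  · have hE : Complex.exp L = ((-Real.exp L.re : ℝ) : ℂ) := by
      have hc : Real.cos L.im = -1 := by rw [← Real.cos_abs, hb, Real.cos_pi]
      have hs : Real.sin L.im = 0 := by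
        rcases abs_eq Real.pi_pos.le |>.mp hb with h0 | h0 <;> simp [h0]
      apply Complex.ext
      · rw [Complex.exp_re, hc, Complex.ofReal_re]; ring
      · rw [Complex.exp_im, hs, Complex.ofReal_im]; ring
    have hne : L.im ≠ 0 := by
      intro h0; rw [h0, abs_zero] at hb; exact Real.pi_pos.ne hb
    have hr : -Real.exp L.re - 1 / 2 ≠ 0 := by linarith [Real.exp_pos L.re]
    have hq : cubicQuot L = (((-Real.exp L.re) ^ 2 - 2 * (-Real.exp L.re) + 3 / 4 : ℝ) +
        (L / (2 : ℝ) + (Real.log 2 / 2 : ℝ))) / (((-Real.exp L.re - 1 / 2) ^ 3 : ℝ) : ℂ) := by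
      rw [cubicQuot, phase, phase, exp_saddleLog, saddleLog, hE]
      push_cast
      congr 1
      ring
    right
    rw [hq, Complex.div_ofReal_im, Complex.add_im, Complex.ofReal_im, Complex.add_im,
      Complex.ofReal_im, Complex.div_ofReal_im]
    refine div_ne_zero ?_ (pow_ne_zero 3 hr)
    rw [zero_add, add_zero]
    exact div_ne_zero hne two_ne_zero
  · have hlt := abs_lt.mp (lt_of_le_of_ne hL hb)
    obtain ⟨l1', l2'⟩ := hlt
    rw [cubicQuot_eq_integral h l1' l2']
    set a : ℂ := 2 * Complex.exp L - 1 with ha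
    have hmem : ∀ t ∈ Icc (0 : ℝ) 1, 1 + a * t ∈ Complex.slitPlane :=
      fun t ht => one_add_mem_slitPlane l1' l2' ht
    have hpos : ∀ t ∈ Icc (0 : ℝ) 1, 0 < Complex.normSq (1 + a * t) :=
      fun t ht => Complex.normSq_pos.mpr (Complex.slitPlane_ne_zero (hmem t ht))
    set A : ℝ := ∫ t in (0 : ℝ)..1, t ^ 2 * (1 - t) / Complex.normSq (1 + a * t) with hA
    set B : ℝ := ∫ t in (0 : ℝ)..1, t ^ 3 / Complex.normSq (1 + a * t) with hB
    have cn : ContinuousOn (fun t : ℝ => Complex.normSq (1 + a * t)) (Icc 0 1) :=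
      (Complex.continuous_normSq.comp (by fun_prop)).continuousOn
    have cA : ContinuousOn (fun t : ℝ => t ^ 2 * (1 - t) / Complex.normSq (1 + a * t))
        (uIcc 0 1) := by
      rw [uIcc_of_le zero_le_one]
      exact ContinuousOn.div (by fun_prop) cn fun t ht => (hpos t ht).ne'
    have cB : ContinuousOn (fun t : ℝ => t ^ 3 / Complex.normSq (1 + a * t)) (uIcc 0 1) := by
      rw [uIcc_of_le zero_le_one]
      exact ContinuousOn.div (by fun_prop) cn fun t ht => (hpos t ht).ne'
    have hA0 : 0 ≤ A := by
      refine intervalIntegral.integral_nonneg zero_le_one fun t ht => ?_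
      have := hpos t ht
      have : 0 ≤ 1 - t := by linarith [ht.2]
      positivity
    have hB0 : 0 < B := by
      refine intervalIntegral.intervalIntegral_pos_of_pos_on cB.intervalIntegrable
        (fun t ht => ?_) zero_lt_one
      have := hpos t ⟨ht.1.le, ht.2.le⟩
      have := ht.1
      positivity
    have key : (∫ t in (0 : ℝ)..1, (t : ℂ) ^ 2 / (1 + a * t)) =
        (A : ℂ) + (starRingEnd ℂ) (2 * Complex.exp L) * (B : ℂ) := by
      rw [hA, hB, ← intervalIntegral.integral_ofReal, ← intervalIntegral.integral_ofReal,
        ← intervalIntegral.integral_const_mul, ← intervalIntegral.integral_add]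
      · refine intervalIntegral.integral_congr fun t ht => ?_
        rw [uIcc_of_le zero_le_one] at ht
        have hn := Complex.slitPlane_ne_zero (hmem t ht)
        have hc : (starRingEnd ℂ) (1 + a * t) ≠ 0 := by
          rw [Ne, map_eq_zero]; exact hn
        have e2 : (starRingEnd ℂ) (2 * Complex.exp L) = (starRingEnd ℂ) a + 1 := by
          rw [← map_one (starRingEnd ℂ), ← map_add, ha]; congr 1; ring
        simp only [Complex.ofReal_div, Complex.normSq_eq_conj_mul_self]
        rw [e2]
        push_cast
        have hc' : 1 + (starRingEnd ℂ) a * t ≠ 0 := by simpa using hc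
        simp only [map_add, map_mul, map_one, Complex.conj_ofReal]
        rw [mul_div_assoc', ← add_div, div_eq_div_iff hn (mul_ne_zero hc' hn)]
        ring
      · exact (Complex.continuous_ofReal.comp_continuousOn cA).intervalIntegrable
      · exact (continuousOn_const.mul
          (Complex.continuous_ofReal.comp_continuousOn cB)).intervalIntegrable
    have hz : 2 * Complex.exp L ∈ Complex.slitPlane := by
      have := hmem 1 (by simp)
      rw [ha] at this
      simpa using this
    rw [key]
    rcases hz with hz | hz
    · left
      have : 0 < (2 * Complex.exp L).re * B := mul_pos hz hB0
      simp at this ⊢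
      linarith
    · right
      have : (2 * Complex.exp L).im * B ≠ 0 := mul_ne_zero hz hB0.ne'
      simpa using this

theorem differentiableAt_cubicQuot {L : ℂ} (h : Complex.exp L ≠ 1 / 2) :
    DifferentiableAt ℂ cubicQuot L := by
  have h' : (Complex.exp L - 1 / 2) ^ 3 ≠ 0 := pow_ne_zero 3 (sub_ne_zero.mpr h)
  unfold cubicQuot phase
  fun_prop (disch := exact h')

theorem differentiableAt_cubeRoot_of_ne {L : ℂ} (hL : |L.im| ≤ Real.pi)
    (h : Complex.exp L ≠ 1 / 2) : DifferentiableAt ℂ cubeRoot L := by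
  have h1 := (differentiableAt_cubicQuot h).cpow (differentiableAt_const (1 / 3 : ℂ))
    (cubicQuot_mem_slitPlane hL h)
  unfold cubeRoot
  exact DifferentiableAt.mul (by fun_prop) h1

theorem continuousAt_cubeRoot_saddleLog : ContinuousAt cubeRoot saddleLog := by
  have h0 : cubeRoot saddleLog = 0 := by simp [cubeRoot, exp_saddleLog]
  rw [ContinuousAt, h0, tendsto_zero_iff_norm_tendsto_zero]
  have hp : Tendsto (fun L => ‖phase L - phase saddleLog‖ ^ (1 / 3 : ℝ)) (𝓝 saddleLog) (𝓝 0) := by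
    have hc : ContinuousAt (fun L => ‖phase L - phase saddleLog‖ ^ (1 / 3 : ℝ)) saddleLog := by
      refine ContinuousAt.rpow_const ?_ (Or.inr (by norm_num))
      unfold phase
      fun_prop
    have := hc.tendsto
    simpa using this
  refine hp.congr' ?_
  have hs : ∀ᶠ L : ℂ in 𝓝 saddleLog, |L.im| < Real.pi := by
    refine (isOpen_lt (by fun_prop) continuous_const).mem_nhds ?_
    simp [saddleLog_im, Real.pi_pos]
  filter_upwards [hs] with L hL
  rw [← cubeRoot_cube hL.le, norm_pow, ← Real.rpow_natCast, ← Real.rpow_mul (norm_nonneg _)]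
  norm_num

/-- `w` is continuous up to the two sides of the cut. -/
theorem continuousOn_cubeRoot : ContinuousOn cubeRoot {L | |L.im| ≤ Real.pi} := by
  intro L hL
  by_cases h : Complex.exp L = 1 / 2
  · rw [eq_saddleLog hL h]
    exact continuousAt_cubeRoot_saddleLog.continuousWithinAt
  · exact (differentiableAt_cubeRoot_of_ne hL h).continuousAt.continuousWithinAt

/-- `w` is analytic in the cut plane. -/
theorem differentiableOn_cubeRoot : DifferentiableOn ℂ cubeRoot {L | |L.im| < Real.pi} := by
  have ho : IsOpen {L : ℂ | |L.im| < Real.pi} := isOpen_lt (by fun_prop) continuous_const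
  have hm : saddleLog ∈ {L : ℂ | |L.im| < Real.pi} := by simp [saddleLog_im, Real.pi_pos]
  refine (Complex.differentiableOn_compl_singleton_and_continuousAt_iff (ho.mem_nhds hm)).mp
    ⟨fun L hL => ?_, continuousAt_cubeRoot_saddleLog⟩
  have hL' : |L.im| ≤ Real.pi := le_of_lt hL.1
  exact (differentiableAt_cubeRoot_of_ne hL'
    fun h => hL.2 (eq_saddleLog hL' h)).differentiableWithinAt

theorem cubicQuot_log_sub (x : ℂ) (hx : x ≠ 0) (hx1 : ‖x‖ < 1 / 4) :
    ‖cubicQuot (Complex.log (1 / 2 + x)) - 4 / 3‖ ≤ 4 * ‖x‖ := by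
  set a : ℂ := 2 * x with ha
  have hx2 : x = a / 2 := by rw [ha]; ring
  have ha0 : a ≠ 0 := mul_ne_zero two_ne_zero hx
  have han : ‖a‖ = 2 * ‖x‖ := by rw [ha, norm_mul]; norm_num
  have ha1 : ‖a‖ < 1 := by linarith
  have hne : 1 + a ≠ 0 := by
    intro h
    rw [show a = -1 by linear_combination h] at ha1
    norm_num at ha1
  have hT := Complex.norm_log_sub_logTaylor_le 3 ha1
  set R : ℂ := Complex.log (1 + a) - Complex.logTaylor (3 + 1) a with hR
  have hlogT : Complex.logTaylor (3 + 1) a = a - a ^ 2 / 2 + a ^ 3 / 3 := by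
    simp [Complex.logTaylor_succ, Complex.logTaylor_zero]
    ring
  have hz : (1 / 2 + x : ℂ) = ((1 / 2 : ℝ) : ℂ) * (1 + a) := by rw [hx2]; push_cast; ring
  have hlog : Complex.log (1 / 2 + x) = -(Real.log 2 : ℂ) + (a - a ^ 2 / 2 + a ^ 3 / 3 + R) := by
    rw [hz, Complex.log_ofReal_mul (by norm_num) hne, ← hlogT, hR, one_div, Real.log_inv]
    push_cast
    ring
  have hz0 : (1 / 2 + x : ℂ) ≠ 0 := by
    rw [hz]; exact mul_ne_zero (by norm_num) hne
  have hq : cubicQuot (Complex.log (1 / 2 + x)) - 4 / 3 = 4 * R / a ^ 3 := by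
    rw [cubicQuot, phase, phase, exp_saddleLog, Complex.exp_log hz0, hlog, saddleLog, hx2]
    have : (1 / 2 + a / 2 - 1 / 2 : ℂ) = a / 2 := by ring
    rw [this]
    field_simp
    ring
  have hpos : 0 < ‖a‖ := norm_pos_iff.mpr ha0
  have hinv : (1 - ‖a‖)⁻¹ ≤ 2 := by
    rw [inv_le_comm₀ (by linarith) (by norm_num)]; linarith
  have hR2 : ‖R‖ ≤ ‖a‖ ^ 4 / 2 := by
    refine hT.trans ?_
    norm_num
    have := mul_le_mul_of_nonneg_left hinv (pow_nonneg hpos.le 4)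
    linarith
  rw [hq, norm_div, norm_mul, norm_pow, div_le_iff₀ (by positivity)]
  have h4 : ‖(4 : ℂ)‖ = 4 := by norm_num
  rw [h4]
  have h5 : 4 * ‖x‖ * ‖a‖ ^ 3 = 2 * ‖a‖ ^ 4 := by rw [han]; ring
  linarith

/-- The branch of `w` at the saddle point: `w'(1/2) = (4/3)^(1/3) e^(-2πi/3)`. -/
theorem hasDerivAt_cubeRoot_log : HasDerivAt (fun z => cubeRoot (Complex.log z))
    ((((4 / 3 : ℝ) ^ (1 / 3 : ℝ) : ℝ) : ℂ) * Complex.exp (-(2 * Real.pi * Complex.I / 3)))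
    (1 / 2) := by
  have hlog : Complex.log (1 / 2) = saddleLog := by
    rw [← exp_saddleLog, Complex.log_exp] <;> rw [saddleLog_im] <;> linarith [Real.pi_pos]
  rw [hasDerivAt_iff_tendsto_slope_zero]
  have hq : Tendsto (fun x : ℂ => cubicQuot (Complex.log (1 / 2 + x))) (𝓝[≠] 0) (𝓝 (4 / 3)) := by
    rw [tendsto_iff_norm_sub_tendsto_zero]
    refine squeeze_zero' (Eventually.of_forall fun _ => norm_nonneg _) ?_
      (g := fun x => 4 * ‖x‖) ?_
    · have : ∀ᶠ x : ℂ in 𝓝[≠] 0, ‖x‖ < 1 / 4 :=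
        nhdsWithin_le_nhds ((isOpen_lt continuous_norm continuous_const).mem_nhds (by simp))
      filter_upwards [this, self_mem_nhdsWithin] with x hx hx0
      exact cubicQuot_log_sub x hx0 hx
    · have : Tendsto (fun x : ℂ => 4 * ‖x‖) (𝓝 0) (𝓝 (4 * ‖(0 : ℂ)‖)) :=
        Continuous.tendsto (by fun_prop) 0
      simpa using this.mono_left nhdsWithin_le_nhds
  have hc : Tendsto (fun x : ℂ => Complex.exp (-(2 * Real.pi * Complex.I / 3)) *
      cubicQuot (Complex.log (1 / 2 + x)) ^ (1 / 3 : ℂ)) (𝓝[≠] 0)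
      (𝓝 (Complex.exp (-(2 * Real.pi * Complex.I / 3)) * (4 / 3 : ℂ) ^ (1 / 3 : ℂ))) := by
    refine Tendsto.const_mul _ (hq.cpow tendsto_const_nhds ?_)
    left; norm_num
  have h43 : (((4 / 3 : ℝ) ^ (1 / 3 : ℝ) : ℝ) : ℂ) = (4 / 3 : ℂ) ^ (1 / 3 : ℂ) := by
    rw [Complex.ofReal_cpow (by norm_num)]; norm_num
  rw [h43, mul_comm]
  refine hc.congr' ?_
  have hx : ∀ᶠ x : ℂ in 𝓝[≠] 0, ‖x‖ < 1 / 4 :=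
    nhdsWithin_le_nhds ((isOpen_lt continuous_norm continuous_const).mem_nhds (by simp))
  filter_upwards [hx, self_mem_nhdsWithin] with x hx hx0
  have hx0 : x ≠ 0 := hx0
  have hz : (1 / 2 + x : ℂ) ≠ 0 := by
    intro h
    have : x = -(1 / 2) := by linear_combination h
    rw [this] at hx; norm_num at hx
  have hw0 : cubeRoot saddleLog = 0 := by simp [cubeRoot, exp_saddleLog]
  rw [hlog, hw0, sub_zero, cubeRoot, Complex.exp_log hz, smul_eq_mul]
  have : (1 / 2 + x - 1 / 2 : ℂ) = x := by ring
  rw [this]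
  field_simp

end

end HermiteTurningPoint

open HermiteTurningPoint

namespace HermiteTurningPoint

/-! Write `V` for `realRoot`, so that `V^3 = f(z) - f(1/2)` with `z = e^L`. Cauchy's formula at `x =
√N`, `N = 2n+1`, expresses `H_n(√N)`, up to an explicit factor, as the integral of `e^(L/2) e^(-N
V^3)` over any vertical segment across the strip `|Im L| ≤ π`. Instead of following steepest descent
paths and inverting `V(z)`, the proof realizes the exponential as the discrepancy between two
continuations of one function.

That function is the Cauchy transform `T(V)` of `e^(-N v^3)` over the rays `arg v = ±2π/3`. It
satisfies the same first-order linear differential equation on both sides of the rays, so its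
continuation `M` from the left sector is entire, and `M + 2πi e^(-N V^3)` is `T` in the right sector
(`exists_entire_rayTransform`). Both sides of the cut are mapped into the left sector, where `M =
T`. Cauchy's theorem for `e^(L/2) M(V)` in the strip thus equates the integral of `z^(-1/2) T(V)`
along the cut with the contributions of the two ends. The end at the origin gives nothing. At
infinity `V ~ z^(2/3)`, the part of size `1/V` dies out, and the exponential leaves the Hermite
integral (`cutIntegral_rayTransform`).

Expanding `T` in powers of `1/V` gives the asymptotic series: each coefficient is a Gamma value from
a moment of `e^(-N ρ^3)`, times a sine from combining the two rays, times the cut integral of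
`z^(-1/2) V^(-j)`. The remainder is explicit because `Im V^3 = ±π/2` on the cut, which keeps `V` off
the rays quantitatively at the cost of two powers of `|V|` (`norm_rayTransform_sub_sum_le`,
`cutIntegral_rayTransform_expansion`).

The cut integrals are residues at `z = 1/2` (`cutIntegral_rootIntegrand`). With `y = 1/2 - z` the
integrand is a constant times `y^(-j) (1-2y)^(-1/2) (1+τ(y))^(-j/3)`, where both series are
rational. The recurrence says that `∑ Q_{m+1}(s) y^m = (1-2y)^(-1/2) e^(-s τ(y))` (`coeff_recQ`),
and integrating against `e^(-s) s^(j/3-1)` turns `e^(-s τ)` into `Γ(j/3) (1+τ)^(-j/3)`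
(`integral_recQ`). -/

/-! ### Cut integrals and Cauchy's theorem in the strip `|Im L| ≤ π` -/

theorem integrable_comp_exp {g : ℝ → ℂ} (hg : IntegrableOn g (Ioi 0)) :
    Integrable (fun t : ℝ => (Real.exp t : ℂ) * g (Real.exp t)) := by
  have h := integrableOn_image_iff_integrableOn_abs_deriv_smul (s := univ) (f := Real.exp)
    (f' := Real.exp) MeasurableSet.univ (fun x _ => (Real.hasDerivAt_exp x).hasDerivWithinAt)
    Real.exp_injective.injOn g
  rw [image_univ, Real.range_exp] at h
  have := h.mp hg
  rw [integrableOn_univ] at this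
  refine this.congr (Eventually.of_forall fun t => ?_)
  simp only [abs_of_pos (Real.exp_pos t), Complex.real_smul]

theorem integral_comp_exp (g : ℝ → ℂ) :
    ∫ t : ℝ, (Real.exp t : ℂ) * g (Real.exp t) = ∫ s in Ioi (0 : ℝ), g s := by
  have h := integral_image_eq_integral_abs_deriv_smul (s := univ) (f := Real.exp)
    (f' := Real.exp) MeasurableSet.univ (fun x _ => (Real.hasDerivAt_exp x).hasDerivWithinAt)
    Real.exp_injective.injOn g
  rw [image_univ, Real.range_exp] at h
  rw [h, setIntegral_univ]
  refine integral_congr_ae (Eventually.of_forall fun t => ?_)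
  simp only [abs_of_pos (Real.exp_pos t), Complex.real_smul]

theorem exp_add_pi_mul_I (t : ℝ) :
    Complex.exp (t + Real.pi * Complex.I) = -(Real.exp t : ℂ) := by
  rw [Complex.exp_add, Complex.exp_pi_mul_I, Complex.ofReal_exp]; ring

theorem exp_sub_pi_mul_I (t : ℝ) :
    Complex.exp (t - Real.pi * Complex.I) = -(Real.exp t : ℂ) := by
  rw [Complex.exp_sub, Complex.exp_pi_mul_I, Complex.ofReal_exp]; ring

/-- The integral over the vertical segment of the closed strip `|Im L| ≤ π` with real part `R`. -/
noncomputable def vertIntegral (φ : ℂ → ℂ) (R : ℝ) : ℂ :=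
  ∫ y in (-Real.pi)..Real.pi, φ (R + y * Complex.I)

/-- Cauchy's theorem in the strip `|Im L| ≤ π` for a function `φ` that has the same jump across
the strip as `e^L h(L)`. -/
theorem cutIntegral_eq_of_tendsto {h φ : ℂ → ℂ} {c c' : ℂ} (hint : CutIntegrable h)
    (hc : ContinuousOn φ {L | |L.im| ≤ Real.pi})
    (hd : ∀ L : ℂ, |L.im| < Real.pi → L ≠ saddleLog → DifferentiableAt ℂ φ L)
    (hj : ∀ t : ℝ, φ (t + Real.pi * Complex.I) - φ (t - Real.pi * Complex.I) =
      Complex.exp (t + Real.pi * Complex.I) * h (t + Real.pi * Complex.I) -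
      Complex.exp (t - Real.pi * Complex.I) * h (t - Real.pi * Complex.I))
    (hr : Tendsto (vertIntegral φ) atTop (𝓝 c)) (hl : Tendsto (vertIntegral φ) atBot (𝓝 c')) :
    cutIntegral h = Complex.I * (c' - c) := by
  have hpi := Real.pi_pos
  set g : ℝ → ℂ := fun s => h (upperCut s) - h (lowerCut s) with hg
  have hgi : IntegrableOn g (Ioi 0) := hint.1.sub hint.2
  have hcut : cutIntegral h = ∫ s in Ioi (0 : ℝ), g s := (integral_sub hint.1 hint.2).symm
  have hgt : ∀ t : ℝ, (Real.exp t : ℂ) * g (Real.exp t) =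
      φ (t - Real.pi * Complex.I) - φ (t + Real.pi * Complex.I) := by
    intro t
    have := hj t
    rw [exp_add_pi_mul_I, exp_sub_pi_mul_I] at this
    simp only [hg, upperCut, lowerCut, Real.log_exp]
    linear_combination this
  -- The substitution `s = e^t` makes the cut integral the limit of symmetric integrals over the
  -- horizontal sides of growing rectangles.
  have h1 : Tendsto (fun R : ℝ => ∫ t in (-R)..R, (Real.exp t : ℂ) * g (Real.exp t)) atTop
      (𝓝 (cutIntegral h)) := by
    rw [hcut, ← integral_comp_exp]
    exact intervalIntegral_tendsto_integral (integrable_comp_exp hgi) tendsto_neg_atTop_atBot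
      tendsto_id
  have hcl : ∀ σ : ℝ, |σ| ≤ Real.pi → Continuous fun t : ℝ => φ (t + σ * Complex.I) := by
    intro σ hσ
    refine hc.comp_continuous (by fun_prop) fun t => ?_
    simpa using hσ
  have hcp := hcl Real.pi (by rw [abs_of_pos hpi])
  have hcm : Continuous fun t : ℝ => φ (t - Real.pi * Complex.I) := by
    have := hcl (-Real.pi) (by rw [abs_neg, abs_of_pos hpi])
    simpa [sub_eq_add_neg] using this
  have h2 : ∀ R : ℝ, 0 ≤ R → ∫ t in (-R)..R, (Real.exp t : ℂ) * g (Real.exp t) =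
      Complex.I * (vertIntegral φ (-R) - vertIntegral φ R) := by
    intro R hR
    -- The version with a countable exceptional set is used because `φ` is assumed only continuous
    -- at the saddle point.
    have hrect := Complex.integral_boundary_rect_eq_zero_of_differentiable_on_off_countable φ
      (((-R : ℝ) : ℂ) - Real.pi * Complex.I) ((R : ℂ) + Real.pi * Complex.I) {saddleLog}
      (countable_singleton _) ?_ ?_
    · simp only [Complex.sub_re, Complex.sub_im, Complex.add_re, Complex.add_im, Complex.ofReal_re,
        Complex.ofReal_im, Complex.re_ofReal_mul, Complex.im_ofReal_mul, Complex.I_re,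
        Complex.I_im, mul_zero, mul_one, sub_zero, zero_sub, add_zero, zero_add,
        smul_eq_mul] at hrect
      simp_rw [hgt]
      rw [intervalIntegral.integral_sub (hcm.intervalIntegrable _ _) (hcp.intervalIntegrable _ _)]
      simp only [vertIntegral]
      have e1 : ∀ t : ℝ, (t : ℂ) + ((-Real.pi : ℝ) : ℂ) * Complex.I = t - Real.pi * Complex.I := by
        intro t; push_cast; ring
      simp_rw [e1] at hrect
      linear_combination hrect
    · refine hc.mono fun L hL => ?_
      have := hL.2
      simp at this
      rw [uIcc_of_le (by linarith)] at this
      exact abs_le.mpr this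
    · rintro L ⟨hL, hs⟩
      have := hL.2
      simp at this
      refine hd L (abs_lt.mpr ⟨?_, ?_⟩) hs
      · rcases this.1 with h | h <;> linarith
      · rcases this.2 with h | h <;> linarith
  have h3 : Tendsto (fun R : ℝ => Complex.I * (vertIntegral φ (-R) - vertIntegral φ R)) atTop
      (𝓝 (Complex.I * (c' - c))) :=
    ((hl.comp tendsto_neg_atTop_atBot).sub hr).const_mul _
  refine tendsto_nhds_unique h1 (h3.congr' ?_)
  filter_upwards [eventually_ge_atTop 0] with R hR
  exact (h2 R hR).symm

/-! ### The Hermite polynomial as an integral over a vertical segment -/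

/-- The exponential wraps the segment once around the circle, with `dz = i z dy`; periodicity moves
`[-π, π]` to the standard range `[0, 2π]`. -/
theorem vertIntegral_eq_circleIntegral (F : ℂ → ℂ) (R : ℝ) :
    vertIntegral (fun L => Complex.exp L * F (Complex.exp L)) R =
      -Complex.I * ∮ z in C(0, Real.exp R), F z := by
  have hexp : ∀ y : ℝ, Complex.exp (R + y * Complex.I) = circleMap 0 (Real.exp R) y := by
    intro y; rw [circleMap, Complex.exp_add, Complex.ofReal_exp]; ring
  rw [vertIntegral, circleIntegral]
  simp_rw [hexp, deriv_circleMap]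
  have hper : Function.Periodic (fun y => circleMap 0 (Real.exp R) y *
      F (circleMap 0 (Real.exp R) y)) (2 * Real.pi) := fun y => by
    simp only [periodic_circleMap 0 (Real.exp R) y]
  have := hper.intervalIntegral_add_eq (-Real.pi) 0
  rw [show -Real.pi + 2 * Real.pi = Real.pi by ring, zero_add] at this
  rw [this, ← intervalIntegral.integral_const_mul]
  refine intervalIntegral.integral_congr fun y _ => ?_
  simp only [smul_eq_mul]
  linear_combination (circleMap 0 (Real.exp R) y *
    F (circleMap 0 (Real.exp R) y)) * Complex.I_sq

theorem norm_vertIntegral_le {φ : ℂ → ℂ} {R C : ℝ}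
    (h : ∀ y : ℝ, |y| ≤ Real.pi → ‖φ (R + y * Complex.I)‖ ≤ C) :
    ‖vertIntegral φ R‖ ≤ C * (2 * Real.pi) := by
  have hpi := Real.pi_pos
  have := intervalIntegral.norm_integral_le_of_norm_le_const (a := -Real.pi) (b := Real.pi)
    (f := fun y : ℝ => φ (R + y * Complex.I)) (C := C) fun y hy => h y ?_
  · rw [show Real.pi - -Real.pi = 2 * Real.pi by ring, abs_of_pos (by linarith)] at this
    exact this
  · rw [uIoc_of_le (by linarith)] at hy
    exact abs_le.mpr ⟨hy.1.le, hy.2⟩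

/-- This is the generating function of the Hermite polynomials in Rodrigues form; the induction step
is `He_{n+1} = x He_n - He_n'`. At `t = 0` with `a = N` and `c = √2 √N` the argument becomes `√2
√N`, as `hermiteH` requires. -/
theorem iteratedDeriv_exp_quadratic {a c : ℂ} (hc : c ^ 2 = 2 * a) (n : ℕ) :
    iteratedDeriv n (fun t : ℂ => Complex.exp (2 * a * t - a * t ^ 2)) =
      fun t => c ^ n * aeval (c * (1 - t)) (hermite n) * Complex.exp (2 * a * t - a * t ^ 2) := by
  induction n with
  | zero => ext t; simp [hermite_zero]
  | succ n ih =>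
    ext t
    rw [iteratedDeriv_succ, ih]
    have h1 : HasDerivAt (fun t : ℂ => Complex.exp (2 * a * t - a * t ^ 2))
        (Complex.exp (2 * a * t - a * t ^ 2) * (2 * a - 2 * a * t)) t := by
      have e0 : HasDerivAt (fun z : ℂ => z) 1 t := hasDerivAt_id _
      refine ((e0.const_mul (2 * a)).sub ((e0.pow 2).const_mul a)).cexp.congr_deriv ?_
      simp; ring_nf
    have h2 : HasDerivAt (fun t : ℂ => aeval (c * (1 - t)) (hermite n))
        (aeval (c * (1 - t)) (derivative (hermite n)) * -c) t := by
      have e0 : HasDerivAt (fun z : ℂ => c * (1 - z)) (-c) t := by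
        have := ((hasDerivAt_id t).const_sub 1).const_mul c
        simpa using this
      exact (Polynomial.hasDerivAt_aeval (hermite n) (c * (1 - t))).comp t e0
    have h3 : HasDerivAt (fun t => c ^ n * aeval (c * (1 - t)) (hermite n) *
        Complex.exp (2 * a * t - a * t ^ 2)) _ t := (h2.const_mul (c ^ n)).mul h1
    rw [h3.deriv, hermite_succ]
    simp only [map_sub, map_mul, aeval_X]
    linear_combination -(c ^ n * aeval (c * (1 - t)) (hermite n) *
      Complex.exp (2 * a * t - a * t ^ 2) * (1 - t)) * hc

/-- Cauchy's formula for the Hermite polynomials, in the coordinate `L = ln z`. -/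
theorem vertIntegral_hermite (n : ℕ) {N : ℝ} (hN : 0 ≤ N) (R : ℝ) :
    vertIntegral (fun L => Complex.exp (-(n * L)) *
      Complex.exp (2 * N * Complex.exp L - N * Complex.exp L ^ 2)) R =
      2 * Real.pi * Real.sqrt N ^ n * hermiteH n (Real.sqrt N) / n.factorial := by
  have h := vertIntegral_eq_circleIntegral (fun z => (1 / (z - 0) ^ (n + 1)) •
    Complex.exp (2 * N * z - N * z ^ 2)) R
  rw [(show Differentiable ℂ fun z : ℂ => Complex.exp (2 * N * z - N * z ^ 2) by
    fun_prop).differentiableOn.circleIntegral_one_div_sub_center_pow_smul (Real.exp_pos R) n,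
    iteratedDeriv_exp_quadratic (c := Real.sqrt 2 * Real.sqrt N)] at h
  · rw [show (fun L => Complex.exp (-(n * L)) *
        Complex.exp (2 * N * Complex.exp L - N * Complex.exp L ^ 2)) = fun L => Complex.exp L *
        (1 / (Complex.exp L - 0) ^ (n + 1)) •
          Complex.exp (2 * N * Complex.exp L - N * Complex.exp L ^ 2) from ?_, h, hermiteH]
    · have he : aeval (Real.sqrt 2 * Real.sqrt N * (1 - 0) : ℂ) (hermite n) =
          ((aeval (Real.sqrt 2 * Real.sqrt N) (hermite n) : ℝ) : ℂ) := by
        rw [sub_zero, mul_one, ← Complex.ofReal_mul]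
        exact aeval_algebraMap_apply (A := ℝ) ℂ _ _
      beta_reduce
      rw [he]
      simp only [mul_zero, ne_eq, OfNat.ofNat_ne_zero, not_false_eq_true, zero_pow, sub_zero,
        Complex.exp_zero, smul_eq_mul]
      have : (n.factorial : ℂ) ≠ 0 := by exact_mod_cast n.factorial_ne_zero
      push_cast
      field_simp
      rw [Complex.I_sq]
      ring
    · funext L
      have := Complex.exp_ne_zero L
      rw [Complex.exp_neg, Complex.exp_nat_mul, sub_zero, smul_eq_mul]
      field_simp
      ring
  · rw [mul_pow, ← Complex.ofReal_pow, ← Complex.ofReal_pow, Real.sq_sqrt hN,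
      Real.sq_sqrt (by norm_num)]
    norm_num

theorem exp_mul_phase_saddleLog (N : ℝ) :
    Complex.exp (N * phase saddleLog) =
      ((Real.exp (-(3 * N / 4)) * 2 ^ (-(N / 2)) : ℝ) : ℂ) := by
  rw [phase, exp_saddleLog, saddleLog, Real.rpow_def_of_pos (by norm_num), ← Real.exp_add,
    Complex.ofReal_exp]
  congr 1
  push_cast
  ring

/-- The choice `N = 2n+1` makes `e^(-nL) = e^(L/2) e^(-NL/2)`, which supplies exactly the logarithm
in the phase. The value does not depend on `R`. -/
theorem vertIntegral_exp_phase (n : ℕ) {N : ℝ} (hN : N = 2 * n + 1) (R : ℝ) :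
    vertIntegral (fun L => Complex.exp (L / 2) *
      Complex.exp (-(N * (phase L - phase saddleLog)))) R =
      ((Real.exp (-(3 * N / 4)) * 2 ^ (-(N / 2)) *
      (2 * Real.pi * Real.sqrt N ^ n * hermiteH n (Real.sqrt N) / n.factorial) : ℝ) : ℂ) := by
  have hN0 : 0 ≤ N := by rw [hN]; positivity
  rw [Complex.ofReal_mul, ← exp_mul_phase_saddleLog]
  have := vertIntegral_hermite n hN0 R
  push_cast
  rw [← this, vertIntegral, vertIntegral, ← intervalIntegral.integral_const_mul]
  refine intervalIntegral.integral_congr fun y _ => ?_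
  simp only [← Complex.exp_add]
  congr 1
  rw [phase, hN]
  push_cast
  ring

/-! ### The branch `V` of the cube root: on the cut, at infinity and at the origin -/

/-- The cube root of `f(z) - f(1/2)` at `z = e^L` that is real for real `z > 0`. -/
noncomputable def realRoot (L : ℂ) : ℂ :=
  (Complex.exp L - 1 / 2) * cubicQuot L ^ (1 / 3 : ℂ)

theorem cubeRoot_eq (L : ℂ) :
    cubeRoot L = Complex.exp (-(2 * Real.pi * Complex.I / 3)) * realRoot L := by
  rw [cubeRoot, realRoot, mul_assoc]

theorem realRoot_eq (L : ℂ) :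
    realRoot L = Complex.exp (2 * Real.pi * Complex.I / 3) * cubeRoot L := by
  rw [cubeRoot_eq, ← mul_assoc, ← Complex.exp_add, add_neg_cancel, Complex.exp_zero, one_mul]

theorem realRoot_cube {L : ℂ} (hL : |L.im| ≤ Real.pi) :
    realRoot L ^ 3 = phase L - phase saddleLog := by
  rw [realRoot_eq, mul_pow, cubeRoot_cube hL, ← Complex.exp_nat_mul]
  have : Complex.exp ((3 : ℕ) * (2 * Real.pi * Complex.I / 3)) = 1 :=
    Complex.exp_eq_one_iff.mpr ⟨1, by push_cast; ring⟩
  rw [this, one_mul]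

theorem continuousOn_realRoot : ContinuousOn realRoot {L | |L.im| ≤ Real.pi} := by
  have : realRoot = fun L => Complex.exp (2 * Real.pi * Complex.I / 3) * cubeRoot L :=
    funext realRoot_eq
  rw [this]
  exact continuousOn_const.mul continuousOn_cubeRoot

theorem differentiableAt_realRoot {L : ℂ} (hL : |L.im| ≤ Real.pi) (h : L ≠ saddleLog) :
    DifferentiableAt ℂ realRoot L := by
  have : realRoot = fun L => Complex.exp (2 * Real.pi * Complex.I / 3) * cubeRoot L :=
    funext realRoot_eq
  rw [this]
  exact (differentiableAt_cubeRoot_of_ne hL fun h' => h (eq_saddleLog hL h')).const_mul _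

theorem cpow_third_eq_exp {q : ℂ} (hq : q ∈ Complex.slitPlane) :
    q ^ (1 / 3 : ℂ) = Complex.exp (Complex.log q / 3) := by
  rw [Complex.cpow_def_of_ne_zero (Complex.slitPlane_ne_zero hq)]
  congr 1; ring

theorem abs_im_log_div_three_lt {q : ℂ} (hq : q ∈ Complex.slitPlane) :
    |(Complex.log q / 3).im| < Real.pi / 3 := by
  have h1 : (Complex.log q / 3).im = q.arg / 3 := by
    rw [show (3 : ℂ) = ((3 : ℝ) : ℂ) by norm_num, Complex.div_ofReal_im, Complex.log_im]
  have h2 := Complex.neg_pi_lt_arg q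
  have h3 := (Complex.arg_le_pi q).lt_of_ne (Complex.mem_slitPlane_iff_arg.mp hq).1
  rw [h1, abs_lt]
  constructor <;> linarith

theorem realRoot_ne_zero {L : ℂ} (hL : |L.im| ≤ Real.pi) (h : L ≠ saddleLog) :
    realRoot L ≠ 0 := by
  have h' : Complex.exp L ≠ 1 / 2 := fun h' => h (eq_saddleLog hL h')
  rw [realRoot, cpow_third_eq_exp (cubicQuot_mem_slitPlane hL h')]
  exact mul_ne_zero (sub_ne_zero.mpr h') (Complex.exp_ne_zero _)

/-- The open sector of opening angle `2π/3` around the negative real axis. -/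
def leftSector : Set ℂ := {V | ∃ W : ℂ, |W.im| < Real.pi / 3 ∧ V = -Complex.exp W}

/-- The open sector of opening angle `4π/3` around the positive real axis. -/
def rightSector : Set ℂ := {V | ∃ W : ℂ, |W.im| < 2 * Real.pi / 3 ∧ V = Complex.exp W}

theorem exp_of_abs_im_eq_pi {L : ℂ} (hL : |L.im| = Real.pi) :
    Complex.exp L = ((-Real.exp L.re : ℝ) : ℂ) := by
  have hc : Real.cos L.im = -1 := by rw [← Real.cos_abs, hL, Real.cos_pi]
  have hs : Real.sin L.im = 0 := by
    rcases abs_eq Real.pi_pos.le |>.mp hL with h0 | h0 <;> simp [h0]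
  apply Complex.ext
  · rw [Complex.exp_re, hc, Complex.ofReal_re]; ring
  · rw [Complex.exp_im, hs, Complex.ofReal_im]; ring

theorem ne_saddleLog_of_abs_im_eq_pi {L : ℂ} (hL : |L.im| = Real.pi) : L ≠ saddleLog := by
  rintro rfl
  rw [saddleLog_im, abs_zero] at hL
  exact Real.pi_pos.ne hL

/-- On the cut `e^L - 1/2` is a negative real number, and the principal cube root of a point of the
slit plane has argument of modulus less than `π/3`. -/
theorem realRoot_mem_leftSector_of_abs_im_eq_pi {L : ℂ} (hL : |L.im| = Real.pi) :
    realRoot L ∈ leftSector := by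
  have hne : Complex.exp L ≠ 1 / 2 :=
    fun h => ne_saddleLog_of_abs_im_eq_pi hL (eq_saddleLog hL.le h)
  have hq := cubicQuot_mem_slitPlane hL.le hne
  have hpos : 0 < Real.exp L.re + 1 / 2 := by positivity
  refine ⟨(Real.log (Real.exp L.re + 1 / 2) : ℂ) + Complex.log (cubicQuot L) / 3, ?_, ?_⟩
  · rw [Complex.add_im, Complex.ofReal_im, zero_add]
    exact abs_im_log_div_three_lt hq
  · rw [Complex.exp_add, ← cpow_third_eq_exp hq, ← Complex.ofReal_exp, Real.exp_log hpos, realRoot,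
      exp_of_abs_im_eq_pi hL]
    push_cast
    ring

theorem phase_sub_phase_saddleLog (L : ℂ) : phase L - phase saddleLog =
    Complex.exp L ^ 2 - 2 * Complex.exp L + L / 2 + 3 / 4 + (Real.log 2 : ℂ) / 2 := by
  rw [phase, phase, exp_saddleLog, saddleLog]
  ring

theorem realRoot_cube_of_abs_im_eq_pi {L : ℂ} (hL : |L.im| = Real.pi) :
    realRoot L ^ 3 = ((Real.exp L.re ^ 2 + 2 * Real.exp L.re + L.re / 2 + 3 / 4 +
      Real.log 2 / 2 : ℝ) : ℂ) + ((L.im / 2 : ℝ) : ℂ) * Complex.I := by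
  rw [realRoot_cube hL.le, phase_sub_phase_saddleLog, exp_of_abs_im_eq_pi hL]
  have := Complex.re_add_im L
  push_cast
  linear_combination -this / 2

/-- Since `z` is real on the cut, only the term `L/2` of the phase has an imaginary part. This
constancy is the source of the explicit remainder bound and of the lower bound for `|V|` near the
origin. -/
theorem abs_im_realRoot_cube {L : ℂ} (hL : |L.im| = Real.pi) :
    |(realRoot L ^ 3).im| = Real.pi / 2 := by
  rw [realRoot_cube_of_abs_im_eq_pi hL, Complex.add_im, Complex.ofReal_im, Complex.im_ofReal_mul,
    Complex.I_im, mul_one, zero_add, abs_div, hL, abs_two]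

theorem pi_div_two_le_norm_realRoot_cube {L : ℂ} (hL : |L.im| = Real.pi) :
    Real.pi / 2 ≤ ‖realRoot L‖ ^ 3 := by
  rw [← norm_pow, ← abs_im_realRoot_cube hL]
  exact Complex.abs_im_le_norm _

theorem exp_le_norm_realRoot_cube {L : ℂ} (hL : |L.im| = Real.pi) (h0 : 0 ≤ L.re) :
    Real.exp L.re ^ 2 ≤ ‖realRoot L‖ ^ 3 := by
  rw [← norm_pow]
  refine le_trans ?_ ((le_abs_self _).trans (Complex.abs_re_le_norm _))
  rw [realRoot_cube_of_abs_im_eq_pi hL]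
  simp only [Complex.add_re, Complex.ofReal_re, Complex.re_ofReal_mul, Complex.I_re, mul_zero,
    add_zero]
  have := Real.log_nonneg (show (1 : ℝ) ≤ 2 by norm_num)
  have := Real.exp_pos L.re
  linarith

theorem norm_phase_mul_exp_sub_one_le {L : ℂ} (hL : |L.im| ≤ Real.pi) (h0 : 0 ≤ L.re) :
    ‖(phase L - phase saddleLog) * Complex.exp (-2 * L) - 1‖ ≤ 7 * Real.exp (-L.re) := by
  have e1 : (phase L - phase saddleLog) * Complex.exp (-2 * L) - 1 =
      (-2 * Complex.exp L + L / 2 + 3 / 4 + (Real.log 2 : ℂ) / 2) * Complex.exp (-L) ^ 2 := by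
    rw [phase_sub_phase_saddleLog, show (-2 : ℂ) * L = (2 : ℕ) * (-L) by push_cast; ring,
      Complex.exp_nat_mul]
    have : Complex.exp L * Complex.exp (-L) = 1 := by
      rw [← Complex.exp_add, add_neg_cancel, Complex.exp_zero]
    linear_combination (Complex.exp L * Complex.exp (-L) + 1) * this
  have hx : 1 ≤ Real.exp L.re := Real.one_le_exp h0
  have hx2 : L.re ≤ Real.exp L.re := by linarith [Real.add_one_le_exp L.re]
  have hLn : ‖L‖ ≤ L.re + Real.pi := by
    refine (Complex.norm_le_abs_re_add_abs_im L).trans ?_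
    rw [abs_of_nonneg h0]; linarith
  have hlog : Real.log 2 ≤ 1 := by
    have := Real.log_le_sub_one_of_pos (show (0 : ℝ) < 2 by norm_num); linarith
  have hlog0 : 0 ≤ Real.log 2 := Real.log_nonneg (by norm_num)
  have hpi := Real.pi_lt_four
  rw [e1, norm_mul, norm_pow, Complex.norm_exp, Complex.neg_re]
  have h2 : ‖-2 * Complex.exp L + L / 2 + 3 / 4 + (Real.log 2 : ℂ) / 2‖ ≤
      7 * Real.exp L.re := by
    refine (norm_add₄_le (E := ℂ)).trans ?_
    rw [norm_mul, norm_div, norm_div, norm_div, Complex.norm_exp, Complex.norm_real,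
      Real.norm_of_nonneg hlog0]
    norm_num
    linarith
  have h3 : Real.exp L.re * Real.exp (-L.re) = 1 := by
    rw [← Real.exp_add, add_neg_cancel, Real.exp_zero]
  calc _ ≤ 7 * Real.exp L.re * Real.exp (-L.re) ^ 2 := by gcongr
    _ = 7 * (Real.exp L.re * Real.exp (-L.re)) * Real.exp (-L.re) := by ring
    _ = _ := by rw [h3, mul_one]

/-- The other two cube roots of unity, which are the zeros of `g^2 + g + 1`, lie in the left
half-plane, so this factor of `g^3 - 1` stays away from zero when `Re g > 0`. The bound `1/4` is not
sharp. -/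
theorem norm_sub_one_le_of_cube {g : ℂ} (hg : 0 < g.re) : ‖g - 1‖ ≤ 4 * ‖g ^ 3 - 1‖ := by
  have h1 : g ^ 3 - 1 = (g - 1) * (g ^ 2 + g + 1) := by ring
  have h2 : 1 / 4 ≤ ‖g ^ 2 + g + 1‖ := by
    rw [← abs_of_pos (show (0 : ℝ) < 1 / 4 by norm_num),
      ← abs_of_nonneg (norm_nonneg (g ^ 2 + g + 1)), ← sq_le_sq, ← Complex.normSq_eq_norm_sq,
      Complex.normSq_apply]
    simp only [pow_two, Complex.add_re, Complex.mul_re, Complex.one_re, Complex.add_im,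
      Complex.mul_im, Complex.one_im]
    generalize g.re = x at *
    generalize g.im = y
    nlinarith [sq_nonneg (x * y), sq_nonneg (y ^ 2 - 3 / 4), sq_nonneg y, pow_pos hg 2,
      pow_pos hg 3, pow_pos hg 4, mul_nonneg hg.le (sq_nonneg y)]
  rw [h1, norm_mul]
  nlinarith [norm_nonneg (g - 1)]

theorem realRoot_re_pos_of_real {t : ℝ} (ht : 0 ≤ t) : 0 < (realRoot t).re := by
  have hx : 1 ≤ Real.exp t := Real.one_le_exp ht
  have hne : Complex.exp (t : ℂ) ≠ 1 / 2 := by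
    rw [← Complex.ofReal_exp]
    intro h
    have := congrArg Complex.re h
    rw [Complex.ofReal_re] at this
    norm_num at this
    linarith
  have hq := cubicQuot_mem_slitPlane (L := t) (by simp [Real.pi_pos.le]) hne
  have h3 := abs_lt.mp (abs_im_log_div_three_lt hq)
  rw [realRoot, cpow_third_eq_exp hq, ← Complex.ofReal_exp,
    show ((Real.exp t : ℂ) - 1 / 2) = ((Real.exp t - 1 / 2 : ℝ) : ℂ) by push_cast; ring,
    Complex.re_ofReal_mul, Complex.exp_re]
  have hpi := Real.pi_pos
  have := Real.cos_pos_of_mem_Ioo (x := (Complex.log (cubicQuot t) / 3).im)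
    ⟨by linarith, by linarith⟩
  have := Real.exp_pos (Complex.log (cubicQuot t) / 3).re
  have : 0 < Real.exp t - 1 / 2 := by linarith
  positivity

/-- `w ~ z^(2/3)` at infinity, uniformly in the closed cut plane. -/
theorem exists_realRoot_eq_exp {ε : ℝ} (hε : 0 < ε) : ∃ R : ℝ, 0 ≤ R ∧ ∀ L : ℂ, R ≤ L.re →
    |L.im| ≤ Real.pi → ∃ δ : ℂ, ‖δ‖ ≤ ε ∧ realRoot L = Complex.exp (2 * L / 3 + δ) := by
  have hpi := Real.pi_pos
  -- The chain `|g^3 - 1| ≤ η`, `|g - 1| ≤ 4η`, `|log g| ≤ 6η` asks for `ε/6`; the logarithm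
  -- estimate needs `4η ≤ 1/2`.
  set η := min (ε / 6) (1 / 8) with hη
  have hη0 : 0 < η := lt_min (by positivity) (by norm_num)
  have hlim : ∀ᶠ t : ℝ in atTop, 7 * Real.exp (-t) < η := by
    have : Tendsto (fun t : ℝ => 7 * Real.exp (-t)) atTop (𝓝 (7 * 0)) :=
      Real.tendsto_exp_neg_atTop_nhds_zero.const_mul 7
    rw [mul_zero] at this
    exact this.eventually_lt_const hη0
  obtain ⟨R, hR0, hR⟩ := (hlim.and (eventually_ge_atTop (0 : ℝ))).exists
  refine ⟨R, hR, ?_⟩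
  set X : Set ℂ := {L | R ≤ L.re ∧ |L.im| ≤ Real.pi} with hX
  have hXc : IsPreconnected X := by
    have : X = Complex.re ⁻¹' Ici R ∩ Complex.im ⁻¹' Icc (-Real.pi) Real.pi := by
      ext L; simp [hX, abs_le]
    rw [this]
    exact (((convex_Ici R).linear_preimage Complex.reLm).inter
      ((convex_Icc _ _).linear_preimage Complex.imLm)).isPreconnected
  set g : ℂ → ℂ := fun L => realRoot L * Complex.exp (-(2 * L / 3)) with hg
  have hg3 : ∀ L ∈ X, ‖g L ^ 3 - 1‖ ≤ η := by
    intro L hL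
    have : g L ^ 3 = (phase L - phase saddleLog) * Complex.exp (-2 * L) := by
      rw [hg, mul_pow, realRoot_cube hL.2, ← Complex.exp_nat_mul]
      congr 2; push_cast; ring
    rw [this]
    refine (norm_phase_mul_exp_sub_one_le hL.2 (hR.trans hL.1)).trans (le_trans ?_ hR0.le)
    have := hL.1
    gcongr
  have hgc : ContinuousOn (fun L => (g L).re) X := by
    refine Complex.continuous_re.comp_continuousOn ?_
    refine ContinuousOn.mul (continuousOn_realRoot.mono fun L hL => hL.2) ?_
    fun_prop
  -- The branch is identified by connectedness: a purely imaginary `g` has a purely imaginary cube,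
  -- which cannot be near `1`. Hence `Re g` has one sign on the half-strip, the one found at the
  -- real point `R`.
  have hne : ∀ L ∈ X, (g L).re ≠ 0 := by
    intro L hL h0
    have h1 := hg3 L hL
    have h2 : (g L ^ 3 - 1).re = -1 := by
      simp [pow_succ, h0]
    have h3 := Complex.abs_re_le_norm (g L ^ 3 - 1)
    rw [h2, abs_neg, abs_one] at h3
    have : η ≤ 1 / 8 := min_le_right _ _
    linarith
  have hRX : (R : ℂ) ∈ X := by simp [hX, hpi.le]
  have hpos : ∀ L ∈ X, 0 < (g L).re := by
    intro L hL
    by_contra hn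
    have hR' : 0 < (g R).re := by
      have : Complex.exp (-(2 * (R : ℂ) / 3)) = ((Real.exp (-(2 * R / 3)) : ℝ) : ℂ) := by
        push_cast; rfl
      rw [hg]
      simp only
      rw [this, Complex.re_mul_ofReal]
      exact mul_pos (realRoot_re_pos_of_real hR) (Real.exp_pos _)
    obtain ⟨L', hL', h0⟩ := hXc.intermediate_value hL hRX hgc ⟨not_lt.mp hn, hR'.le⟩
    exact hne L' hL' h0
  intro L hL1 hL2
  have hL : L ∈ X := ⟨hL1, hL2⟩
  have h1 : ‖g L - 1‖ ≤ 4 * η :=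
    (norm_sub_one_le_of_cube (hpos L hL)).trans (by linarith [hg3 L hL])
  have h2 : ‖Complex.log (1 + (g L - 1))‖ ≤ 3 / 2 * ‖g L - 1‖ :=
    Complex.norm_log_one_add_half_le_self (h1.trans (by linarith [min_le_right (ε / 6) (1 / 8)]))
  refine ⟨Complex.log (1 + (g L - 1)), h2.trans ?_, ?_⟩
  · have : η ≤ ε / 6 := min_le_left _ _
    linarith
  · have : 1 + (g L - 1) ≠ 0 := by
      intro h0
      have h3 := hpos L hL
      rw [show g L = 0 by linear_combination h0] at h3
      simp at h3
    rw [Complex.exp_add, Complex.exp_log this, hg]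
    have : Complex.exp (2 * L / 3) * Complex.exp (-(2 * L / 3)) = 1 := by
      rw [← Complex.exp_add, add_neg_cancel, Complex.exp_zero]
    linear_combination -(realRoot L) * this

/-- The behaviour of `w` at the origin. -/
theorem exists_realRoot_mem_leftSector : ∃ R : ℝ, ∀ L : ℂ, L.re ≤ R → |L.im| ≤ Real.pi →
    realRoot L ∈ leftSector ∧ (realRoot L ^ 3).re ≤ 0 ∧ 1 ≤ ‖realRoot L‖ := by
  have hpi := Real.pi_gt_three
  have hlog : Real.log 2 ≤ 1 := by
    have := Real.log_le_sub_one_of_pos (show (0 : ℝ) < 2 by norm_num); linarith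
  have hlog0 : 0 ≤ Real.log 2 := Real.log_nonneg (by norm_num)
  have hlim : ∀ᶠ t : ℝ in atBot, Real.exp t < 1 / 80 :=
    Real.tendsto_exp_atBot.eventually_lt_const (by norm_num)
  -- With `Re L ≤ -12` the term `L/2` has real part at most `-6`, which outweighs all bounded terms
  -- of the phase; `1/80` keeps those in `z` small.
  obtain ⟨R, hR0, hR⟩ := (hlim.and (eventually_le_atBot (-12 : ℝ))).exists
  refine ⟨R, fun L hL1 hL2 => ?_⟩
  have hz : ‖Complex.exp L‖ ≤ 1 / 80 := by
    rw [Complex.norm_exp]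
    exact (Real.exp_le_exp.mpr hL1).trans hR0.le
  have hne : Complex.exp L ≠ 1 / 2 := by
    intro h; rw [h] at hz; norm_num at hz
  have hq := cubicQuot_mem_slitPlane hL2 hne
  -- the phase is `L / 2` up to a bounded term
  have hre : (realRoot L ^ 3).re ≤ -4 ∧ |(realRoot L ^ 3).im| ≤ 2 := by
    have hi := abs_le.mp hL2
    have hb : ‖Complex.exp L ^ 2 - 2 * Complex.exp L‖ ≤ 17 / 64 := by
      refine (norm_sub_le _ _).trans ?_
      rw [norm_pow, norm_mul]
      norm_num
      nlinarith [norm_nonneg (Complex.exp L)]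
    have hb1 := abs_le.mp ((Complex.abs_re_le_norm _).trans hb)
    have hb2 := abs_le.mp ((Complex.abs_im_le_norm _).trans hb)
    have e : realRoot L ^ 3 = (Complex.exp L ^ 2 - 2 * Complex.exp L) + L / (2 : ℝ) +
        ((3 / 4 + Real.log 2 / 2 : ℝ) : ℂ) := by
      rw [realRoot_cube hL2, phase_sub_phase_saddleLog]; push_cast; ring
    rw [e, Complex.add_re, Complex.add_re, Complex.add_im, Complex.add_im, Complex.div_ofReal_re,
      Complex.div_ofReal_im, Complex.ofReal_re, Complex.ofReal_im]
    have := Real.pi_lt_d2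
    refine ⟨by linarith, abs_le.mpr ⟨by linarith, by linarith⟩⟩
  refine ⟨?_, by linarith [hre.1], ?_⟩
  · set u : ℂ := -(2 * Complex.exp L) with hu
    have hun : ‖u‖ ≤ 1 / 40 := by
      rw [hu, norm_neg, norm_mul]; norm_num; linarith
    have hl1 : ‖Complex.log (1 + u)‖ ≤ 3 / 2 * ‖u‖ :=
      Complex.norm_log_one_add_half_le_self (by linarith)
    have h1u : 1 + u ≠ 0 := by
      intro h
      rw [show u = -1 by linear_combination h] at hun
      norm_num at hun
    have h3q : realRoot L ^ 3 = (-(1 + u) / 2) ^ 3 * cubicQuot L := by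
      have hc : (cubicQuot L ^ (1 / 3 : ℂ)) ^ 3 = cubicQuot L := by
        have := Complex.cpow_nat_inv_pow (cubicQuot L) (n := 3) (by norm_num)
        simpa only [Nat.cast_ofNat, one_div] using this
      rw [realRoot, mul_pow, hc, hu]
      ring
    -- The quotient times `(1+u)^3 = 1+e` equals `-8 V^3`, which lies well inside the right
    -- half-plane. With positive real part its cube root has argument below `π/6`, leaving room for
    -- the small argument of `1+u`.
    have hqre : 0 < (cubicQuot L).re := by
      set e : ℂ := u * (3 + 3 * u + u ^ 2) with he
      have hen : ‖e‖ ≤ 1 / 8 := by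
        have : ‖3 + 3 * u + u ^ 2‖ ≤ 5 := by
          refine (norm_add₃_le).trans ?_
          rw [norm_mul, norm_pow]
          norm_num
          nlinarith [norm_nonneg u]
        rw [he, norm_mul]
        nlinarith [norm_nonneg u]
      have e1 : (1 + e) * cubicQuot L = -8 * realRoot L ^ 3 := by rw [h3q, he]; ring
      have hre1 := congrArg Complex.re e1
      have him1 := congrArg Complex.im e1
      rw [Complex.mul_re] at hre1
      rw [Complex.mul_im] at him1
      have er : (-8 * realRoot L ^ 3).re = -8 * (realRoot L ^ 3).re := by simp
      have ei : (-8 * realRoot L ^ 3).im = -8 * (realRoot L ^ 3).im := by simp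
      rw [er] at hre1
      rw [ei] at him1
      have h1 := abs_le.mp ((Complex.abs_re_le_norm _).trans hen)
      have h2 := abs_le.mp ((Complex.abs_im_le_norm _).trans hen)
      have h4 := abs_le.mp hre.2
      have h5 := hre.1
      simp only [Complex.add_re, Complex.add_im, Complex.one_re, Complex.one_im, zero_add]
        at hre1 him1
      generalize (realRoot L ^ 3).re = a at *
      generalize (realRoot L ^ 3).im = b at *
      generalize (cubicQuot L).re = x at *
      generalize (cubicQuot L).im = y at *
      generalize e.re = r at *
      generalize e.im = s at *
      have h6 : ((1 + r) ^ 2 + s ^ 2) * x = -8 * a * (1 + r) - 8 * b * s := by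
        linear_combination (1 + r) * hre1 + s * him1
      have h7 : 0 < -8 * a * (1 + r) - 8 * b * s := by
        have : |b * s| ≤ 2 * (1 / 8) := by
          rw [abs_mul]
          exact mul_le_mul hre.2 (abs_le.mpr h2) (abs_nonneg _) (by norm_num)
        have := abs_le.mp this
        nlinarith
      rw [← h6] at h7
      exact pos_of_mul_pos_right h7 (by positivity)
    have harg : |(cubicQuot L).arg| < Real.pi / 2 :=
      Complex.abs_arg_lt_pi_div_two_iff.mpr (Or.inl hqre)
    refine ⟨-(Real.log 2 : ℂ) + Complex.log (1 + u) + Complex.log (cubicQuot L) / 3, ?_, ?_⟩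
    · have h1 : (Complex.log (cubicQuot L) / 3).im = (cubicQuot L).arg / 3 := by
        rw [show (3 : ℂ) = ((3 : ℝ) : ℂ) by norm_num, Complex.div_ofReal_im, Complex.log_im]
      have h2 := abs_le.mp ((Complex.abs_im_le_norm _).trans hl1)
      have h3 := abs_lt.mp harg
      rw [Complex.add_im, Complex.add_im, Complex.neg_im, Complex.ofReal_im, h1, abs_lt]
      constructor <;> linarith
    · rw [Complex.exp_add, Complex.exp_add, ← cpow_third_eq_exp hq, Complex.exp_log h1u, realRoot,
        show -(Real.log 2 : ℂ) = saddleLog from rfl, exp_saddleLog, hu]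
      ring
  · by_contra hn
    have h1 : ‖realRoot L‖ ^ 3 ≤ 1 := pow_le_one₀ (norm_nonneg _) (not_le.mp hn).le
    rw [← norm_pow] at h1
    have := (Complex.abs_re_le_norm _).trans h1
    have := (abs_le.mp this).1
    linarith [hre.1]

/-! ### Moments and Stieltjes transforms of `e^(-N ρ^3)` -/

/-- The moment `∫_0^∞ ρ^k e^(-N ρ^3) dρ`. -/
noncomputable def moment (N : ℝ) (k : ℕ) : ℝ :=
  ∫ ρ in Ioi (0 : ℝ), ρ ^ k * Real.exp (-(N * ρ ^ 3))

/-- The Stieltjes transform `∫_0^∞ ρ^k e^(-N ρ^3) / (ρ + u) dρ`. -/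
noncomputable def stieltjes (N : ℝ) (k : ℕ) (u : ℂ) : ℂ :=
  ∫ ρ in Ioi (0 : ℝ), ((ρ ^ k * Real.exp (-(N * ρ ^ 3)) : ℝ) : ℂ) / (ρ + u)

section

variable {N : ℝ}

theorem integrableOn_moment (hN : 0 < N) (k : ℕ) :
    IntegrableOn (fun ρ : ℝ => ρ ^ k * Real.exp (-(N * ρ ^ 3))) (Ioi 0) := by
  have := integrableOn_rpow_mul_exp_neg_mul_rpow (p := 3) (s := k) (b := N)
    (by linarith [(Nat.cast_nonneg k : (0 : ℝ) ≤ k)]) (by norm_num) hN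
  refine this.congr_fun (fun ρ _ => ?_) measurableSet_Ioi
  simp only [Real.rpow_natCast, neg_mul]
  congr 4
  exact_mod_cast Real.rpow_natCast ρ 3

theorem moment_eq (hN : 0 < N) (k : ℕ) :
    moment N k = Real.Gamma (((k : ℝ) + 1) / 3) / (3 * N ^ (((k : ℝ) + 1) / 3)) := by
  have := integral_rpow_mul_exp_neg_mul_rpow (p := 3) (q := k) (b := N) (by norm_num)
    (by linarith [(Nat.cast_nonneg k : (0 : ℝ) ≤ k)]) hN
  have e : moment N k = ∫ x in Ioi (0 : ℝ), x ^ (k : ℝ) * Real.exp (-N * x ^ (3 : ℝ)) := by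
    refine setIntegral_congr_fun measurableSet_Ioi fun ρ _ => ?_
    simp only [Real.rpow_natCast, neg_mul]
    congr 4
    exact_mod_cast (Real.rpow_natCast ρ 3).symm
  rw [e, this, neg_div, Real.rpow_neg hN.le]
  field_simp

theorem moment_nonneg (N : ℝ) (k : ℕ) : 0 ≤ moment N k := by
  refine setIntegral_nonneg measurableSet_Ioi fun ρ hρ => ?_
  have : (0 : ℝ) < ρ := hρ
  positivity

/-- The reflection formula at `1/3`. This product is what makes the constants of integration of the
differential equation explicit multiples of `πi`. -/
theorem moment_zero_mul_moment_one (hN : 0 < N) :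
    3 * N * Real.sqrt 3 * (moment N 0 * moment N 1) = 2 * Real.pi / 3 := by
  have hG := Real.Gamma_mul_Gamma_one_sub (1 / 3)
  rw [show Real.pi * (1 / 3) = Real.pi / 3 by ring, Real.sin_pi_div_three] at hG
  rw [moment_eq hN, moment_eq hN]
  norm_num at hG ⊢
  have hp : N ^ (1 / 3 : ℝ) * N ^ (2 / 3 : ℝ) = N := by
    rw [← Real.rpow_add hN]; norm_num
  have h3 : Real.sqrt 3 ^ 2 = 3 := Real.sq_sqrt (by norm_num)
  have h30 : Real.sqrt 3 ≠ 0 := by positivity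
  have h1 : N ^ (1 / 3 : ℝ) ≠ 0 := by positivity
  have h2 : N ^ (2 / 3 : ℝ) ≠ 0 := by positivity
  have e : 3 * N * Real.sqrt 3 * (Real.Gamma (1 / 3) / (3 * N ^ (1 / 3 : ℝ)) *
      (Real.Gamma (2 / 3) / (3 * N ^ (2 / 3 : ℝ)))) =
      3 * N * Real.sqrt 3 * (Real.Gamma (1 / 3) * Real.Gamma (2 / 3)) /
        (9 * (N ^ (1 / 3 : ℝ) * N ^ (2 / 3 : ℝ))) := by
    field_simp; ring
  rw [e, hG, hp]
  field_simp
  ring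

/-- The slit plane is open and contains no `-ρ` with `ρ ≥ 0`. Uniformity in `u'` is what
differentiation under the integral sign needs. -/
theorem exists_le_norm_add {u : ℂ} (hu : u ∈ Complex.slitPlane) :
    ∃ δ > 0, ∀ u' ∈ Metric.ball u δ, ∀ ρ : ℝ, 0 ≤ ρ → δ ≤ ‖(ρ : ℂ) + u'‖ := by
  obtain ⟨ε, hε, hb⟩ := Metric.isOpen_iff.mp Complex.isOpen_slitPlane u hu
  refine ⟨ε / 2, by positivity, fun u' hu' ρ hρ => ?_⟩
  by_contra hn
  have h1 : ((-ρ : ℝ) : ℂ) ∈ Metric.ball u ε := by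
    rw [Metric.mem_ball] at hu' ⊢
    have h2 : dist ((-ρ : ℝ) : ℂ) u' = ‖(ρ : ℂ) + u'‖ := by
      rw [dist_eq_norm, ← norm_neg]; congr 1; push_cast; ring
    have := dist_triangle ((-ρ : ℝ) : ℂ) u' u
    rw [h2] at this
    linarith [not_le.mp hn]
  have h3 := hb h1
  rw [Complex.mem_slitPlane_iff, Complex.ofReal_re, Complex.ofReal_im] at h3
  rcases h3 with h | h
  · linarith
  · exact h rfl

theorem add_ne_zero_of_mem_slitPlane {u : ℂ} (hu : u ∈ Complex.slitPlane) {ρ : ℝ} (hρ : 0 ≤ ρ) :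
    (ρ : ℂ) + u ≠ 0 := by
  obtain ⟨δ, h0, h⟩ := exists_le_norm_add hu
  have := h u (Metric.mem_ball_self h0) ρ hρ
  exact norm_pos_iff.mp (by linarith)

theorem aestronglyMeasurable_stieltjes (N : ℝ) (k m : ℕ) (u : ℂ) :
    AEStronglyMeasurable (fun ρ : ℝ => ((ρ ^ k * Real.exp (-(N * ρ ^ 3)) : ℝ) : ℂ) / (ρ + u) ^ m)
      (volume.restrict (Ioi 0)) := by
  refine Measurable.aestronglyMeasurable ?_
  fun_prop

theorem norm_stieltjes_integrand_le {k m : ℕ} {u : ℂ} {δ ρ : ℝ} (hδ : 0 < δ) (hρ : 0 ≤ ρ)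
    (h : δ ≤ ‖(ρ : ℂ) + u‖) :
    ‖((ρ ^ k * Real.exp (-(N * ρ ^ 3)) : ℝ) : ℂ) / (ρ + u) ^ m‖ ≤
      1 / δ ^ m * (ρ ^ k * Real.exp (-(N * ρ ^ 3))) := by
  rw [norm_div, norm_pow, Complex.norm_real, Real.norm_of_nonneg (by positivity), div_eq_mul_inv,
    mul_comm, one_div]
  gcongr

theorem integrableOn_stieltjes (hN : 0 < N) (k m : ℕ) {u : ℂ} {δ : ℝ} (hδ : 0 < δ)
    (h : ∀ ρ : ℝ, 0 ≤ ρ → δ ≤ ‖(ρ : ℂ) + u‖) :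
    IntegrableOn (fun ρ : ℝ => ((ρ ^ k * Real.exp (-(N * ρ ^ 3)) : ℝ) : ℂ) / (ρ + u) ^ m)
      (Ioi 0) := by
  refine Integrable.mono' ((integrableOn_moment hN k).const_mul (1 / δ ^ m))
    (aestronglyMeasurable_stieltjes N k m u) ?_
  refine (ae_restrict_iff' measurableSet_Ioi).mpr (Eventually.of_forall fun ρ hρ => ?_)
  exact norm_stieltjes_integrand_le hδ (le_of_lt hρ) (h ρ (le_of_lt hρ))

theorem norm_stieltjes_le (hN : 0 < N) (k : ℕ) {u : ℂ} {δ : ℝ} (hδ : 0 < δ)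
    (h : ∀ ρ : ℝ, 0 ≤ ρ → δ ≤ ‖(ρ : ℂ) + u‖) : ‖stieltjes N k u‖ ≤ moment N k / δ := by
  have := norm_integral_le_of_norm_le (μ := volume.restrict (Ioi (0 : ℝ)))
    (f := fun ρ : ℝ => ((ρ ^ k * Real.exp (-(N * ρ ^ 3)) : ℝ) : ℂ) / (ρ + u))
    ((integrableOn_moment hN k).const_mul (1 / δ)) ?_
  · refine this.trans (le_of_eq ?_)
    rw [integral_const_mul, moment]; ring
  · refine (ae_restrict_iff' measurableSet_Ioi).mpr (Eventually.of_forall fun ρ hρ => ?_)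
    simpa using norm_stieltjes_integrand_le (N := N) (k := k) (m := 1) hδ (le_of_lt hρ)
      (h ρ (le_of_lt hρ))

/-- From `ρ/(ρ+u) = 1 - u/(ρ+u)`. Iterating it produces both the expansion at infinity and the
differential equation. -/
theorem stieltjes_succ (hN : 0 < N) (k : ℕ) {u : ℂ} (hu : u ∈ Complex.slitPlane) :
    stieltjes N (k + 1) u = moment N k - u * stieltjes N k u := by
  obtain ⟨δ, hδ, h⟩ := exists_le_norm_add hu
  have hi := integrableOn_stieltjes hN k 1 hδ (h u (Metric.mem_ball_self hδ))
  simp only [pow_one] at hi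
  have hm : IntegrableOn (fun ρ : ℝ => ((ρ ^ k * Real.exp (-(N * ρ ^ 3)) : ℝ) : ℂ)) (Ioi 0) :=
    (integrableOn_moment hN k).ofReal
  rw [moment, ← integral_complex_ofReal, stieltjes, stieltjes, ← integral_const_mul, ← integral_sub
    hm (hi.const_mul u)]
  refine setIntegral_congr_fun measurableSet_Ioi fun ρ hρ => ?_
  have := add_ne_zero_of_mem_slitPlane hu (le_of_lt hρ)
  push_cast
  field_simp
  ring

/-- The truncated expansion of the Stieltjes transform at infinity. -/
theorem stieltjes_zero_eq_sum (hN : 0 < N) (p : ℕ) {u : ℂ} (hu : u ∈ Complex.slitPlane) :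
    stieltjes N 0 u = ∑ j ∈ Finset.range p, (-1) ^ j * moment N j / u ^ (j + 1) +
      (-1) ^ p * stieltjes N p u / u ^ p := by
  have hu0 := Complex.slitPlane_ne_zero hu
  induction p with
  | zero => simp
  | succ p ih =>
    rw [ih, Finset.sum_range_succ, stieltjes_succ hN p hu]
    field_simp
    ring

theorem tendsto_exp_neg_cube (hN : 0 < N) :
    Tendsto (fun ρ : ℝ => Real.exp (-(N * ρ ^ 3))) atTop (𝓝 0) :=
  Real.tendsto_exp_neg_atTop_nhds_zero.comp
    ((tendsto_pow_atTop (by norm_num)).const_mul_atTop hN)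

/-- Differentiation under the integral gives the kernel `-(ρ+u)^(-2)`. Integration by parts moves
the derivative to the exponential: the boundary term at `ρ = 0` is `-1/u`, and the new factor `ρ^2`
is removed by applying `stieltjes_succ` twice. -/
theorem hasDerivAt_stieltjes (hN : 0 < N) {u : ℂ} (hu : u ∈ Complex.slitPlane) :
    HasDerivAt (stieltjes N 0)
      (-1 / u + 3 * N * (moment N 1 - u * moment N 0 + u ^ 2 * stieltjes N 0 u)) u := by
  obtain ⟨δ, hδ, h⟩ := exists_le_norm_add hu
  have hu0 := Complex.slitPlane_ne_zero hu
  have hself := h u (Metric.mem_ball_self hδ)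
  have hder := (hasDerivAt_integral_of_dominated_loc_of_deriv_le
    (μ := volume.restrict (Ioi (0 : ℝ))) (x₀ := u) (s := Metric.ball u δ)
    (F := fun v ρ => ((ρ ^ 0 * Real.exp (-(N * ρ ^ 3)) : ℝ) : ℂ) / (ρ + v))
    (F' := fun v ρ => -(((ρ ^ 0 * Real.exp (-(N * ρ ^ 3)) : ℝ) : ℂ) / (ρ + v) ^ 2))
    (bound := fun ρ => 1 / δ ^ 2 * (ρ ^ 0 * Real.exp (-(N * ρ ^ 3))))
    (Metric.ball_mem_nhds u hδ) ?_ ?_ ?_ ?_ ?_ ?_).2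
  · have hib : ∫ ρ in Ioi (0 : ℝ), (-(3 * N) * (((ρ ^ 2 * Real.exp (-(N * ρ ^ 3)) : ℝ) : ℂ) /
        (ρ + u)) + -(((ρ ^ 0 * Real.exp (-(N * ρ ^ 3)) : ℝ) : ℂ) / (ρ + u) ^ 2)) = -1 / u := by
      have := integral_Ioi_of_hasDerivAt_of_tendsto' (a := 0) (m := 0)
        (f := fun ρ : ℝ => ((Real.exp (-(N * ρ ^ 3)) : ℝ) : ℂ) / (ρ + u))
        (f' := fun ρ : ℝ => (-(3 * N) * (((ρ ^ 2 * Real.exp (-(N * ρ ^ 3)) : ℝ) : ℂ) /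
          (ρ + u)) + -(((ρ ^ 0 * Real.exp (-(N * ρ ^ 3)) : ℝ) : ℂ) / (ρ + u) ^ 2))) ?_ ?_ ?_
      · rw [this]; simp; ring
      · intro ρ hρ
        have hne := add_ne_zero_of_mem_slitPlane hu hρ
        have e1 : HasDerivAt (fun ρ : ℝ => Real.exp (-(N * ρ ^ 3)))
            (Real.exp (-(N * ρ ^ 3)) * -(N * (3 * ρ ^ 2))) ρ := by
          have := (((hasDerivAt_pow 3 ρ).const_mul N).neg).exp
          simpa using this
        have e2 : HasDerivAt (fun ρ : ℝ => (ρ : ℂ) + u) 1 ρ :=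
          (Complex.ofRealCLM.hasDerivAt (x := ρ)).add_const u
        refine (e1.ofReal_comp.div e2 hne).congr_deriv ?_
        push_cast
        field_simp
        ring
      · have i1 := integrableOn_stieltjes hN 2 1 hδ hself
        have i2 := integrableOn_stieltjes hN 0 2 hδ hself
        simp only [pow_one] at i1
        exact (i1.const_mul _).add i2.neg
      · rw [tendsto_zero_iff_norm_tendsto_zero]
        refine squeeze_zero' (Eventually.of_forall fun _ => norm_nonneg _) ?_
          (g := fun ρ => 1 / δ * Real.exp (-(N * ρ ^ 3))) ?_
        · filter_upwards [eventually_ge_atTop 0] with ρ hρ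
          simpa using norm_stieltjes_integrand_le (N := N) (k := 0) (m := 1) hδ hρ (hself ρ hρ)
        · simpa using (tendsto_exp_neg_cube hN).const_mul (1 / δ)
    rw [integral_add, integral_const_mul] at hib
    · have h2 : ∫ ρ in Ioi (0 : ℝ), ((ρ ^ 2 * Real.exp (-(N * ρ ^ 3)) : ℝ) : ℂ) / (ρ + u) =
          moment N 1 - u * moment N 0 + u ^ 2 * stieltjes N 0 u := by
        have := stieltjes_succ hN 1 hu
        rw [stieltjes_succ hN 0 hu] at this
        rw [← stieltjes, this]; ring
      rw [h2] at hib
      refine hder.congr_deriv ?_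
      linear_combination hib
    · have i1 := integrableOn_stieltjes hN 2 1 hδ hself
      simp only [pow_one] at i1
      exact i1.const_mul _
    · exact (integrableOn_stieltjes hN 0 2 hδ hself).neg
  · refine Eventually.of_forall fun v => ?_
    simpa using aestronglyMeasurable_stieltjes N 0 1 v
  · simpa [IntegrableOn] using integrableOn_stieltjes hN 0 1 hδ hself
  · exact (aestronglyMeasurable_stieltjes N 0 2 u).neg
  · refine (ae_restrict_iff' measurableSet_Ioi).mpr (Eventually.of_forall fun ρ hρ v hv => ?_)
    rw [norm_neg]
    exact norm_stieltjes_integrand_le hδ (le_of_lt hρ) (h v hv ρ (le_of_lt hρ))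
  · exact (integrableOn_moment hN 0).const_mul _
  · refine (ae_restrict_iff' measurableSet_Ioi).mpr (Eventually.of_forall fun ρ hρ v hv => ?_)
    have hne : (ρ : ℂ) + v ≠ 0 :=
      norm_pos_iff.mp (hδ.trans_le (h v hv ρ (le_of_lt hρ)))
    have e2 : HasDerivAt (fun v : ℂ => (ρ : ℂ) + v) 1 v := (hasDerivAt_id v).const_add _
    refine ((hasDerivAt_const v (((ρ ^ 0 * Real.exp (-(N * ρ ^ 3)) : ℝ) : ℂ))).div e2
      hne).congr_deriv ?_
    simp [neg_div]

/-! ### The Cauchy transform over the two rays and its entire continuation -/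

/-- The sixth root of unity `e^(πi/3)`. -/
noncomputable def sixthRoot : ℂ := Complex.exp (Real.pi / 3 * Complex.I)

/-- The sixth root of unity `e^(-πi/3)`. -/
noncomputable def sixthRoot' : ℂ := Complex.exp (-(Real.pi / 3 * Complex.I))

theorem sixthRoot_eq : sixthRoot = 1 / 2 + Real.sqrt 3 / 2 * Complex.I := by
  rw [sixthRoot, Complex.exp_mul_I, show (Real.pi / 3 : ℂ) = ((Real.pi / 3 : ℝ) : ℂ) by push_cast; rfl,
    ← Complex.ofReal_cos, ← Complex.ofReal_sin, Real.cos_pi_div_three, Real.sin_pi_div_three]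
  push_cast
  rfl

theorem sixthRoot'_eq : sixthRoot' = 1 / 2 - Real.sqrt 3 / 2 * Complex.I := by
  rw [sixthRoot', ← neg_mul, Complex.exp_mul_I,
    show (-(Real.pi / 3) : ℂ) = ((-(Real.pi / 3) : ℝ) : ℂ) by push_cast; rfl,
    ← Complex.ofReal_cos, ← Complex.ofReal_sin, Real.cos_neg, Real.sin_neg, Real.cos_pi_div_three,
    Real.sin_pi_div_three]
  push_cast
  ring

theorem sixthRoot_cube : sixthRoot ^ 3 = -1 := by
  rw [sixthRoot, ← Complex.exp_nat_mul, ← Complex.exp_pi_mul_I]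
  congr 1; push_cast; ring

theorem sixthRoot'_cube : sixthRoot' ^ 3 = -1 := by
  rw [sixthRoot', ← Complex.exp_nat_mul,
    show ((3 : ℕ) : ℂ) * -(Real.pi / 3 * Complex.I) = -(Real.pi * Complex.I) by push_cast; ring,
    Complex.exp_neg, Complex.exp_pi_mul_I]
  norm_num

theorem norm_sixthRoot : ‖sixthRoot‖ = 1 := by
  rw [sixthRoot, show (Real.pi / 3 : ℂ) = ((Real.pi / 3 : ℝ) : ℂ) by push_cast; rfl,
    Complex.norm_exp_ofReal_mul_I]

theorem norm_sixthRoot' : ‖sixthRoot'‖ = 1 := by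
  rw [sixthRoot', ← neg_mul,
    show (-(Real.pi / 3) : ℂ) = ((-(Real.pi / 3) : ℝ) : ℂ) by push_cast; rfl,
    Complex.norm_exp_ofReal_mul_I]

theorem exp_mem_slitPlane_of_abs_im_lt {W : ℂ} (h : |W.im| < Real.pi) :
    Complex.exp W ∈ Complex.slitPlane := by
  obtain ⟨h1, h2⟩ := abs_lt.mp h
  have := Complex.log_im (Complex.exp W)
  rw [Complex.log_exp h1 h2.le] at this
  exact Complex.mem_slitPlane_iff_arg.mpr ⟨by rw [← this]; exact h2.ne, Complex.exp_ne_zero W⟩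

/-- The product is a negative real number exactly when `V` is on the ray `arg V = 2π/3`, which
separates the two sectors and belongs to neither. -/
theorem sixthRoot_mul_mem_slitPlane {V : ℂ} (hV : V ∈ leftSector ∪ rightSector) :
    sixthRoot * V ∈ Complex.slitPlane := by
  have hpi := Real.pi_pos
  have him : (Real.pi / 3 * Complex.I : ℂ).im = Real.pi / 3 := by
    rw [show (Real.pi / 3 : ℂ) = ((Real.pi / 3 : ℝ) : ℂ) by push_cast; rfl]
    simp
  rcases hV with ⟨W, hW, rfl⟩ | ⟨W, hW, rfl⟩
  · have : sixthRoot * -Complex.exp W = Complex.exp (Real.pi / 3 * Complex.I + W -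
        Real.pi * Complex.I) := by
      rw [Complex.exp_sub, Complex.exp_add, Complex.exp_pi_mul_I, sixthRoot]; ring
    rw [this]
    refine exp_mem_slitPlane_of_abs_im_lt ?_
    rw [Complex.sub_im, Complex.add_im, him]
    simp only [Complex.im_ofReal_mul, Complex.I_im, mul_one]
    obtain ⟨h1, h2⟩ := abs_lt.mp hW
    exact abs_lt.mpr ⟨by linarith, by linarith⟩
  · rw [sixthRoot, ← Complex.exp_add]
    refine exp_mem_slitPlane_of_abs_im_lt ?_
    rw [Complex.add_im, him]
    obtain ⟨h1, h2⟩ := abs_lt.mp hW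
    exact abs_lt.mpr ⟨by linarith, by linarith⟩

theorem sixthRoot'_mul_mem_slitPlane {V : ℂ} (hV : V ∈ leftSector ∪ rightSector) :
    sixthRoot' * V ∈ Complex.slitPlane := by
  have hpi := Real.pi_pos
  have him : (-(Real.pi / 3 * Complex.I) : ℂ).im = -(Real.pi / 3) := by
    rw [show (Real.pi / 3 : ℂ) = ((Real.pi / 3 : ℝ) : ℂ) by push_cast; rfl]
    simp
  rcases hV with ⟨W, hW, rfl⟩ | ⟨W, hW, rfl⟩
  · have : sixthRoot' * -Complex.exp W = Complex.exp (-(Real.pi / 3 * Complex.I) + W +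
        Real.pi * Complex.I) := by
      rw [Complex.exp_add, Complex.exp_add, Complex.exp_pi_mul_I, sixthRoot']; ring
    rw [this]
    refine exp_mem_slitPlane_of_abs_im_lt ?_
    rw [Complex.add_im, Complex.add_im, him]
    simp only [Complex.im_ofReal_mul, Complex.I_im, mul_one]
    obtain ⟨h1, h2⟩ := abs_lt.mp hW
    exact abs_lt.mpr ⟨by linarith, by linarith⟩
  · rw [sixthRoot', ← Complex.exp_add]
    refine exp_mem_slitPlane_of_abs_im_lt ?_
    rw [Complex.add_im, him]
    obtain ⟨h1, h2⟩ := abs_lt.mp hW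
    exact abs_lt.mpr ⟨by linarith, by linarith⟩

/-- The integral `∫ e^(-N v^3) / (V - v) dv` over the two rays `arg v = ±2π/3`, from
`∞ e^(-2πi/3)` to `∞ e^(2πi/3)`. -/
noncomputable def rayTransform (N : ℝ) (V : ℂ) : ℂ :=
  stieltjes N 0 (sixthRoot' * V) - stieltjes N 0 (sixthRoot * V)

/-- The inhomogeneity of the differential equation of `rayTransform N`. -/
noncomputable def rayForcing (N : ℝ) (V : ℂ) : ℂ :=
  3 * N * Real.sqrt 3 * Complex.I * (moment N 0 * V - moment N 1)

/-- The terms `-1/u` of the two rays cancel because the rays meet at the origin. Since both roots of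
unity have cube `-1`, the two homogeneous terms acquire the same factor `-3 N V^2`, and the moments
combine into an entire inhomogeneity. -/
theorem hasDerivAt_rayTransform (hN : 0 < N) {V : ℂ} (hV : V ∈ leftSector ∪ rightSector) :
    HasDerivAt (rayTransform N) (rayForcing N V - 3 * N * V ^ 2 * rayTransform N V) V := by
  have h1 := hasDerivAt_stieltjes hN (sixthRoot_mul_mem_slitPlane hV)
  have h2 := hasDerivAt_stieltjes hN (sixthRoot'_mul_mem_slitPlane hV)
  have hb := right_ne_zero_of_mul (Complex.slitPlane_ne_zero (sixthRoot_mul_mem_slitPlane hV))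
  have hb1 := left_ne_zero_of_mul (Complex.slitPlane_ne_zero (sixthRoot_mul_mem_slitPlane hV))
  have hb2 := left_ne_zero_of_mul (Complex.slitPlane_ne_zero (sixthRoot'_mul_mem_slitPlane hV))
  have e1 : HasDerivAt (fun V : ℂ => sixthRoot * V) sixthRoot V := by
    simpa using (hasDerivAt_id V).const_mul sixthRoot
  have e2 : HasDerivAt (fun V : ℂ => sixthRoot' * V) sixthRoot' V := by
    simpa using (hasDerivAt_id V).const_mul sixthRoot'
  refine ((h2.comp V e2).sub (h1.comp V e1)).congr_deriv ?_
  have hr1 : -1 / (sixthRoot * V) * sixthRoot = -1 / V := by field_simp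
  have hr2 : -1 / (sixthRoot' * V) * sixthRoot' = -1 / V := by field_simp
  have hd : sixthRoot' - sixthRoot = -(Real.sqrt 3 * Complex.I) := by
    rw [sixthRoot_eq, sixthRoot'_eq]; ring
  have hs : sixthRoot' + sixthRoot = 1 := by
    rw [sixthRoot_eq, sixthRoot'_eq]; ring
  rw [add_mul, add_mul, hr1, hr2, rayForcing, rayTransform]
  linear_combination (3 * N * V ^ 2 * stieltjes N 0 (sixthRoot' * V)) * sixthRoot'_cube -
    (3 * N * V ^ 2 * stieltjes N 0 (sixthRoot * V)) * sixthRoot_cube +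
    (3 * N * (moment N 1 - V * moment N 0)) * hd -
    (3 * N * V * moment N 0 * (sixthRoot' - sixthRoot)) * hs

/-- For `ρ ≥ 2|V|` the triangle inequality suffices. Otherwise `ρ^3 - V^3` factors as `ρ + u` times
a factor of size at most `7|V|^2`, while the hypothesis keeps `V^3` at distance at least `|V|^3/2`
from the positive real axis. -/
theorem le_norm_add_of_cube {V u : ℂ} (hV : (V ^ 3).re ≤ ‖V‖ ^ 3 / 2) (hu : u ^ 3 = -V ^ 3)
    (hn : ‖u‖ = ‖V‖) {ρ : ℝ} (hρ : 0 ≤ ρ) : ‖V‖ / 14 ≤ ‖(ρ : ℂ) + u‖ := by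
  have hr := norm_nonneg V
  by_cases h : 2 * ‖V‖ ≤ ρ
  · have := norm_sub_le_norm_add (ρ : ℂ) u
    rw [Complex.norm_real, Real.norm_of_nonneg hρ, hn] at this
    linarith
  · have h := not_le.mp h
    have e1 : ((ρ ^ 3 : ℝ) : ℂ) - V ^ 3 = ((ρ : ℂ) + u) * (ρ ^ 2 - ρ * u + u ^ 2) := by
      push_cast; linear_combination -hu
    have e2 : ‖(ρ : ℂ) ^ 2 - ρ * u + u ^ 2‖ ≤ 7 * ‖V‖ ^ 2 := by
      refine (norm_add_le _ _).trans ((add_le_add_left (norm_sub_le _ _) _).trans ?_)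
      rw [norm_mul, norm_pow, norm_pow, Complex.norm_real, Real.norm_of_nonneg hρ, hn]
      nlinarith
    have e3 : ‖V‖ ^ 3 / 2 ≤ ‖((ρ ^ 3 : ℝ) : ℂ) - V ^ 3‖ := by
      rw [← abs_of_nonneg (show 0 ≤ ‖V‖ ^ 3 / 2 by positivity),
        ← abs_of_nonneg (norm_nonneg (((ρ ^ 3 : ℝ) : ℂ) - V ^ 3)), ← sq_le_sq,
        ← Complex.normSq_eq_norm_sq, Complex.normSq_apply, Complex.sub_re, Complex.sub_im,
        Complex.ofReal_re, Complex.ofReal_im]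
      have h1 : (V ^ 3).re * (V ^ 3).re + (V ^ 3).im * (V ^ 3).im = (‖V‖ ^ 3) ^ 2 := by
        rw [← Complex.normSq_apply, Complex.normSq_eq_norm_sq, norm_pow]
      have h2 : 0 ≤ ρ ^ 3 := by positivity
      generalize (V ^ 3).re = x at *
      generalize (V ^ 3).im = y at *
      generalize ‖V‖ ^ 3 = r at *
      generalize ρ ^ 3 = t at *
      nlinarith [sq_nonneg (t - r / 2), mul_le_mul_of_nonneg_left hV h2]
    rw [e1, norm_mul] at e3
    rcases hr.eq_or_lt with h0 | h0
    · rw [← h0]; simp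
    · have h4 : ‖V‖ ^ 3 / 2 ≤ ‖(ρ : ℂ) + u‖ * (7 * ‖V‖ ^ 2) :=
        e3.trans (mul_le_mul_of_nonneg_left e2 (norm_nonneg _))
      have h5 : 0 < ‖V‖ ^ 2 := by positivity
      by_contra hc
      nlinarith

theorem norm_rayTransform_le (hN : 0 < N) {V : ℂ} (h0 : V ≠ 0)
    (hV : (V ^ 3).re ≤ ‖V‖ ^ 3 / 2) : ‖rayTransform N V‖ ≤ 28 * moment N 0 / ‖V‖ := by
  have hr := norm_pos_iff.mpr h0
  have h1 := norm_stieltjes_le hN 0 (u := sixthRoot * V) (δ := ‖V‖ / 14) (by positivity)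
    fun ρ hρ => le_norm_add_of_cube hV (by rw [mul_pow, sixthRoot_cube]; ring)
      (by rw [norm_mul, norm_sixthRoot, one_mul]) hρ
  have h2 := norm_stieltjes_le hN 0 (u := sixthRoot' * V) (δ := ‖V‖ / 14) (by positivity)
    fun ρ hρ => le_norm_add_of_cube hV (by rw [mul_pow, sixthRoot'_cube]; ring)
      (by rw [norm_mul, norm_sixthRoot', one_mul]) hρ
  refine (norm_sub_le _ _).trans ((add_le_add h2 h1).trans (le_of_eq ?_))
  field_simp
  ring

/-- Primitive of `e^(N x^3)` times the inhomogeneity. -/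
theorem exists_rayPrimitive (N : ℝ) : ∃ J : ℂ → ℂ, J 0 = 0 ∧
    ∀ V, HasDerivAt J (Complex.exp (N * V ^ 3) * rayForcing N V) V := by
  have hd : Differentiable ℂ fun V : ℂ => Complex.exp (N * V ^ 3) * rayForcing N V := by
    unfold rayForcing; fun_prop
  obtain ⟨J, h0, hJ⟩ := hd.isExactOn_univ.with_val_at 0 0
  exact ⟨J, h0, fun V => hJ V (mem_univ V)⟩

theorem rayPrimitive_eq_integral {J : ℂ → ℂ} (h0 : J 0 = 0)
    (hJ : ∀ V, HasDerivAt J (Complex.exp (N * V ^ 3) * rayForcing N V) V) (V : ℂ) (R : ℝ) :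
    J (V * R) = ∫ t in (0 : ℝ)..R,
      Complex.exp (N * (V * t) ^ 3) * rayForcing N (V * t) * V := by
  have hder : ∀ t ∈ uIcc (0 : ℝ) R, HasDerivAt (fun t : ℝ => J (V * t))
      (Complex.exp (N * (V * t) ^ 3) * rayForcing N (V * t) * V) t := by
    intro t _
    have e : HasDerivAt (fun z : ℂ => V * z) V (t : ℂ) := by
      simpa using (hasDerivAt_id (t : ℂ)).const_mul V
    exact ((hJ (V * t)).comp (t : ℂ) e).comp_ofReal
  rw [intervalIntegral.integral_eq_sub_of_hasDerivAt hder]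
  · simp [h0]
  · refine Continuous.intervalIntegrable ?_ _ _
    unfold rayForcing
    fun_prop

/-- Along a ray on which `V^3` is negative the integrand of the primitive becomes a combination of
the integrands of the first two moments, so the limit involves only their product. -/
theorem tendsto_rayPrimitive (hN : 0 < N) {J : ℂ → ℂ} (h0 : J 0 = 0)
    (hJ : ∀ V, HasDerivAt J (Complex.exp (N * V ^ 3) * rayForcing N V) V) {β : ℂ}
    (hβ : β ^ 3 = -1) : Tendsto (fun R : ℝ => J (β * R)) atTop
      (𝓝 (2 * Real.pi / 3 * Complex.I * (β ^ 2 - β))) := by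
  simp_rw [rayPrimitive_eq_integral h0 hJ]
  have hm := moment_zero_mul_moment_one hN
  set κ : ℂ := 3 * N * Real.sqrt 3 * Complex.I with hκ
  have hint : ∀ k : ℕ, IntegrableOn (fun ρ : ℝ =>
      ((ρ ^ k * Real.exp (-(N * ρ ^ 3)) : ℝ) : ℂ)) (Ioi 0) :=
    fun k => (integrableOn_moment hN k).ofReal
  have heq : (fun t : ℝ => Complex.exp (N * (β * t) ^ 3) * rayForcing N (β * t) * β) =
      fun t : ℝ => κ * β ^ 2 * moment N 0 * ((t ^ 1 * Real.exp (-(N * t ^ 3)) : ℝ) : ℂ) -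
        κ * β * moment N 1 * ((t ^ 0 * Real.exp (-(N * t ^ 3)) : ℝ) : ℂ) := by
    funext t
    rw [mul_pow, hβ, rayForcing, ← hκ, show (N : ℂ) * (-1 * t ^ 3) = ((-(N * t ^ 3) : ℝ) : ℂ) by
      push_cast; ring]
    push_cast
    ring
  rw [heq]
  have hI := intervalIntegral_tendsto_integral_Ioi (0 : ℝ)
    (((hint 1).const_mul (κ * β ^ 2 * moment N 0)).sub ((hint 0).const_mul (κ * β * moment N 1)))
    tendsto_id
  refine hI.congr' (Eventually.of_forall fun _ => rfl) |>.trans (le_of_eq ?_)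
  congr 1
  rw [integral_sub' ((hint 1).const_mul _) ((hint 0).const_mul _), integral_const_mul,
    integral_const_mul, integral_complex_ofReal, integral_complex_ofReal]
  change κ * β ^ 2 * moment N 0 * moment N 1 - κ * β * moment N 1 * moment N 0 = _
  have hm' : (3 * N * Real.sqrt 3 * (moment N 0 * moment N 1) : ℂ) = 2 * Real.pi / 3 := by
    exact_mod_cast congrArg (fun x : ℝ => (x : ℂ)) hm
  rw [hκ]
  linear_combination (Complex.I * (β ^ 2 - β)) * hm'

/-- Variation of constants: `e^(N V^3)` is the integrating factor, so on each sector this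
combination is a constant of integration. -/
theorem hasDerivAt_variation (hN : 0 < N) {J : ℂ → ℂ}
    (hJ : ∀ V, HasDerivAt J (Complex.exp (N * V ^ 3) * rayForcing N V) V) {V : ℂ}
    (hV : V ∈ leftSector ∪ rightSector) :
    HasDerivAt (fun V => Complex.exp (N * V ^ 3) * rayTransform N V - J V) 0 V := by
  have e : HasDerivAt (fun V : ℂ => Complex.exp (N * V ^ 3))
      (Complex.exp (N * V ^ 3) * (N * (3 * V ^ 2))) V := by
    have := ((hasDerivAt_pow 3 V).const_mul (N : ℂ)).cexp
    simpa using this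
  refine ((e.mul (hasDerivAt_rayTransform hN hV)).sub (hJ V)).congr_deriv ?_
  ring

/-- The mean value inequality is applied on a convex strip, of which the sector is the exponential
image. -/
theorem eq_of_hasDerivAt_zero_comp_exp {Y : ℂ → ℂ} {σ : ℂ} {c : ℝ}
    (hY : ∀ W : ℂ, |W.im| < c → HasDerivAt Y 0 (σ * Complex.exp W)) {W W' : ℂ}
    (hW : |W.im| < c) (hW' : |W'.im| < c) :
    Y (σ * Complex.exp W) = Y (σ * Complex.exp W') := by
  have hconv : Convex ℝ {W : ℂ | |W.im| < c} := by
    have : {W : ℂ | |W.im| < c} = Complex.im ⁻¹' Ioo (-c) c := by ext; simp [abs_lt]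
    rw [this]
    exact (convex_Ioo _ _).linear_preimage Complex.imLm
  have hd : ∀ W : ℂ, |W.im| < c → HasDerivAt (fun W => Y (σ * Complex.exp W)) 0 W := by
    intro W hW
    have e : HasDerivAt (fun W : ℂ => σ * Complex.exp W) (σ * Complex.exp W) W :=
      (Complex.hasDerivAt_exp W).const_mul σ
    exact ((hY W hW).comp W e).congr_deriv (zero_mul _)
  have := hconv.norm_image_sub_le_of_norm_hasDerivWithin_le (C := 0)
    (f := fun W => Y (σ * Complex.exp W)) (fun W hW => (hd W hW).hasDerivWithinAt) (by simp)
    hW' hW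
  rw [zero_mul] at this
  exact sub_eq_zero.mp (norm_le_zero_iff.mp this)

theorem tendsto_variation (hN : 0 < N) {J : ℂ → ℂ} (h0 : J 0 = 0)
    (hJ : ∀ V, HasDerivAt J (Complex.exp (N * V ^ 3) * rayForcing N V) V) {β : ℂ}
    (hβ : β ^ 3 = -1) :
    Tendsto (fun R : ℝ => Complex.exp (N * (β * R) ^ 3) * rayTransform N (β * R) - J (β * R))
      atTop (𝓝 (-(2 * Real.pi / 3 * Complex.I * (β ^ 2 - β)))) := by
  have hβn : ‖β‖ = 1 := by
    have := congrArg norm hβ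
    rw [norm_pow, norm_neg, norm_one] at this
    exact (pow_eq_one_iff_of_nonneg (norm_nonneg _) (by norm_num)).mp this
  have hz : Tendsto (fun R : ℝ => Complex.exp (N * (β * R) ^ 3) * rayTransform N (β * R))
      atTop (𝓝 0) := by
    rw [tendsto_zero_iff_norm_tendsto_zero]
    refine squeeze_zero' (Eventually.of_forall fun _ => norm_nonneg _) ?_
      (g := fun R => Real.exp (-(N * R ^ 3)) * (28 * moment N 0)) ?_
    · filter_upwards [eventually_ge_atTop 1] with R hR
      have hR0 : (0 : ℝ) < R := by linarith
      have hn : ‖β * R‖ = R := by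
        rw [norm_mul, hβn, one_mul, Complex.norm_real, Real.norm_of_nonneg hR0.le]
      have hc : (β * R) ^ 3 = ((-(R ^ 3) : ℝ) : ℂ) := by
        rw [mul_pow, hβ]; push_cast; ring
      have hb := norm_rayTransform_le hN (V := β * R)
        (by rw [← norm_pos_iff, hn]; exact hR0)
        (by rw [hc, Complex.ofReal_re, hn]; have : 0 < R ^ 3 := by positivity
            linarith)
      rw [hn] at hb
      rw [norm_mul, hc, ← Complex.ofReal_mul, Complex.norm_exp_ofReal, mul_neg]
      refine mul_le_mul_of_nonneg_left (hb.trans (div_le_self ?_ hR)) (Real.exp_pos _).le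
      have := moment_nonneg N 0
      positivity
    · simpa using (tendsto_exp_neg_cube hN).mul_const (28 * moment N 0)
  simpa using hz.sub (tendsto_rayPrimitive hN h0 hJ hβ)

/-- The constant is read off at infinity along the negative axis, where the exponential kills the
transform and only the primitive has a nonzero limit. -/
theorem variation_left (hN : 0 < N) {J : ℂ → ℂ} (h0 : J 0 = 0)
    (hJ : ∀ V, HasDerivAt J (Complex.exp (N * V ^ 3) * rayForcing N V) V) {V : ℂ}
    (hV : V ∈ leftSector) :
    Complex.exp (N * V ^ 3) * rayTransform N V - J V = -(4 * Real.pi / 3 * Complex.I) := by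
  have hpi := Real.pi_pos
  obtain ⟨W, hW, rfl⟩ := hV
  have hlim := tendsto_variation hN h0 hJ (β := -1) (by norm_num)
  rw [show -(2 * Real.pi / 3 * Complex.I * ((-1) ^ 2 - -1)) = -(4 * Real.pi / 3 * Complex.I) by
    ring] at hlim
  refine tendsto_nhds_unique (tendsto_const_nhds.congr' ?_) hlim
  filter_upwards [eventually_gt_atTop 0] with R hR
  have := eq_of_hasDerivAt_zero_comp_exp (σ := -1) (c := Real.pi / 3)
    (Y := fun V => Complex.exp (N * V ^ 3) * rayTransform N V - J V) (W := W)
    (W' := (Real.log R : ℂ)) (fun W hW => hasDerivAt_variation hN hJ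
      (Or.inl ⟨W, hW, by ring⟩)) hW (by simpa using hpi)
  rw [← Complex.ofReal_exp, Real.exp_log hR] at this
  simpa only [neg_one_mul] using this

/-- Here the limit is taken along `arg V = π/3`, a ray of the right sector with `V^3 < 0`. The two
constants differ by `2πi`, the residue of the Cauchy kernel. -/
theorem variation_right (hN : 0 < N) {J : ℂ → ℂ} (h0 : J 0 = 0)
    (hJ : ∀ V, HasDerivAt J (Complex.exp (N * V ^ 3) * rayForcing N V) V) {V : ℂ}
    (hV : V ∈ rightSector) :
    Complex.exp (N * V ^ 3) * rayTransform N V - J V = 2 * Real.pi / 3 * Complex.I := by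
  have hpi := Real.pi_pos
  obtain ⟨W, hW, rfl⟩ := hV
  have hlim := tendsto_variation hN h0 hJ sixthRoot_cube
  have hb : sixthRoot ^ 2 - sixthRoot = -1 := by
    have h3 : (Real.sqrt 3 : ℂ) ^ 2 = 3 := by
      rw [← Complex.ofReal_pow, Real.sq_sqrt (by norm_num)]; norm_num
    rw [sixthRoot_eq]
    linear_combination ((Complex.I) ^ 2 / 4) * h3 + (3 / 4 : ℂ) * Complex.I_sq
  rw [hb, mul_neg_one, neg_neg] at hlim
  refine tendsto_nhds_unique (tendsto_const_nhds.congr' ?_) hlim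
  filter_upwards [eventually_gt_atTop 0] with R hR
  have := eq_of_hasDerivAt_zero_comp_exp (σ := 1) (c := 2 * Real.pi / 3)
    (Y := fun V => Complex.exp (N * V ^ 3) * rayTransform N V - J V) (W := W)
    (W' := Real.pi / 3 * Complex.I + (Real.log R : ℂ)) (fun W hW => hasDerivAt_variation hN hJ
      (Or.inr ⟨W, hW, by ring⟩)) hW ?_
  · rw [Complex.exp_add, ← Complex.ofReal_exp, Real.exp_log hR] at this
    simpa only [one_mul, sixthRoot] using this
  · rw [show (Real.pi / 3 : ℂ) = ((Real.pi / 3 : ℝ) : ℂ) by push_cast; rfl, Complex.add_im,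
      Complex.im_ofReal_mul, Complex.ofReal_im, Complex.I_im, mul_one, add_zero,
      abs_of_pos (by positivity)]
    linarith

theorem integral_exp_mul_sub_one_le {A : ℝ} (hA : 0 < A) :
    ∫ t in (0 : ℝ)..1, Real.exp (-(A * (1 - t))) ≤ 1 / A := by
  have hder : ∀ t ∈ uIcc (0 : ℝ) 1, HasDerivAt (fun t => Real.exp (-(A * (1 - t))) / A)
      (Real.exp (-(A * (1 - t)))) t := by
    intro t _
    have e : HasDerivAt (fun t : ℝ => -(A * (1 - t))) A t := by
      exact (((hasDerivAt_id t).const_sub 1).const_mul A).neg.congr_deriv (by ring)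
    refine (e.exp.div_const A).congr_deriv ?_
    field_simp
  rw [intervalIntegral.integral_eq_sub_of_hasDerivAt hder
    (Continuous.intervalIntegrable (by fun_prop) _ _)]
  have := Real.exp_pos (-(A * (1 - 0)))
  rw [sub_self, mul_zero, neg_zero, Real.exp_zero]
  have : 0 ≤ Real.exp (-(A * (1 - 0))) / A := by positivity
  linarith

/-- On the segment from `0` to `V` the exponential grows towards `V`, so the endpoint dominates:
integrating the exponential saves a factor of order `|V|^(-3)` against inhomogeneity and length,
which contribute `|V|` each. This covers the directions near `V^3 > 0`, including the two rays
themselves. -/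
theorem norm_exp_mul_rayPrimitive_le (hN : 0 < N) {J : ℂ → ℂ} (h0 : J 0 = 0)
    (hJ : ∀ V, HasDerivAt J (Complex.exp (N * V ^ 3) * rayForcing N V) V) : ∃ C : ℝ, ∀ V : ℂ,
      1 ≤ ‖V‖ → ‖V‖ ^ 3 / 2 ≤ (V ^ 3).re → ‖Complex.exp (-(N * V ^ 3)) * J V‖ ≤ C / ‖V‖ := by
  have hm0 := moment_nonneg N 0
  have hm1 := moment_nonneg N 1
  set κ : ℂ := 3 * N * Real.sqrt 3 * Complex.I with hκ
  refine ⟨2 * ‖κ‖ * (moment N 0 + moment N 1) / N, fun V hV1 hV => ?_⟩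
  set r := ‖V‖ with hr
  have hr0 : 0 < r := by linarith
  have hA : 0 < N * (r ^ 3 / 2) := by positivity
  have h1 := rayPrimitive_eq_integral h0 hJ V 1
  rw [Complex.ofReal_one, mul_one] at h1
  rw [h1, ← intervalIntegral.integral_const_mul]
  have hb : ∀ t ∈ Ioc (0 : ℝ) 1, ‖Complex.exp (-(N * V ^ 3)) *
      (Complex.exp (N * (V * t) ^ 3) * rayForcing N (V * t) * V)‖ ≤
      ‖κ‖ * (moment N 0 + moment N 1) * r ^ 2 * Real.exp (-(N * (r ^ 3 / 2) * (1 - t))) := by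
    rintro t ⟨ht0, ht1⟩
    have e1 : ‖rayForcing N (V * t)‖ ≤ ‖κ‖ * ((moment N 0 + moment N 1) * r) := by
      rw [rayForcing, ← hκ, norm_mul]
      refine mul_le_mul_of_nonneg_left ((norm_sub_le _ _).trans ?_) (norm_nonneg _)
      rw [norm_mul, norm_mul, Complex.norm_real, Complex.norm_real, Complex.norm_real,
        Real.norm_of_nonneg hm0, Real.norm_of_nonneg hm1, Real.norm_of_nonneg ht0.le, ← hr]
      have : r * t ≤ r := by nlinarith
      nlinarith [mul_le_mul_of_nonneg_left this hm0]
    have e2 : Complex.exp (-(N * V ^ 3)) * Complex.exp (N * (V * t) ^ 3) =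
        Complex.exp (((-(N * (1 - t ^ 3)) : ℝ) : ℂ) * V ^ 3) := by
      rw [← Complex.exp_add]; congr 1; push_cast; ring
    rw [← mul_assoc, ← mul_assoc, e2, norm_mul, norm_mul, Complex.norm_exp,
      Complex.re_ofReal_mul, ← hr]
    have e3 : -(N * (1 - t ^ 3)) * (V ^ 3).re ≤ -(N * (r ^ 3 / 2) * (1 - t)) := by
      have ht3 : t ^ 3 ≤ t := by
        have := pow_le_pow_of_le_one ht0.le ht1 (show 1 ≤ 3 by norm_num)
        simpa using this
      have h4 : 0 ≤ 1 - t ^ 3 := by linarith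
      have h5 := mul_le_mul_of_nonneg_left hV (mul_nonneg hN.le h4)
      have h6 := mul_le_mul_of_nonneg_left (show 1 - t ≤ 1 - t ^ 3 by linarith) hA.le
      nlinarith
    calc _ ≤ Real.exp (-(N * (r ^ 3 / 2) * (1 - t))) *
          (‖κ‖ * ((moment N 0 + moment N 1) * r)) * r := by gcongr
      _ = _ := by ring
  refine (intervalIntegral.norm_integral_le_of_norm_le zero_le_one
    (Eventually.of_forall hb) (Continuous.intervalIntegrable (by fun_prop) _ _)).trans ?_
  rw [intervalIntegral.integral_const_mul]
  refine (mul_le_mul_of_nonneg_left (integral_exp_mul_sub_one_le hA) (by positivity)).trans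
    (le_of_eq ?_)
  field_simp

/-- The analytic continuation of `rayTransform N` from the left sector is an entire function, and
its continuation from the right sector differs from it by `2πi e^(-N V^3)`. -/
theorem exists_entire_rayTransform (hN : 0 < N) : ∃ M : ℂ → ℂ, Differentiable ℂ M ∧
    (∀ V ∈ leftSector, M V = rayTransform N V) ∧
    ∃ C : ℝ, ∀ V : ℂ, 1 ≤ ‖V‖ → V ∈ rightSector ∨ ‖V‖ ^ 3 / 2 ≤ (V ^ 3).re →
      ‖M V + 2 * Real.pi * Complex.I * Complex.exp (-(N * V ^ 3))‖ ≤ C / ‖V‖ := by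
  obtain ⟨J, h0, hJ⟩ := exists_rayPrimitive N
  obtain ⟨C, hC⟩ := norm_exp_mul_rayPrimitive_le hN h0 hJ
  have hJd : Differentiable ℂ J := fun V => (hJ V).differentiableAt
  have hee : ∀ V : ℂ, Complex.exp (-(N * V ^ 3)) * Complex.exp (N * V ^ 3) = 1 := by
    intro V; rw [← Complex.exp_add, neg_add_cancel, Complex.exp_zero]
  have hm0 := moment_nonneg N 0
  have hpi := Real.pi_pos
  -- The general solution of the equation is entire; the constant `-4πi/3` selects the one that
  -- agrees with the transform in the left sector.
  refine ⟨fun V => Complex.exp (-(N * V ^ 3)) * (J V - 4 * Real.pi / 3 * Complex.I), by fun_prop,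
    fun V hV => ?_, 28 * moment N 0 + (C + 2 * Real.pi / 3 * (2 / N)), fun V hV1 hV => ?_⟩
  · have := variation_left hN h0 hJ hV
    linear_combination (-Complex.exp (-(N * V ^ 3))) * this + rayTransform N V * hee V
  · have hr : 0 < ‖V‖ := by linarith
    have e : Complex.exp (-(N * V ^ 3)) * (J V - 4 * Real.pi / 3 * Complex.I) +
        2 * Real.pi * Complex.I * Complex.exp (-(N * V ^ 3)) =
        Complex.exp (-(N * V ^ 3)) * J V +
          Complex.exp (-(N * V ^ 3)) * (2 * Real.pi / 3 * Complex.I) := by ring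
    have hC0 : 0 ≤ C := by
      have := (norm_nonneg _).trans (hC 1 (by simp) (by norm_num))
      simpa using this
    -- Near the directions with `V^3 > 0` the growth of the primitive is compensated by its
    -- exponential factor. Elsewhere the expression is the transform itself, and `V` keeps its
    -- distance from the rays.
    by_cases hc : ‖V‖ ^ 3 / 2 ≤ (V ^ 3).re
    · rw [e]
      have h1 : ‖Complex.exp (-(N * V ^ 3))‖ ≤ 2 / N / ‖V‖ := by
        rw [Complex.norm_exp, Complex.neg_re, Complex.re_ofReal_mul, Real.exp_neg]
        have h2 : N * ‖V‖ / 2 ≤ Real.exp (N * (V ^ 3).re) := by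
          have h3 := Real.add_one_le_exp (N * (V ^ 3).re)
          have h4 : ‖V‖ ≤ ‖V‖ ^ 3 := le_self_pow₀ hV1 (by norm_num)
          have h5 := mul_le_mul_of_nonneg_left (show ‖V‖ / 2 ≤ (V ^ 3).re by linarith) hN.le
          linarith
        calc _ ≤ (N * ‖V‖ / 2)⁻¹ := inv_anti₀ (by positivity) h2
          _ = _ := by field_simp
      refine (norm_add_le _ _).trans ?_
      rw [norm_mul _ (2 * Real.pi / 3 * Complex.I)]
      have h2 : ‖(2 * Real.pi / 3 * Complex.I : ℂ)‖ = 2 * Real.pi / 3 := by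
        rw [norm_mul, Complex.norm_I, mul_one, show (2 * Real.pi / 3 : ℂ) =
          ((2 * Real.pi / 3 : ℝ) : ℂ) by push_cast; rfl, Complex.norm_real,
          Real.norm_of_nonneg (by positivity)]
      rw [h2, add_div, add_div]
      have h3 : 0 ≤ 28 * moment N 0 / ‖V‖ := by positivity
      have h4 := mul_le_mul_of_nonneg_right h1 (show 0 ≤ 2 * Real.pi / 3 by positivity)
      have h5 : 2 / N / ‖V‖ * (2 * Real.pi / 3) = 2 * Real.pi / 3 * (2 / N) / ‖V‖ := by ring
      linarith [hC V hV1 hc]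
    · have hR := hV.resolve_right hc
      have h1 := variation_right hN h0 hJ hR
      have h2 : Complex.exp (-(N * V ^ 3)) * (J V - 4 * Real.pi / 3 * Complex.I) +
          2 * Real.pi * Complex.I * Complex.exp (-(N * V ^ 3)) = rayTransform N V := by
        linear_combination (-Complex.exp (-(N * V ^ 3))) * h1 + rayTransform N V * hee V
      rw [h2]
      refine (norm_rayTransform_le hN (norm_pos_iff.mp hr) (not_le.mp hc).le).trans ?_
      gcongr
      have : 0 ≤ 2 * Real.pi / 3 * (2 / N) := by positivity
      linarith

/-! ### Convergence and bounds of integrals along the cut -/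

theorem upperCut_im (s : ℝ) : (upperCut s).im = Real.pi := by simp [upperCut]

theorem lowerCut_im (s : ℝ) : (lowerCut s).im = -Real.pi := by simp [lowerCut]

theorem upperCut_re (s : ℝ) : (upperCut s).re = Real.log s := by simp [upperCut]

theorem lowerCut_re (s : ℝ) : (lowerCut s).re = Real.log s := by simp [lowerCut]

theorem abs_im_upperCut (s : ℝ) : |(upperCut s).im| = Real.pi := by
  rw [upperCut_im, abs_of_pos Real.pi_pos]

theorem abs_im_lowerCut (s : ℝ) : |(lowerCut s).im| = Real.pi := by
  rw [lowerCut_im, abs_neg, abs_of_pos Real.pi_pos]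

/-- The bound of `|z^(-1/2) / w(z)^q|` at the points of modulus `s` on the cut. -/
noncomputable def cutBound (q : ℕ) (s : ℝ) : ℝ :=
  if s ≤ 1 then s ^ (-(1 / 2) : ℝ) * (1 / (Real.pi / 2) ^ ((q : ℝ) / 3))
  else s ^ (-(1 / 2) - 2 * (q : ℝ) / 3)

theorem integral_cutBound {q : ℕ} (hq : 1 ≤ q) : IntegrableOn (cutBound q) (Ioi 0) ∧
    ∫ s in Ioi (0 : ℝ), cutBound q s =
      2 / (Real.pi / 2) ^ ((q : ℝ) / 3) + 6 / (4 * (q : ℝ) - 3) := by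
  have hq' : (1 : ℝ) ≤ q := by exact_mod_cast hq
  have hlt : -(1 / 2) - 2 * (q : ℝ) / 3 < -1 := by linarith
  set c : ℝ := 1 / (Real.pi / 2) ^ ((q : ℝ) / 3) with hc
  have e1 : EqOn (fun s : ℝ => s ^ (-(1 / 2) : ℝ) * c) (cutBound q) (Ioc 0 1) := by
    intro s hs
    simp only [cutBound, if_pos hs.2, hc]
  have e2 : EqOn (fun s : ℝ => s ^ (-(1 / 2) - 2 * (q : ℝ) / 3)) (cutBound q) (Ioi 1) := by
    intro s hs
    simp only [cutBound, if_neg (not_le.mpr (show (1 : ℝ) < s from hs))]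
  have i1 : IntegrableOn (cutBound q) (Ioc 0 1) := by
    refine IntegrableOn.congr_fun ?_ e1 measurableSet_Ioc
    have := intervalIntegral.intervalIntegrable_rpow' (a := 0) (b := 1)
      (show (-1 : ℝ) < -(1 / 2) by norm_num)
    rw [intervalIntegrable_iff_integrableOn_Ioc_of_le zero_le_one] at this
    exact this.mul_const c
  have i2 : IntegrableOn (cutBound q) (Ioi 1) :=
    (integrableOn_Ioi_rpow_of_lt hlt one_pos).congr_fun e2 measurableSet_Ioi
  have hu : Ioc (0 : ℝ) 1 ∪ Ioi 1 = Ioi 0 := Ioc_union_Ioi_eq_Ioi zero_le_one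
  refine ⟨by rw [← hu]; exact i1.union i2, ?_⟩
  rw [← hu, setIntegral_union (Ioc_disjoint_Ioi le_rfl) measurableSet_Ioi i1 i2,
    ← setIntegral_congr_fun measurableSet_Ioc e1, ← setIntegral_congr_fun measurableSet_Ioi e2,
    integral_Ioi_rpow_of_lt hlt one_pos, ← intervalIntegral.integral_of_le zero_le_one,
    intervalIntegral.integral_mul_const, integral_rpow (Or.inl (by norm_num)), hc]
  have h4 : 4 * (q : ℝ) - 3 ≠ 0 := by intro h; linarith
  have h5 : -(1 / 2) - 2 * (q : ℝ) / 3 + 1 = -((4 * q - 3) / 6) := by ring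
  rw [Real.one_rpow, Real.one_rpow, Real.zero_rpow (by norm_num), h5]
  field_simp
  ring

theorem norm_realRoot_pow_ge {L : ℂ} (hL : |L.im| = Real.pi) (q : ℕ) :
    (Real.pi / 2) ^ ((q : ℝ) / 3) ≤ ‖realRoot L‖ ^ q := by
  have h := pi_div_two_le_norm_realRoot_cube hL
  have hpi := Real.pi_pos
  have := Real.rpow_le_rpow (z := (q : ℝ) / 3) (by positivity) h (by positivity)
  rwa [← Real.rpow_natCast, ← Real.rpow_mul (norm_nonneg _),
    show ((3 : ℕ) : ℝ) * ((q : ℝ) / 3) = q by push_cast; ring, Real.rpow_natCast] at this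

/-- Two lower bounds of `|V|^3` are used: its imaginary part `π/2` for `s ≤ 1`, and its real part,
at least `s^2`, for `s > 1`. -/
theorem norm_div_realRoot_pow_le {L : ℂ} (hL : |L.im| = Real.pi) (q : ℕ) :
    ‖Complex.exp (-L / 2)‖ / ‖realRoot L‖ ^ q ≤ cutBound q (Real.exp L.re) := by
  have hpi := Real.pi_pos
  have e1 : ‖Complex.exp (-L / 2)‖ = Real.exp L.re ^ (-(1 / 2) : ℝ) := by
    rw [Complex.norm_exp, ← Real.exp_mul]
    congr 1
    rw [show (2 : ℂ) = ((2 : ℝ) : ℂ) by norm_num, Complex.div_ofReal_re, Complex.neg_re]; ring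
  rw [e1, cutBound]
  split_ifs with h
  · rw [div_eq_mul_one_div]
    have := norm_realRoot_pow_ge hL q
    gcongr
  · have h0 : 0 ≤ L.re := by
      by_contra hn
      exact h (Real.exp_le_one_iff.mpr (not_le.mp hn).le)
    have h1 := exp_le_norm_realRoot_cube hL h0
    have h2 := Real.rpow_le_rpow (z := (q : ℝ) / 3) (by positivity) h1 (by positivity)
    rw [← Real.rpow_natCast, ← Real.rpow_mul (Real.exp_pos _).le, ← Real.rpow_natCast ‖realRoot L‖,
      ← Real.rpow_mul (norm_nonneg _),
      show ((3 : ℕ) : ℝ) * ((q : ℝ) / 3) = q by push_cast; ring, Real.rpow_natCast,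
      show ((2 : ℕ) : ℝ) * ((q : ℝ) / 3) = 2 * q / 3 by push_cast; ring] at h2
    rw [Real.rpow_sub (Real.exp_pos _)]
    gcongr

/-- The two sides of the cut. -/
def cutSides : Set ℂ := {L | |L.im| = Real.pi}

theorem continuousOn_comp_upperCut {h : ℂ → ℂ} (hc : ContinuousOn h cutSides) :
    ContinuousOn (fun s : ℝ => h (upperCut s)) (Ioi 0) := by
  refine hc.comp ?_ fun s _ => abs_im_upperCut s
  unfold upperCut
  refine ContinuousOn.add ?_ continuousOn_const
  exact Complex.continuous_ofReal.comp_continuousOn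
    (Real.continuousOn_log.mono fun s hs => (ne_of_gt hs : s ≠ 0))

theorem continuousOn_comp_lowerCut {h : ℂ → ℂ} (hc : ContinuousOn h cutSides) :
    ContinuousOn (fun s : ℝ => h (lowerCut s)) (Ioi 0) := by
  refine hc.comp ?_ fun s _ => abs_im_lowerCut s
  unfold lowerCut
  refine ContinuousOn.sub ?_ continuousOn_const
  exact Complex.continuous_ofReal.comp_continuousOn
    (Real.continuousOn_log.mono fun s hs => (ne_of_gt hs : s ≠ 0))

/-- Used both for the single terms `z^(-1/2) V^(-j)` and for the remainder of the expansion. The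
factor `2` counts the sides of the cut. -/
theorem cutIntegrable_of_bound {h : ℂ → ℂ} {B : ℝ} {q : ℕ} (hq : 1 ≤ q)
    (hc : ContinuousOn h cutSides)
    (hb : ∀ L ∈ cutSides, ‖h L‖ ≤ B * (‖Complex.exp (-L / 2)‖ / ‖realRoot L‖ ^ q))
    (hB : 0 ≤ B) : CutIntegrable h ∧ ‖cutIntegral h‖ ≤
      2 * (B * (2 / (Real.pi / 2) ^ ((q : ℝ) / 3) + 6 / (4 * (q : ℝ) - 3))) := by
  obtain ⟨hi, he⟩ := integral_cutBound hq
  have hu : ∀ᵐ s ∂volume.restrict (Ioi (0 : ℝ)), ‖h (upperCut s)‖ ≤ B * cutBound q s := by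
    refine (ae_restrict_iff' measurableSet_Ioi).mpr (Eventually.of_forall fun s hs => ?_)
    have := norm_div_realRoot_pow_le (abs_im_upperCut s) q
    rw [upperCut_re, Real.exp_log hs] at this
    exact (hb _ (abs_im_upperCut s)).trans (mul_le_mul_of_nonneg_left this hB)
  have hl : ∀ᵐ s ∂volume.restrict (Ioi (0 : ℝ)), ‖h (lowerCut s)‖ ≤ B * cutBound q s := by
    refine (ae_restrict_iff' measurableSet_Ioi).mpr (Eventually.of_forall fun s hs => ?_)
    have := norm_div_realRoot_pow_le (abs_im_lowerCut s) q
    rw [lowerCut_re, Real.exp_log hs] at this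
    exact (hb _ (abs_im_lowerCut s)).trans (mul_le_mul_of_nonneg_left this hB)
  have h1 := norm_integral_le_of_norm_le (hi.const_mul B) hu
  have h2 := norm_integral_le_of_norm_le (hi.const_mul B) hl
  refine ⟨⟨Integrable.mono' (hi.const_mul B)
    ((continuousOn_comp_upperCut hc).aestronglyMeasurable measurableSet_Ioi) hu,
    Integrable.mono' (hi.const_mul B)
    ((continuousOn_comp_lowerCut hc).aestronglyMeasurable measurableSet_Ioi) hl⟩, ?_⟩
  rw [integral_const_mul, he] at h1 h2
  refine (norm_sub_le _ _).trans ?_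
  linarith

/-- The function `z^(-1/2) / v(z)^j`, where `v = e^(2πi/3) w`, at `z = e^L`. -/
noncomputable def rootIntegrand (j : ℕ) (L : ℂ) : ℂ := Complex.exp (-L / 2) / realRoot L ^ j

theorem coeffIntegrand_eq (j : ℕ) (L : ℂ) : coeffIntegrand j L =
    Complex.exp (2 * Real.pi * Complex.I * j / 3) * rootIntegrand j L := by
  have h : Complex.exp (-(2 * Real.pi * Complex.I / 3)) ^ j =
      (Complex.exp (2 * Real.pi * Complex.I * j / 3))⁻¹ := by
    rw [← Complex.exp_nat_mul, ← Complex.exp_neg]; congr 1; ring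
  rw [coeffIntegrand, rootIntegrand, cubeRoot_eq, mul_pow, h]
  have := Complex.exp_ne_zero (2 * Real.pi * Complex.I * j / 3)
  field_simp

theorem continuousOn_rootIntegrand (j : ℕ) : ContinuousOn (rootIntegrand j) cutSides := by
  refine ContinuousOn.div (by fun_prop) ((continuousOn_realRoot.mono fun L hL => ?_).pow j)
    fun L hL => pow_ne_zero j (realRoot_ne_zero ?_ (ne_saddleLog_of_abs_im_eq_pi hL))
  · exact le_of_eq hL
  · exact le_of_eq hL

theorem cutIntegrable_rootIntegrand {j : ℕ} (hj : 1 ≤ j) : CutIntegrable (rootIntegrand j) :=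
  (cutIntegrable_of_bound (B := 1) hj (continuousOn_rootIntegrand j)
    (fun L _ => by rw [rootIntegrand, norm_div, norm_pow, one_mul]) zero_le_one).1

theorem CutIntegrable.const_mul {h : ℂ → ℂ} (hh : CutIntegrable h) (c : ℂ) :
    CutIntegrable fun L => c * h L := ⟨hh.1.const_mul c, hh.2.const_mul c⟩

theorem CutIntegrable.add {h k : ℂ → ℂ} (hh : CutIntegrable h) (hk : CutIntegrable k) :
    CutIntegrable fun L => h L + k L := ⟨hh.1.add hk.1, hh.2.add hk.2⟩

theorem cutIntegrable_sum {ι : Type*} {s : Finset ι} {h : ι → ℂ → ℂ}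
    (hh : ∀ i ∈ s, CutIntegrable (h i)) : CutIntegrable fun L => ∑ i ∈ s, h i L :=
  ⟨integrable_finsetSum s fun i hi => (hh i hi).1, integrable_finsetSum s fun i hi => (hh i hi).2⟩

theorem cutIntegral_const_mul (c : ℂ) (h : ℂ → ℂ) :
    cutIntegral (fun L => c * h L) = c * cutIntegral h := by
  rw [cutIntegral, cutIntegral, integral_const_mul, integral_const_mul, mul_sub]

theorem cutIntegral_add {h k : ℂ → ℂ} (hh : CutIntegrable h) (hk : CutIntegrable k) :
    cutIntegral (fun L => h L + k L) = cutIntegral h + cutIntegral k := by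
  rw [cutIntegral, cutIntegral, cutIntegral, integral_add hh.1 hk.1, integral_add hh.2 hk.2]
  ring

theorem cutIntegral_sum {ι : Type*} {s : Finset ι} {h : ι → ℂ → ℂ}
    (hh : ∀ i ∈ s, CutIntegrable (h i)) :
    cutIntegral (fun L => ∑ i ∈ s, h i L) = ∑ i ∈ s, cutIntegral (h i) := by
  simp only [cutIntegral]
  rw [integral_finsetSum s fun i hi => (hh i hi).1, integral_finsetSum s fun i hi => (hh i hi).2,
    Finset.sum_sub_distrib]

theorem coeffD_eq (j : ℕ) : coeffD j = (((4 / 3 : ℝ) ^ ((j : ℝ) / 3) : ℝ) : ℂ) /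
    ((((2 : ℝ) ^ (3 / 2 : ℝ) : ℝ) : ℂ) * Real.pi * Complex.I) * cutIntegral (rootIntegrand j) := by
  have : coeffIntegrand j = fun L =>
      Complex.exp (2 * Real.pi * Complex.I * j / 3) * rootIntegrand j L :=
    funext (coeffIntegrand_eq j)
  rw [coeffD, this, cutIntegral_const_mul, Complex.exp_neg]
  have := Complex.exp_ne_zero (2 * Real.pi * Complex.I * j / 3)
  field_simp

theorem cutIntegrable_coeffIntegrand {j : ℕ} (hj : 1 ≤ j) : CutIntegrable (coeffIntegrand j) := by
  have : coeffIntegrand j = fun L =>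
      Complex.exp (2 * Real.pi * Complex.I * j / 3) * rootIntegrand j L :=
    funext (coeffIntegrand_eq j)
  rw [this]
  exact (cutIntegrable_rootIntegrand hj).const_mul _

/-! ### Expansion of the Cauchy transform at infinity -/

/-- The coefficient `2i sin(2πj/3) ∫_0^∞ e^(-N ρ^3) ρ^(j-1) dρ` of `V^(-j)` in the expansion of
`rayTransform N V` at infinity. -/
noncomputable def rayCoeff (N : ℝ) (j : ℕ) : ℂ :=
  2 * Complex.I * Real.sin (2 * Real.pi * j / 3) * moment N (j - 1)

/-- The two rays contribute conjugate phases to each power of `1/V`; their difference is the sine,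
which vanishes when `3` divides the index. -/
theorem sixthRoot_pow_inv_sub (j : ℕ) :
    (-1) ^ j * (1 / sixthRoot' ^ (j + 1) - 1 / sixthRoot ^ (j + 1)) =
      2 * Complex.I * Real.sin (2 * Real.pi * (j + 1 : ℕ) / 3) := by
  have hs := Complex.two_sin (2 * Real.pi * (j + 1 : ℕ) / 3)
  have e1 : 1 / sixthRoot' ^ (j + 1) = (-1) ^ (j + 1) *
      Complex.exp (-(2 * Real.pi * (j + 1 : ℕ) / 3) * Complex.I) := by
    rw [sixthRoot', ← Complex.exp_nat_mul, one_div, ← Complex.exp_neg, ← Complex.exp_pi_mul_I,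
      ← Complex.exp_nat_mul, ← Complex.exp_add]
    congr 1; push_cast; ring
  have e2 : 1 / sixthRoot ^ (j + 1) = (-1) ^ (j + 1) *
      Complex.exp (2 * Real.pi * (j + 1 : ℕ) / 3 * Complex.I) := by
    rw [sixthRoot, ← Complex.exp_nat_mul, one_div, ← Complex.exp_neg,
      show ((-1 : ℂ)) = Complex.exp (-(Real.pi * Complex.I)) by
        rw [Complex.exp_neg, Complex.exp_pi_mul_I]; norm_num,
      ← Complex.exp_nat_mul, ← Complex.exp_add]
    congr 1; push_cast; ring
  have h1 : ((-1 : ℂ)) ^ j * (-1) ^ (j + 1) = -1 := by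
    rw [pow_succ, ← mul_assoc, ← mul_pow]; norm_num
  rw [e1, e2, Complex.ofReal_sin]
  push_cast at hs ⊢
  linear_combination (Complex.exp (-(2 * Real.pi * (j + 1) / 3) * Complex.I) -
    Complex.exp (2 * Real.pi * (j + 1) / 3 * Complex.I)) * h1 - Complex.I * hs -
    (Complex.exp (-(2 * Real.pi * (j + 1) / 3) * Complex.I) -
      Complex.exp (2 * Real.pi * (j + 1) / 3 * Complex.I)) * Complex.I_sq

theorem rayTransform_eq_sum (hN : 0 < N) (p : ℕ) {V : ℂ} (hV : V ∈ leftSector ∪ rightSector) :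
    rayTransform N V = ∑ j ∈ Finset.Ico 1 (p + 1), rayCoeff N j / V ^ j +
      ((-1) ^ p * stieltjes N p (sixthRoot' * V) / (sixthRoot' * V) ^ p -
        (-1) ^ p * stieltjes N p (sixthRoot * V) / (sixthRoot * V) ^ p) := by
  have h1 := sixthRoot_mul_mem_slitPlane hV
  have h2 := sixthRoot'_mul_mem_slitPlane hV
  rw [rayTransform, stieltjes_zero_eq_sum hN p h1, stieltjes_zero_eq_sum hN p h2,
    Finset.sum_Ico_eq_sum_range, Nat.add_sub_cancel]
  have : ∑ k ∈ Finset.range p, rayCoeff N (1 + k) / V ^ (1 + k) =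
      ∑ j ∈ Finset.range p, (-1) ^ j * (moment N j : ℂ) / (sixthRoot' * V) ^ (j + 1) -
      ∑ j ∈ Finset.range p, (-1) ^ j * (moment N j : ℂ) / (sixthRoot * V) ^ (j + 1) := by
    rw [← Finset.sum_sub_distrib]
    refine Finset.sum_congr rfl fun j _ => ?_
    rw [add_comm 1 j, rayCoeff, ← sixthRoot_pow_inv_sub, Nat.add_sub_cancel, mul_pow, mul_pow]
    simp only [div_eq_mul_inv, mul_inv]
    ring
  rw [this]
  ring

theorem abs_im_cube_le (u : ℂ) : |(u ^ 3).im| ≤ 3 * ‖u‖ ^ 2 * |u.im| := by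
  have h1 : (u ^ 3).im = u.im * (3 * u.re ^ 2 - u.im ^ 2) := by
    simp [pow_succ]; ring
  rw [h1, abs_mul, mul_comm]
  refine mul_le_mul_of_nonneg_right ?_ (abs_nonneg _)
  rw [← Complex.normSq_eq_norm_sq, Complex.normSq_apply, abs_le]
  constructor <;> nlinarith [sq_nonneg u.re, sq_nonneg u.im]

/-- From `abs_im_cube_le`, `|Im u| ≥ π/(6|u|^2)`, and `|ρ + u| ≥ |Im u|` for every real `ρ`. -/
theorem norm_stieltjes_le_of_cube (hN : 0 < N) (p : ℕ) {u : ℂ} (hu : |(u ^ 3).im| = Real.pi / 2) :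
    ‖stieltjes N p u‖ ≤ 6 / Real.pi * moment N p * ‖u‖ ^ 2 := by
  have hpi := Real.pi_pos
  have hu0 : u ≠ 0 := by
    rintro rfl
    simp at hu
    linarith
  have hr := norm_pos_iff.mpr hu0
  have h1 := abs_im_cube_le u
  rw [hu] at h1
  refine (norm_stieltjes_le hN p (δ := Real.pi / (6 * ‖u‖ ^ 2)) (by positivity)
    fun ρ _ => ?_).trans (le_of_eq ?_)
  · refine le_trans ?_ (Complex.abs_im_le_norm _)
    rw [Complex.add_im, Complex.ofReal_im, zero_add, div_le_iff₀ (by positivity)]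
    linarith
  · field_simp

/-- The expansion is taken two orders beyond `p`, to pay for the factor `|V|^2` lost in
`norm_stieltjes_le_of_cube`; the two rays double `6/π` to `12/π`. -/
theorem norm_rayTransform_sub_sum_le (hN : 0 < N) {p : ℕ} {V : ℂ}
    (hV : V ∈ leftSector ∪ rightSector) (h3 : |(V ^ 3).im| = Real.pi / 2) :
    ‖rayTransform N V - ∑ j ∈ Finset.Ico 1 (p + 3), rayCoeff N j / V ^ j‖ ≤
      12 / Real.pi * moment N (p + 2) / ‖V‖ ^ p := by
  have hpi := Real.pi_pos
  have hm := moment_nonneg N (p + 2)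
  have h1 := norm_stieltjes_le_of_cube hN (p + 2) (u := sixthRoot * V)
    (by rw [mul_pow, sixthRoot_cube, neg_one_mul, Complex.neg_im, abs_neg, h3])
  have h2 := norm_stieltjes_le_of_cube hN (p + 2) (u := sixthRoot' * V)
    (by rw [mul_pow, sixthRoot'_cube, neg_one_mul, Complex.neg_im, abs_neg, h3])
  have hV0 := right_ne_zero_of_mul (Complex.slitPlane_ne_zero (sixthRoot_mul_mem_slitPlane hV))
  have hr := norm_pos_iff.mpr hV0
  rw [rayTransform_eq_sum hN (p + 2) hV, add_sub_cancel_left]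
  rw [norm_mul, norm_sixthRoot, one_mul] at h1
  rw [norm_mul, norm_sixthRoot', one_mul] at h2
  refine (norm_sub_le _ _).trans ?_
  have e : ∀ x : ℂ, ‖x‖ ≤ 6 / Real.pi * moment N (p + 2) * ‖V‖ ^ 2 →
      ‖x‖ / ‖V‖ ^ (p + 2) ≤ 6 / Real.pi * moment N (p + 2) / ‖V‖ ^ p := by
    intro x hx
    rw [div_le_div_iff₀ (by positivity) (by positivity)]
    calc _ ≤ 6 / Real.pi * moment N (p + 2) * ‖V‖ ^ 2 * ‖V‖ ^ p := by gcongr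
      _ = _ := by ring
  simp only [norm_div, norm_mul, norm_pow, norm_neg, norm_one, one_pow, one_mul, norm_sixthRoot,
    norm_sixthRoot']
  refine (add_le_add (e _ h2) (e _ h1)).trans (le_of_eq ?_)
  ring

theorem norm_exp_half (L : ℂ) : ‖Complex.exp (L / 2)‖ = Real.exp (L.re / 2) := by
  rw [Complex.norm_exp, show (2 : ℂ) = ((2 : ℝ) : ℂ) by norm_num, Complex.div_ofReal_re]

theorem exp_mul_exp_neg_half (L : ℂ) :
    Complex.exp L * Complex.exp (-L / 2) = Complex.exp (L / 2) := by
  rw [← Complex.exp_add]; congr 1; ring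

/-- Near infinity `arg V` may exceed `2π/3`, but by at most `1/3`. Then `3 arg V` is within `1 <
π/3` of `±2π`, so its cosine is at least `1/2`. -/
theorem exp_mem_rightSector_or {W L δ : ℂ} (hW : W = 2 * L / 3 + δ) (hL : |L.im| ≤ Real.pi)
    (hδ : ‖δ‖ ≤ 1 / 3) : Complex.exp W ∈ rightSector ∨
      ‖Complex.exp W‖ ^ 3 / 2 ≤ (Complex.exp W ^ 3).re := by
  by_cases h : |W.im| < 2 * Real.pi / 3
  · exact Or.inl ⟨W, h, rfl⟩
  · right
    have hpi := Real.pi_gt_three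
    have h1 : W.im = 2 * L.im / 3 + δ.im := by
      rw [hW, Complex.add_im, show (2 * L / 3 : ℂ) = ((2 / 3 : ℝ) : ℂ) * L by push_cast; ring,
        Complex.im_ofReal_mul]
      ring
    have h2 : |W.im| ≤ 2 * Real.pi / 3 + 1 / 3 := by
      have h3 := abs_le.mp ((Complex.abs_im_le_norm δ).trans hδ)
      have h4 := abs_le.mp hL
      rw [h1, abs_le]
      constructor <;> linarith
    have e : Complex.exp W ^ 3 = Complex.exp (3 * W) := by
      rw [← Complex.exp_nat_mul]; norm_num
    have e3 : (3 * W).re = 3 * W.re := by simp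
    have e4 : (3 * W).im = 3 * W.im := by simp
    have hcos : 1 / 2 ≤ Real.cos (3 * W.im) := by
      rw [← Real.cos_abs, abs_mul, abs_of_pos (show (0 : ℝ) < 3 by norm_num),
        ← Real.cos_sub_two_pi, ← Real.cos_pi_div_three]
      have h := not_lt.mp h
      exact Real.cos_le_cos_of_nonneg_of_le_pi (by linarith) (by linarith) (by linarith)
    rw [← norm_pow, e, Complex.norm_exp, Complex.exp_re, e4]
    nlinarith [Real.exp_pos (3 * W).re]

/-! ### The contour argument and the truncated expansion -/

/-- Cauchy's theorem for the entire continuation composed with `V`. The end at infinity sees `-2πi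
e^(-N V^3)`, whose vertical integral is the constant `c`; the end at the origin is suppressed by
`e^(L/2)`. -/
theorem cutIntegral_rayTransform (hN : 0 < N)
    (hi : CutIntegrable fun L => Complex.exp (-L / 2) * rayTransform N (realRoot L)) {c : ℂ}
    (hc : ∀ R, vertIntegral (fun L => Complex.exp (L / 2) *
      Complex.exp (-(N * (phase L - phase saddleLog)))) R = c) :
    cutIntegral (fun L => Complex.exp (-L / 2) * rayTransform N (realRoot L)) =
      -(2 * Real.pi) * c := by
  have hpi := Real.pi_pos
  obtain ⟨M, hMd, hML, C, hMR⟩ := exists_entire_rayTransform hN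
  have hC : 0 ≤ C := by
    have := (norm_nonneg _).trans (hMR 1 (by simp) (Or.inr (by norm_num)))
    simpa using this
  set φ : ℂ → ℂ := fun L => Complex.exp (L / 2) * M (realRoot L) with hφ
  have hφc : ContinuousOn φ {L | |L.im| ≤ Real.pi} :=
    ContinuousOn.mul (by fun_prop) (hMd.continuous.comp_continuousOn continuousOn_realRoot)
  have hcut : ∀ L : ℂ, |L.im| = Real.pi →
      φ L = Complex.exp L * (Complex.exp (-L / 2) * rayTransform N (realRoot L)) := by
    intro L hL
    rw [hφ, ← mul_assoc, exp_mul_exp_neg_half,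
      ← hML _ (realRoot_mem_leftSector_of_abs_im_eq_pi hL)]
  have key := cutIntegral_eq_of_tendsto (c := -(2 * Real.pi * Complex.I) * c) (c' := 0) hi hφc
    (fun L hL hs => ?_) (fun t => ?_) ?_ ?_
  · rw [key]
    linear_combination (2 * Real.pi * c) * Complex.I_sq
  · exact DifferentiableAt.mul (by fun_prop)
      ((hMd _).comp L (differentiableAt_realRoot (le_of_lt hL) hs))
  · rw [hcut _ (by simp [abs_of_pos hpi]), hcut _ (by simp [abs_of_pos hpi])]
  · obtain ⟨R₀, hR₀, hroot⟩ := exists_realRoot_eq_exp (show (0 : ℝ) < 1 / 3 by norm_num)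
    have hsplit : ∀ R : ℝ, vertIntegral φ R = vertIntegral (fun L => Complex.exp (L / 2) *
        (M (realRoot L) + 2 * Real.pi * Complex.I *
          Complex.exp (-(N * (phase L - phase saddleLog))))) R +
          -(2 * Real.pi * Complex.I) * c := by
      intro R
      have hcv : Continuous fun y : ℝ => phase (R + y * Complex.I) := by
        unfold phase; fun_prop
      have hφv : ContinuousOn (fun y : ℝ => φ (R + y * Complex.I)) (uIcc (-Real.pi) Real.pi) := by
        refine hφc.comp (by fun_prop) fun y hy => ?_
        rw [uIcc_of_le (by linarith)] at hy
        simpa using abs_le.mpr hy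
      rw [← hc R]
      simp only [vertIntegral]
      rw [← intervalIntegral.integral_const_mul, ← intervalIntegral.integral_add]
      · refine intervalIntegral.integral_congr fun y _ => ?_
        simp only [hφ]
        ring
      · have : (fun y : ℝ => Complex.exp ((R + y * Complex.I) / 2) *
            (M (realRoot (R + y * Complex.I)) + 2 * Real.pi * Complex.I *
            Complex.exp (-(N * (phase (R + y * Complex.I) - phase saddleLog))))) =
            fun y : ℝ => φ (R + y * Complex.I) + Complex.exp ((R + y * Complex.I) / 2) *
              (2 * Real.pi * Complex.I *
              Complex.exp (-(N * (phase (R + y * Complex.I) - phase saddleLog)))) := by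
          funext y; simp only [hφ]; ring
        rw [this]
        refine (hφv.add (Continuous.continuousOn ?_)).intervalIntegrable
        fun_prop
      · refine Continuous.intervalIntegrable ?_ _ _
        fun_prop
    refine Tendsto.congr (fun R => (hsplit R).symm) ?_
    rw [show 𝓝 (-(2 * Real.pi * Complex.I) * c) = 𝓝 (0 + -(2 * Real.pi * Complex.I) * c) by
      rw [zero_add]]
    refine Tendsto.add_const _ ?_
    rw [tendsto_zero_iff_norm_tendsto_zero]
    refine squeeze_zero' (Eventually.of_forall fun _ => norm_nonneg _) ?_
      (g := fun R => C * Real.exp (1 / 3 - R / 6) * (2 * Real.pi)) ?_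
    · filter_upwards [eventually_ge_atTop R₀, eventually_ge_atTop 1] with R hR hR1
      refine norm_vertIntegral_le fun y hy => ?_
      set L : ℂ := R + y * Complex.I with hL
      have hLre : L.re = R := by simp [hL]
      have hLim : |L.im| ≤ Real.pi := by simpa [hL] using hy
      obtain ⟨δ, hδ, hV⟩ := hroot L (by rw [hLre]; exact hR) hLim
      have hsec := exp_mem_rightSector_or rfl hLim hδ
      rw [← hV] at hsec
      have hδre := abs_le.mp ((Complex.abs_re_le_norm δ).trans hδ)
      have hn : Real.exp (2 * R / 3 - 1 / 3) ≤ ‖realRoot L‖ := by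
        rw [hV, Complex.norm_exp, Complex.add_re,
          show (2 * L / 3 : ℂ) = ((2 / 3 : ℝ) : ℂ) * L by push_cast; ring, Complex.re_ofReal_mul,
          hLre]
        exact Real.exp_le_exp.mpr (by linarith)
      have hn1 : 1 ≤ ‖realRoot L‖ := (Real.one_le_exp (by linarith)).trans hn
      have hb := hMR _ hn1 hsec
      rw [realRoot_cube hLim] at hb
      rw [norm_mul, norm_exp_half, hLre]
      -- The part of order `1/V` has size `e^(R/2) e^(-2R/3)`, so it decays like `e^(-R/6)`.
      calc _ ≤ Real.exp (R / 2) * (C / Real.exp (2 * R / 3 - 1 / 3)) := by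
            refine mul_le_mul_of_nonneg_left (hb.trans ?_) (Real.exp_pos _).le
            gcongr
        _ = C * Real.exp (1 / 3 - R / 6) := by
            rw [show (1 : ℝ) / 3 - R / 6 = R / 2 - (2 * R / 3 - 1 / 3) by ring,
              Real.exp_sub (R / 2)]
            ring
    · have h1 : Tendsto (fun R : ℝ => Real.exp (1 / 3 - R / 6)) atTop (𝓝 0) := by
        refine Real.tendsto_exp_atBot.comp ?_
        refine tendsto_atBot_add_const_left atTop (1 / 3 : ℝ) (f := fun R : ℝ => -(R / 6)) ?_
        exact tendsto_neg_atTop_atBot.comp (tendsto_id.atTop_div_const (by norm_num))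
      simpa using (h1.const_mul C).mul_const (2 * Real.pi)
  · obtain ⟨R₀, hR₀⟩ := exists_realRoot_mem_leftSector
    rw [tendsto_zero_iff_norm_tendsto_zero]
    refine squeeze_zero' (Eventually.of_forall fun _ => norm_nonneg _) ?_
      (g := fun R => Real.exp (R / 2) * (28 * moment N 0) * (2 * Real.pi)) ?_
    · filter_upwards [eventually_le_atBot R₀] with R hR
      refine norm_vertIntegral_le fun y hy => ?_
      set L : ℂ := R + y * Complex.I with hL
      have hLre : L.re = R := by simp [hL]
      have hLim : |L.im| ≤ Real.pi := by simpa [hL] using hy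
      obtain ⟨h1, h2, h3⟩ := hR₀ L (by rw [hLre]; exact hR) hLim
      have hm := moment_nonneg N 0
      rw [hφ, norm_mul, norm_exp_half, hLre, hML _ h1]
      refine mul_le_mul_of_nonneg_left ?_ (Real.exp_pos _).le
      refine (norm_rayTransform_le hN (norm_pos_iff.mp (by linarith))
        (h2.trans (by positivity))).trans (div_le_self (by positivity) h3)
    · have h1 : Tendsto (fun R : ℝ => Real.exp (R / 2)) atBot (𝓝 0) :=
        Real.tendsto_exp_atBot.comp (tendsto_id.atBot_div_const (by norm_num))
      simpa using (h1.mul_const (28 * moment N 0)).mul_const (2 * Real.pi)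

/-- Convergence of the whole integral is deduced from that of the finitely many terms and of the
remainder, the latter being controlled by `|V|^(-p)`. -/
theorem cutIntegral_rayTransform_expansion (hN : 0 < N) {p : ℕ} (hp : 1 ≤ p) :
    CutIntegrable (fun L => Complex.exp (-L / 2) * rayTransform N (realRoot L)) ∧
    ‖cutIntegral (fun L => Complex.exp (-L / 2) * rayTransform N (realRoot L)) -
      ∑ j ∈ Finset.Ico 1 (p + 3), rayCoeff N j * cutIntegral (rootIntegrand j)‖ ≤
      2 * (12 / Real.pi * moment N (p + 2) *
        (2 / (Real.pi / 2) ^ ((p : ℝ) / 3) + 6 / (4 * (p : ℝ) - 3))) := by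
  have hpi := Real.pi_pos
  have hm := moment_nonneg N (p + 2)
  set h : ℂ → ℂ := fun L => Complex.exp (-L / 2) * rayTransform N (realRoot L) with hh
  set S : ℂ → ℂ := fun L => ∑ j ∈ Finset.Ico 1 (p + 3), rayCoeff N j * rootIntegrand j L with hS
  have hroot : ContinuousOn realRoot cutSides :=
    continuousOn_realRoot.mono fun L hL => le_of_eq hL
  have hSc : ContinuousOn S cutSides :=
    continuousOn_finsetSum _ fun j _ => continuousOn_const.mul (continuousOn_rootIntegrand j)
  have hhc : ContinuousOn h cutSides := by
    refine ContinuousOn.mul (by fun_prop) fun L hL => ?_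
    have h1 := (hasDerivAt_rayTransform hN
      (Or.inl (realRoot_mem_leftSector_of_abs_im_eq_pi hL))).continuousAt
    exact h1.comp_continuousWithinAt (hroot L hL)
  have hj : ∀ j ∈ Finset.Ico 1 (p + 3),
      CutIntegrable fun L => rayCoeff N j * rootIntegrand j L := fun j hj =>
    (cutIntegrable_rootIntegrand (Finset.mem_Ico.mp hj).1).const_mul _
  have hSi : CutIntegrable S := cutIntegrable_sum hj
  have hSe : cutIntegral S =
      ∑ j ∈ Finset.Ico 1 (p + 3), rayCoeff N j * cutIntegral (rootIntegrand j) := by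
    rw [hS, cutIntegral_sum hj]
    exact Finset.sum_congr rfl fun j _ => cutIntegral_const_mul _ _
  have hbd : ∀ L ∈ cutSides, ‖h L - S L‖ ≤ 12 / Real.pi * moment N (p + 2) *
      (‖Complex.exp (-L / 2)‖ / ‖realRoot L‖ ^ p) := by
    intro L hL
    have hb := norm_rayTransform_sub_sum_le hN (p := p)
      (Or.inl (realRoot_mem_leftSector_of_abs_im_eq_pi hL)) (abs_im_realRoot_cube hL)
    have e : h L - S L = Complex.exp (-L / 2) * (rayTransform N (realRoot L) -
        ∑ j ∈ Finset.Ico 1 (p + 3), rayCoeff N j / realRoot L ^ j) := by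
      simp only [hh, hS, mul_sub, Finset.mul_sum, rootIntegrand]
      congr 1
      exact Finset.sum_congr rfl fun j _ => by ring
    rw [e, norm_mul]
    refine (mul_le_mul_of_nonneg_left hb (norm_nonneg _)).trans (le_of_eq ?_)
    ring
  obtain ⟨hri, hrb⟩ := cutIntegrable_of_bound (h := fun L => h L - S L)
    (B := 12 / Real.pi * moment N (p + 2)) hp (hhc.sub hSc) hbd (by positivity)
  have hsum : h = fun L => S L + (h L - S L) := by funext L; ring
  have hhi : CutIntegrable h := by rw [hsum]; exact hSi.add hri
  refine ⟨hhi, ?_⟩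
  have he : cutIntegral h = cutIntegral S + cutIntegral (fun L => h L - S L) := by
    conv_lhs => rw [hsum]
    exact cutIntegral_add hSi hri
  rw [he, hSe, add_sub_cancel_left]
  exact hrb

end

/-! ### Asymptotic expansions with rational coefficients -/

/-- `f(y) = φ(y) + O(y^m)` as `y → 0`, for a formal power series `φ` with rational
coefficients. -/
def ExpandsTo (m : ℕ) (f : ℂ → ℂ) (φ : PowerSeries ℚ) : Prop :=
  ∃ P : ℂ[X], (∀ i < m, P.coeff i = ((PowerSeries.coeff i φ : ℚ) : ℂ)) ∧
    (fun y => f y - P.eval y) =O[𝓝[≠] 0] fun y : ℂ => y ^ m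

theorem tendsto_eval_punctured (P : ℂ[X]) :
    Tendsto (fun y => P.eval y) (𝓝[≠] 0) (𝓝 (P.eval 0)) :=
  (P.continuous.tendsto 0).mono_left nhdsWithin_le_nhds

theorem isBigO_pow_pow_punctured {k m : ℕ} (h : k ≤ m) :
    (fun y : ℂ => y ^ m) =O[𝓝[≠] 0] fun y : ℂ => y ^ k := by
  obtain ⟨l, rfl⟩ := Nat.exists_eq_add_of_le h
  have : (fun y : ℂ => y ^ l) =O[𝓝[≠] 0] fun _ : ℂ => (1 : ℂ) := by
    have := tendsto_eval_punctured (X ^ l)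
    simp only [eval_pow, eval_X] at this
    exact this.isBigO_one ℂ
  simpa [pow_add] using (Asymptotics.isBigO_refl (fun y : ℂ => y ^ k) (𝓝[≠] 0)).mul this

namespace ExpandsTo

variable {m : ℕ} {f g : ℂ → ℂ} {φ ψ : PowerSeries ℚ}

theorem isBigO_one (hf : ExpandsTo m f φ) : f =O[𝓝[≠] 0] fun _ => (1 : ℂ) := by
  obtain ⟨P, -, hP⟩ := hf
  have h1 : (fun y => f y - P.eval y) =O[𝓝[≠] 0] fun _ : ℂ => (1 : ℂ) := by
    simpa using hP.trans (isBigO_pow_pow_punctured (Nat.zero_le m))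
  simpa using h1.add ((tendsto_eval_punctured P).isBigO_one ℂ)

theorem isBigO_id (hf : ExpandsTo m f φ) (hm : 1 ≤ m) (h0 : PowerSeries.coeff 0 φ = 0) :
    f =O[𝓝[≠] 0] fun y => y := by
  obtain ⟨P, hc, hP⟩ := hf
  have h1 : (fun y => f y - P.eval y) =O[𝓝[≠] 0] fun y : ℂ => y := by
    simpa using hP.trans (isBigO_pow_pow_punctured hm)
  have hX : X ∣ P := X_dvd_iff.mpr (by rw [hc 0 hm, h0, Rat.cast_zero])
  obtain ⟨Q, rfl⟩ := hX
  have h2 : (fun y => (X * Q).eval y) =O[𝓝[≠] 0] fun y : ℂ => y := by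
    simpa using (Asymptotics.isBigO_refl (fun y : ℂ => y) (𝓝[≠] 0)).mul
      ((tendsto_eval_punctured Q).isBigO_one ℂ)
  simpa using h1.add h2

theorem congr (hf : ExpandsTo m f φ) (h : f =ᶠ[𝓝[≠] 0] g) : ExpandsTo m g φ := by
  obtain ⟨P, hc, hP⟩ := hf
  exact ⟨P, hc, hP.congr' (h.mono fun y hy => by simp only [hy]) EventuallyEq.rfl⟩

theorem add_isBigO (hf : ExpandsTo m f φ) (h : g =O[𝓝[≠] 0] fun y : ℂ => y ^ m) :
    ExpandsTo m (fun y => f y + g y) φ := by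
  obtain ⟨P, hc, hP⟩ := hf
  refine ⟨P, hc, (hP.add h).congr_left fun y => by ring⟩

theorem eval_map (P : ℚ[X]) : ExpandsTo m
    (fun y => (P.map (algebraMap ℚ ℂ)).eval y) (P : PowerSeries ℚ) :=
  ⟨P.map (algebraMap ℚ ℂ), fun i _ => by simp, by simpa using Asymptotics.isBigO_zero _ _⟩

theorem const (m : ℕ) (c : ℚ) : ExpandsTo m (fun _ => (c : ℂ)) (PowerSeries.C c) := by
  have := eval_map (m := m) (C c)
  simpa using this

theorem add (hf : ExpandsTo m f φ) (hg : ExpandsTo m g ψ) :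
    ExpandsTo m (fun y => f y + g y) (φ + ψ) := by
  obtain ⟨P, hc, hP⟩ := hf
  obtain ⟨Q, hd, hQ⟩ := hg
  refine ⟨P + Q, fun i hi => by rw [coeff_add, hc i hi, hd i hi, map_add, Rat.cast_add], ?_⟩
  exact (hP.add hQ).congr_left fun y => by rw [eval_add]; ring

theorem mul (hf : ExpandsTo m f φ) (hg : ExpandsTo m g ψ) :
    ExpandsTo m (fun y => f y * g y) (φ * ψ) := by
  have hf1 := hf.isBigO_one
  obtain ⟨P, hc, hP⟩ := hf
  obtain ⟨Q, hd, hQ⟩ := hg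
  refine ⟨P * Q, fun i hi => ?_, ?_⟩
  · rw [coeff_mul, PowerSeries.coeff_mul, Rat.cast_sum]
    refine Finset.sum_congr rfl fun x hx => ?_
    have := Finset.HasAntidiagonal.mem_antidiagonal.mp hx
    rw [hc x.1 (by omega), hd x.2 (by omega), Rat.cast_mul]
  · have h1 : (fun y => f y * (g y - Q.eval y)) =O[𝓝[≠] 0] fun y : ℂ => y ^ m := by
      simpa using hf1.mul hQ
    have h2 : (fun y => (f y - P.eval y) * Q.eval y) =O[𝓝[≠] 0] fun y : ℂ => y ^ m := by
      simpa using hP.mul ((tendsto_eval_punctured Q).isBigO_one ℂ)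
    exact (h1.add h2).congr_left fun y => by rw [eval_mul]; ring

theorem pow (hf : ExpandsTo m f φ) (k : ℕ) : ExpandsTo m (fun y => f y ^ k) (φ ^ k) := by
  induction k with
  | zero => simpa using const m 1
  | succ k ih => simpa [pow_succ] using ih.mul hf

theorem sum {ι : Type*} {s : Finset ι} {f : ι → ℂ → ℂ} {φ : ι → PowerSeries ℚ}
    (hf : ∀ i ∈ s, ExpandsTo m (f i) (φ i)) :
    ExpandsTo m (fun y => ∑ i ∈ s, f i y) (∑ i ∈ s, φ i) := by
  classical
  induction s using Finset.induction_on with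
  | empty => simpa using const m 0
  | insert i s hi ih =>
    simp only [Finset.sum_insert hi]
    exact (hf i (Finset.mem_insert_self i s)).add
      (ih fun k hk => hf k (Finset.mem_insert_of_mem hk))

end ExpandsTo

/-- The rising factorial `α (α + 1) ⋯ (α + i - 1)`. -/
def rising (α : ℚ) (i : ℕ) : ℚ := ∏ l ∈ Finset.range i, (α + l)

theorem rising_succ (α : ℚ) (i : ℕ) : rising α (i + 1) = rising α i * (α + i) :=
  Finset.prod_range_succ _ _

theorem choose_neg_eq_rising (α : ℚ) (i : ℕ) :
    Ring.choose (-(α : ℂ)) i = (((-1) ^ i * rising α i / i.factorial : ℚ) : ℂ) := by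
  rw [Ring.choose_eq_smul]
  have : (descPochhammer ℤ i).smeval (-(α : ℂ)) = (((-1) ^ i * rising α i : ℚ) : ℂ) := by
    induction i with
    | zero => simp [rising]
    | succ i ih =>
      rw [descPochhammer_succ_right, Polynomial.smeval_mul, ih, rising_succ]
      simp [Polynomial.smeval_sub, Polynomial.smeval_natCast]
      ring
  rw [this, smul_eq_mul]
  push_cast
  field_simp

/-- The coefficients of `(1 + t)^(-α)`, applied to a power series without constant term. -/
noncomputable def binomialComp (m : ℕ) (α : ℚ) (φ : PowerSeries ℚ) : PowerSeries ℚ :=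
  ∑ i ∈ Finset.range m, PowerSeries.C ((-1) ^ i * rising α i / i.factorial) * φ ^ i

/-- Because `g(y) = O(y)`, the tail of the binomial series from degree `m` on is `O(y^m)`, and only
the first `m` powers of `φ` matter. -/
theorem ExpandsTo.one_add_cpow_neg {m : ℕ} {g : ℂ → ℂ} {φ : PowerSeries ℚ}
    (hg : ExpandsTo m g φ) (hm : 1 ≤ m) (h0 : PowerSeries.coeff 0 φ = 0) (α : ℚ) :
    ExpandsTo m (fun y => (1 + g y) ^ (-(α : ℂ))) (binomialComp m α φ) := by
  have hO := hg.isBigO_id hm h0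
  have ht : Tendsto g (𝓝[≠] 0) (𝓝 0) :=
    hO.trans_tendsto (tendsto_id.mono_left nhdsWithin_le_nhds)
  have h1 := (Complex.one_add_cpow_hasFPowerSeriesAt_zero
    (a := -(α : ℂ))).isBigO_sub_partialSum_pow m
  have h2 := h1.comp_tendsto ht
  have h3 : ((fun y : ℂ => ‖y‖ ^ m) ∘ g) =O[𝓝[≠] 0] fun y : ℂ => y ^ m := by
    have := hO.pow m
    refine Asymptotics.IsBigO.trans ?_ this
    exact (Asymptotics.isBigO_refl (fun y => g y ^ m) _).norm_left.congr_left fun y => by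
      simp [norm_pow]
  have h4 : ExpandsTo m (fun y => ∑ i ∈ Finset.range m,
      ((((-1) ^ i * rising α i / i.factorial : ℚ)) : ℂ) * g y ^ i) (binomialComp m α φ) :=
    ExpandsTo.sum fun i _ => (ExpandsTo.const m _).mul (hg.pow i)
  refine (h4.add_isBigO (h2.trans h3)).congr (Eventually.of_forall fun y => ?_)
  simp only [Function.comp, zero_add, FormalMultilinearSeries.partialSum, binomialSeries_apply,
    choose_neg_eq_rising, List.ofFn_const, List.prod_replicate, smul_eq_mul]
  ring

/-! ### The two power series at the saddle point -/

/-- The power series `∑ 3 2^(k+1) y^(k+1) / (k+4)`. -/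
noncomputable def tauSeries : PowerSeries ℚ :=
  PowerSeries.mk fun k => if k = 0 then 0 else 3 * 2 ^ k / (k + 3)

/-- The power series of `(1 - 2y)^(-1/2)`. -/
noncomputable def centralSeries : PowerSeries ℚ :=
  PowerSeries.mk fun k => ((2 * k).choose k : ℚ) / 2 ^ k

theorem two_pow_mul_rising_half (k : ℕ) :
    (2 : ℚ) ^ k * rising (1 / 2) k / k.factorial = ((2 * k).choose k : ℚ) / 2 ^ k := by
  rw [← Nat.centralBinom_eq_two_mul_choose]
  induction k with
  | zero => simp [rising]
  | succ k ih =>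
    have h := Nat.succ_mul_centralBinom_succ k
    have h' : ((k : ℚ) + 1) * (k + 1).centralBinom = 2 * (2 * k + 1) * k.centralBinom := by
      exact_mod_cast h
    have h1 : ((k : ℚ) + 1) ≠ 0 := by positivity
    have h2 : ((k + 1).centralBinom : ℚ) = 2 * (2 * k + 1) * k.centralBinom / (k + 1) := by
      rw [eq_div_iff h1, mul_comm]; exact h'
    have h3 : (k.factorial : ℚ) ≠ 0 := by exact_mod_cast k.factorial_ne_zero
    rw [h2, rising_succ, Nat.factorial_succ]
    rw [div_eq_div_iff h3 (by positivity)] at ih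
    push_cast
    rw [div_div, div_eq_div_iff (by positivity) (by positivity)]
    linear_combination (2 * (2 * (k : ℚ) + 1) * (k + 1)) * ih

theorem expandsTo_inv_sqrt {m : ℕ} (hm : 1 ≤ m) :
    ExpandsTo m (fun y => (1 + -2 * y) ^ (-((1 / 2 : ℚ) : ℂ))) centralSeries := by
  have h1 : ExpandsTo m (fun y : ℂ => -2 * y) ((C (-2) * X : ℚ[X]) : PowerSeries ℚ) := by
    have := ExpandsTo.eval_map (m := m) (C (-2) * X)
    simpa using this
  obtain ⟨P, hc, hP⟩ := h1.one_add_cpow_neg hm (by simp) (1 / 2)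
  refine ⟨P, fun i hi => ?_, hP⟩
  rw [hc i hi, centralSeries, PowerSeries.coeff_mk, ← two_pow_mul_rising_half, binomialComp, map_sum]
  congr 1
  have hcoef : ∀ k : ℕ, PowerSeries.coeff i (PowerSeries.C ((-1) ^ k * rising (1 / 2) k /
      (k.factorial : ℚ)) * ((C (-2) * X : ℚ[X]) : PowerSeries ℚ) ^ k) =
      if i = k then 2 ^ k * rising (1 / 2) k / (k.factorial : ℚ) else 0 := by
    intro k
    rw [← Polynomial.coe_pow, PowerSeries.coeff_C_mul, Polynomial.coeff_coe, mul_pow, ← C_pow,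
      Polynomial.coeff_C_mul, coeff_X_pow]
    split_ifs with h
    · have : ((-1 : ℚ)) ^ k * (-2) ^ k = 2 ^ k := by rw [← mul_pow]; norm_num
      linear_combination (rising (1 / 2) k / k.factorial) * this
    · simp
  simp only [hcoef]
  rw [Finset.sum_ite_eq, if_pos (Finset.mem_range.mpr hi)]

/-- The normalized quotient `3/4 (f(z) - f(1/2)) / (z - 1/2)^3` at `z = 1/2 - y`, minus one. -/
noncomputable def tauFun (y : ℂ) : ℂ :=
  3 / 4 * cubicQuot (Complex.log (1 / 2 - y)) - 1

/-- The polynomial part of the phase cancels the first two Taylor terms of the logarithm, as it must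
at a double saddle. -/
theorem tauFun_eq {y : ℂ} (hy : y ≠ 0) (hy1 : ‖y‖ < 1 / 2) : tauFun y =
    3 / (-2 * y) ^ 3 * (Complex.log (1 + -2 * y) - -2 * y + (-2 * y) ^ 2 / 2) - 1 := by
  have hne : 1 + -2 * y ≠ 0 := by
    intro h
    rw [show y = 1 / 2 by linear_combination (-1 / 2 : ℂ) * h] at hy1
    norm_num at hy1
  have hz : (1 / 2 - y : ℂ) = ((1 / 2 : ℝ) : ℂ) * (1 + -2 * y) := by push_cast; ring
  have hlog : Complex.log (1 / 2 - y) = -(Real.log 2 : ℂ) + Complex.log (1 + -2 * y) := by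
    rw [hz, Complex.log_ofReal_mul (by norm_num) hne, one_div, Real.log_inv]
    push_cast
    ring
  have hz0 : (1 / 2 - y : ℂ) ≠ 0 := by
    rw [hz]; exact mul_ne_zero (by norm_num) hne
  rw [tauFun, cubicQuot, phase, phase, exp_saddleLog, Complex.exp_log hz0, hlog, saddleLog]
  have : (1 / 2 - y - 1 / 2 : ℂ) = -y := by ring
  rw [this]
  field_simp
  ring

theorem logTaylor_add_three (m : ℕ) (a : ℂ) : Complex.logTaylor (m + 3) a =
    a - a ^ 2 / 2 + ∑ k ∈ Finset.range m, (-1) ^ k * a ^ (k + 3) / (k + 3) := by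
  induction m with
  | zero => simp [Complex.logTaylor_succ, Complex.logTaylor_zero]; ring
  | succ m ih =>
    rw [show m + 1 + 3 = (m + 3) + 1 by ring, Complex.logTaylor_succ, Pi.add_apply, ih,
      Finset.sum_range_succ]
    push_cast
    ring

theorem expandsTo_tauFun {m : ℕ} (hm : 1 ≤ m) : ExpandsTo m tauFun tauSeries := by
  refine ⟨∑ k ∈ Finset.range m, C ((PowerSeries.coeff k tauSeries : ℚ) : ℂ) * X ^ k,
    fun i hi => ?_, ?_⟩
  · rw [finsetSum_coeff]
    simp only [coeff_C_mul_X_pow]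
    rw [Finset.sum_ite_eq, if_pos (Finset.mem_range.mpr hi)]
  · refine Asymptotics.IsBigO.of_bound (6 * 2 ^ m) ?_
    have hs : ∀ᶠ y : ℂ in 𝓝[≠] 0, ‖y‖ < 1 / 4 :=
      nhdsWithin_le_nhds ((isOpen_lt continuous_norm continuous_const).mem_nhds (by simp))
    filter_upwards [hs, self_mem_nhdsWithin] with y hy1 hy0
    have hy0 : y ≠ 0 := hy0
    set a : ℂ := -2 * y with ha
    have ha0 : a ≠ 0 := mul_ne_zero (by norm_num) hy0
    have han : ‖a‖ = 2 * ‖y‖ := by rw [ha, norm_mul]; norm_num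
    have hpos : 0 < ‖a‖ := norm_pos_iff.mpr ha0
    have ha1 : ‖a‖ < 1 := by linarith
    have hT := Complex.norm_log_sub_logTaylor_le (m + 2) ha1
    -- The term `k = 0` on the right is `1`, whereas `tauSeries` has no constant term; the added `1`
    -- accounts for it.
    have hsum : ∑ k ∈ Finset.range m, ((PowerSeries.coeff k tauSeries : ℚ) : ℂ) * y ^ k + 1 =
        3 / a ^ 3 * ∑ k ∈ Finset.range m, (-1) ^ k * a ^ (k + 3) / (k + 3) := by
      obtain ⟨l, rfl⟩ := Nat.exists_eq_add_of_le' hm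
      have hterm : ∀ k : ℕ, 3 / a ^ 3 * ((-1) ^ k * a ^ (k + 3) / (k + 3)) =
          3 * 2 ^ k / (k + 3) * y ^ k := by
        intro k
        have h1 : (-1) ^ k * a ^ (k + 3) = (2 ^ k * y ^ k) * a ^ 3 := by
          rw [pow_add, ← mul_assoc, ← mul_pow, ← mul_pow, ha]
          congr 2; ring
        rw [h1]
        field_simp
      rw [Finset.mul_sum, Finset.sum_congr rfl fun k _ => hterm k, Finset.sum_range_succ',
        Finset.sum_range_succ' _ l]
      simp only [tauSeries, PowerSeries.coeff_mk, if_neg (Nat.succ_ne_zero _)]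
      norm_num
    have hE : tauFun y - (∑ k ∈ Finset.range m, C ((PowerSeries.coeff k tauSeries : ℚ) : ℂ) *
        X ^ k : ℂ[X]).eval y =
        3 / a ^ 3 * (Complex.log (1 + a) - Complex.logTaylor (m + 2 + 1) a) := by
      rw [tauFun_eq hy0 (by linarith), ← ha, eval_finsetSum, show m + 2 + 1 = m + 3 by ring,
        logTaylor_add_three]
      simp only [eval_mul, eval_C, eval_pow, eval_X]
      linear_combination -hsum
    have hinv : (1 - ‖a‖)⁻¹ ≤ 2 := by
      rw [inv_le_comm₀ (by linarith) (by norm_num)]; linarith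
    have hm3 : (1 : ℝ) ≤ ((m + 2 : ℕ) : ℝ) + 1 := by
      have : (0 : ℝ) ≤ ((m + 2 : ℕ) : ℝ) := Nat.cast_nonneg _
      linarith
    have hinv0 : 0 ≤ (1 - ‖a‖)⁻¹ := inv_nonneg.mpr (by linarith)
    rw [hE, norm_mul, norm_div, norm_pow, norm_pow]
    have h3 : ‖(3 : ℂ)‖ = 3 := by norm_num
    rw [h3]
    calc _ ≤ 3 / ‖a‖ ^ 3 * (‖a‖ ^ (m + 2 + 1) * (1 - ‖a‖)⁻¹) := by
          refine mul_le_mul_of_nonneg_left (hT.trans ?_) (by positivity)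
          exact div_le_self (by positivity) hm3
      _ ≤ 3 / ‖a‖ ^ 3 * (‖a‖ ^ (m + 2 + 1) * 2) := by gcongr
      _ = 6 * 2 ^ m * ‖y‖ ^ m := by
          rw [show m + 2 + 1 = m + 3 by ring, pow_add]
          field_simp
          rw [han, mul_pow]
          ring

/-! ### The recurrence and the power series -/

theorem coeff_primitive_succ (p : ℚ[X]) (i : ℕ) :
    (primitive p).coeff (i + 1) = p.coeff i / (i + 1) := by
  have h := congrArg (fun q => coeff q i) (derivative_primitive p)
  simp only [coeff_derivative] at h
  rw [← h]
  have : ((i : ℚ) + 1) ≠ 0 := by positivity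
  field_simp

theorem coeff_primitive_zero (p : ℚ[X]) : (primitive p).coeff 0 = 0 := by
  rw [coeff_zero_eq_eval_zero, eval_zero_primitive]

/-- Coefficientwise form of `∑ Q_{m+1}(s) y^m = (1-2y)^(-1/2) e^(-s τ(y))`. Integrating in `s`
divides by `i+1`, and the sum in the recurrence is a convolution with `-τ`, with an index shift
because `τ` has no constant term. -/
theorem coeff_recQ (i m : ℕ) : (recQ (m + 1)).coeff i =
    PowerSeries.coeff m (centralSeries * (-tauSeries) ^ i) / i.factorial := by
  induction i generalizing m with
  | zero =>
    have h3 : ∀ p : ℚ[X], (3 * p).coeff 0 = 3 * p.coeff 0 := fun p => by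
      rw [show (3 : ℚ[X]) = C 3 from (map_ofNat C 3).symm, coeff_C_mul]
    rw [recQ, coeff_sub, h3, finsetSum_coeff]
    simp [coeff_primitive_zero, centralSeries]
  | succ i ih =>
    have h3 : ∀ (p : ℚ[X]) (n : ℕ), (3 * p).coeff n = 3 * p.coeff n := fun p n => by
      rw [show (3 : ℚ[X]) = C 3 from (map_ofNat C 3).symm, coeff_C_mul]
    rw [recQ, coeff_sub, h3, finsetSum_coeff, coeff_C_succ, zero_sub, pow_succ, ← mul_assoc,
      mul_comm _ (-tauSeries), PowerSeries.coeff_mul,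
      Finset.Nat.sum_antidiagonal_eq_sum_range_succ_mk, Finset.sum_range_succ']
    have h0 : PowerSeries.coeff 0 (-tauSeries) = 0 := by simp [tauSeries]
    simp only [h0, zero_mul, add_zero]
    rw [Finset.mul_sum, ← Finset.sum_neg_distrib, Finset.sum_div]
    refine Finset.sum_congr rfl fun k hk => ?_
    have hk := Finset.mem_range.mp hk
    obtain ⟨l, hl⟩ := Nat.exists_eq_add_of_lt hk
    have e1 : m - k = l + 1 := by omega
    have e2 : m - (k + 1) = l := by omega
    rw [coeff_C_mul, coeff_primitive_succ, e1, e2, ih l, Nat.factorial_succ, map_neg, tauSeries,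
      PowerSeries.coeff_mk, if_neg (Nat.succ_ne_zero k), ← tauSeries]
    have h1 : ((i : ℚ) + 1) ≠ 0 := by positivity
    have h2 : ((k : ℚ) + 4) ≠ 0 := by positivity
    have h4 : (i.factorial : ℚ) ≠ 0 := by exact_mod_cast i.factorial_ne_zero
    push_cast
    rw [show ((k : ℚ) + 1 + 3) = k + 4 by ring]
    field_simp

/-- The series `τ^i` starts at degree `i`, so powers beyond `m` contribute nothing. -/
theorem natDegree_recQ_lt (m : ℕ) : (recQ (m + 1)).natDegree < m + 1 := by
  refine Nat.lt_succ_of_le (natDegree_le_iff_coeff_eq_zero.mpr fun i hi => ?_)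
  rw [coeff_recQ]
  have hX : PowerSeries.X ∣ -tauSeries := by
    rw [PowerSeries.X_dvd_iff]; simp [tauSeries]
  have : PowerSeries.X ^ i ∣ centralSeries * (-tauSeries) ^ i :=
    Dvd.dvd.mul_left (pow_dvd_pow_of_dvd hX i) _
  rw [PowerSeries.X_pow_dvd_iff.mp this m hi, zero_div]

/-- The sum `∑ (j/3)_i [s^i] Q_j`. -/
noncomputable def coeffBeta (j : ℕ) : ℚ :=
  ∑ i ∈ Finset.range j, (recQ j).coeff i * rising ((j : ℚ) / 3) i

/-- The factor `1/i!` of the exponential series and the rising factorial together are the binomial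
coefficients of `(1+τ)^(-j/3)`. -/
theorem coeff_central_mul_binomialComp (m : ℕ) :
    PowerSeries.coeff m (centralSeries * binomialComp (m + 1) (((m + 1 : ℕ) : ℚ) / 3) tauSeries) =
      coeffBeta (m + 1) := by
  rw [binomialComp, Finset.mul_sum, map_sum, coeffBeta]
  refine Finset.sum_congr rfl fun i _ => ?_
  rw [coeff_recQ, show centralSeries * (PowerSeries.C ((-1) ^ i * rising (((m + 1 : ℕ) : ℚ) / 3) i /
    (i.factorial : ℚ)) * tauSeries ^ i) = PowerSeries.C (rising (((m + 1 : ℕ) : ℚ) / 3) i /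
    (i.factorial : ℚ)) * (centralSeries * (-tauSeries) ^ i) from ?_, PowerSeries.coeff_C_mul]
  · ring
  · rw [neg_pow tauSeries, mul_div_assoc, map_mul, map_pow, map_neg, map_one]
    ring

theorem gamma_add_nat {x : ℝ} (hx : 0 < x) (i : ℕ) :
    Real.Gamma (x + i) = (∏ l ∈ Finset.range i, (x + l)) * Real.Gamma x := by
  induction i with
  | zero => simp
  | succ i ih =>
    have : x + (i : ℝ) ≠ 0 := by positivity
    rw [Nat.cast_succ, ← add_assoc, Real.Gamma_add_one this, ih, Finset.prod_range_succ]
    ring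

/-- Integrating `s^i` against the weight gives `Γ(j/3 + i)`, which is `Γ(j/3)` times a rising
factorial. -/
theorem integral_recQ (m : ℕ) :
    ∫ s in Ioi (0 : ℝ), Real.exp (-s) * s ^ (((m + 1 : ℕ) : ℝ) / 3 - 1) *
      aeval s (recQ (m + 1)) =
      Real.Gamma (((m + 1 : ℕ) : ℝ) / 3) * ((coeffBeta (m + 1) : ℚ) : ℝ) := by
  set x : ℝ := ((m + 1 : ℕ) : ℝ) / 3 with hx
  have hx0 : 0 < x := by rw [hx]; positivity
  have e1 : ∀ s ∈ Ioi (0 : ℝ), Real.exp (-s) * s ^ (x - 1) * aeval s (recQ (m + 1)) =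
      ∑ i ∈ Finset.range (m + 1), ((recQ (m + 1)).coeff i : ℝ) *
        (Real.exp (-s) * s ^ (x + i - 1)) := by
    intro s hs
    have hs : 0 < s := hs
    rw [aeval_eq_sum_range' (natDegree_recQ_lt m), Finset.mul_sum]
    refine Finset.sum_congr rfl fun i _ => ?_
    rw [show x + (i : ℝ) - 1 = x - 1 + i by ring, Real.rpow_add hs, Real.rpow_natCast,
      Algebra.smul_def, eq_ratCast]
    ring
  rw [setIntegral_congr_fun measurableSet_Ioi e1, integral_finsetSum]
  · rw [coeffBeta, Rat.cast_sum, Finset.mul_sum]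
    refine Finset.sum_congr rfl fun i _ => ?_
    rw [integral_const_mul, ← Real.Gamma_eq_integral (by positivity), gamma_add_nat hx0, rising]
    push_cast
    rw [hx]
    push_cast
    ring
  · intro i _
    exact (Real.GammaIntegral_convergent (by positivity)).const_mul _

/-! ### The cut integrals as residues at the saddle point -/

theorem eventually_abs_im_lt : ∀ᶠ L : ℂ in 𝓝[≠] saddleLog, |L.im| < Real.pi := by
  refine nhdsWithin_le_nhds ((isOpen_lt (by fun_prop) continuous_const).mem_nhds ?_)
  simp [saddleLog_im, Real.pi_pos]

theorem tendsto_half_sub_exp :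
    Tendsto (fun L : ℂ => 1 / 2 - Complex.exp L) (𝓝[≠] saddleLog) (𝓝[≠] 0) := by
  refine tendsto_nhdsWithin_iff.mpr ⟨?_, ?_⟩
  · have : Tendsto (fun L : ℂ => 1 / 2 - Complex.exp L) (𝓝 saddleLog)
        (𝓝 (1 / 2 - Complex.exp saddleLog)) := Continuous.tendsto (by fun_prop) _
    rw [exp_saddleLog, sub_self] at this
    exact this.mono_left nhdsWithin_le_nhds
  · filter_upwards [eventually_abs_im_lt, self_mem_nhdsWithin] with L hL hs
    intro h
    have h : 1 / 2 - Complex.exp L = 0 := h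
    exact hs (eq_saddleLog hL.le (sub_eq_zero.mp h).symm)

/-- The constant `(-1)^j √2 (3/4)^(j/3)`. -/
noncomputable def residueConst (j : ℕ) : ℂ :=
  (-1) ^ j * (((2 : ℝ) ^ (1 / 2 : ℝ) * (3 / 4 : ℝ) ^ ((j : ℝ) / 3) : ℝ) : ℂ)

/-- All powers are principal and match branch by branch: in the open strip `log e^L = L`, positive
real factors split off the logarithm, and the cube root is already defined by the principal power.
-/
theorem rootIntegrand_mul_pow {j : ℕ} {L : ℂ} (hL : |L.im| < Real.pi) (hs : L ≠ saddleLog) :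
    rootIntegrand j L * (1 / 2 - Complex.exp L) ^ j = residueConst j *
      ((1 + -2 * (1 / 2 - Complex.exp L)) ^ (-((1 / 2 : ℚ) : ℂ)) *
        (1 + tauFun (1 / 2 - Complex.exp L)) ^ (-(((j : ℚ) / 3 : ℚ) : ℂ))) := by
  obtain ⟨l1, l2⟩ := abs_lt.mp hL
  have hne : Complex.exp L ≠ 1 / 2 := fun h => hs (eq_saddleLog hL.le h)
  have hq := cubicQuot_mem_slitPlane hL.le hne
  have hq0 := Complex.slitPlane_ne_zero hq
  have hlog : Complex.log (1 / 2 - (1 / 2 - Complex.exp L)) = L := by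
    rw [sub_sub_cancel, Complex.log_exp l1 l2.le]
  have htau : 1 + tauFun (1 / 2 - Complex.exp L) = ((3 / 4 : ℝ) : ℂ) * cubicQuot L := by
    rw [tauFun, hlog]; push_cast; ring
  have hz : 1 + -2 * (1 / 2 - Complex.exp L) = ((2 : ℝ) : ℂ) * Complex.exp L := by
    push_cast; ring
  have e1 : (1 + -2 * (1 / 2 - Complex.exp L)) ^ (-((1 / 2 : ℚ) : ℂ)) =
      Complex.exp (-((Real.log 2 : ℂ) + L) / 2) := by
    rw [hz, Complex.cpow_def_of_ne_zero (mul_ne_zero (by norm_num) (Complex.exp_ne_zero L)),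
      Complex.log_ofReal_mul (by norm_num) (Complex.exp_ne_zero L), Complex.log_exp l1 l2.le]
    congr 1; push_cast; ring
  have e2 : (1 + tauFun (1 / 2 - Complex.exp L)) ^ (-(((j : ℚ) / 3 : ℚ) : ℂ)) =
      Complex.exp (-((Real.log (3 / 4) : ℂ) + Complex.log (cubicQuot L)) * (j / 3)) := by
    rw [htau, Complex.cpow_def_of_ne_zero (mul_ne_zero (by norm_num) hq0),
      Complex.log_ofReal_mul (by norm_num) hq0]
    congr 1; push_cast; ring
  have e3 : (((2 : ℝ) ^ (1 / 2 : ℝ) * (3 / 4 : ℝ) ^ ((j : ℝ) / 3) : ℝ) : ℂ) =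
      Complex.exp ((Real.log 2 : ℂ) / 2 + (Real.log (3 / 4) : ℂ) * (j / 3)) := by
    rw [Real.rpow_def_of_pos (by norm_num), Real.rpow_def_of_pos (by norm_num), ← Real.exp_add,
      Complex.ofReal_exp]
    congr 1; push_cast; ring
  have e4 : cubicQuot L ^ (1 / 3 : ℂ) ≠ 0 := by
    rw [cpow_third_eq_exp hq]; exact Complex.exp_ne_zero _
  have e5 : (cubicQuot L ^ (1 / 3 : ℂ)) ^ j =
      Complex.exp (Complex.log (cubicQuot L) * (j / 3)) := by
    rw [cpow_third_eq_exp hq, ← Complex.exp_nat_mul]; congr 1; ring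
  have e6 : (1 / 2 - Complex.exp L) ^ j = (-1) ^ j * (Complex.exp L - 1 / 2) ^ j := by
    rw [← mul_pow]; congr 1; ring
  have e7 : (Complex.exp L - 1 / 2) ^ j ≠ 0 := pow_ne_zero j (sub_ne_zero.mpr hne)
  rw [residueConst, e1, e2, e3, rootIntegrand, realRoot, mul_pow, e5, e6, mul_assoc ((-1) ^ j),
    ← Complex.exp_add, ← Complex.exp_add, div_mul_eq_mul_div, div_eq_iff (mul_ne_zero e7
      (Complex.exp_ne_zero _)), show (-1 : ℂ) ^ j * Complex.exp
      (Real.log 2 / 2 + Real.log (3 / 4) * (j / 3) + (-(Real.log 2 + L) / 2 +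
        -(Real.log (3 / 4) + Complex.log (cubicQuot L)) * (j / 3))) *
        ((Complex.exp L - 1 / 2) ^ j * Complex.exp (Complex.log (cubicQuot L) * (j / 3))) =
      (-1) ^ j * (Complex.exp L - 1 / 2) ^ j * (Complex.exp
      (Real.log 2 / 2 + Real.log (3 / 4) * (j / 3) + (-(Real.log 2 + L) / 2 +
        -(Real.log (3 / 4) + Complex.log (cubicQuot L)) * (j / 3))) *
        Complex.exp (Complex.log (cubicQuot L) * (j / 3))) by ring, ← Complex.exp_add,
    mul_comm (Complex.exp _)]
  congr 2
  ring

/-- The polar part of `z^(-1/2) / v(z)^j` at the saddle point. -/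
theorem exists_polar_part (m : ℕ) : ∃ P : ℂ[X], P.coeff m = ((coeffBeta (m + 1) : ℚ) : ℂ) ∧
    (fun L => rootIntegrand (m + 1) L - residueConst (m + 1) *
      (P.eval (1 / 2 - Complex.exp L) / (1 / 2 - Complex.exp L) ^ (m + 1)))
      =O[𝓝[≠] saddleLog] fun _ => (1 : ℂ) := by
  have hE := (expandsTo_inv_sqrt (m := m + 1) (by omega)).mul
    ((expandsTo_tauFun (m := m + 1) (by omega)).one_add_cpow_neg (by omega)
      (by simp [tauSeries]) (((m + 1 : ℕ) : ℚ) / 3))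
  obtain ⟨P, hc, hP⟩ := hE
  refine ⟨P, by rw [hc m (by omega), coeff_central_mul_binomialComp], ?_⟩
  have h1 := (hP.comp_tendsto tendsto_half_sub_exp).const_mul_left (residueConst (m + 1))
  have h2 := h1.mul (Asymptotics.isBigO_refl (fun L : ℂ => 1 / (1 / 2 - Complex.exp L) ^ (m + 1))
    (𝓝[≠] saddleLog))
  refine h2.congr' ?_ ?_
  · filter_upwards [eventually_abs_im_lt, self_mem_nhdsWithin] with L hL hs
    have hy : (1 / 2 - Complex.exp L) ^ (m + 1) ≠ 0 := pow_ne_zero _ fun h =>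
      hs (eq_saddleLog hL.le (sub_eq_zero.mp h).symm)
    simp only [Function.comp]
    rw [mul_sub, ← rootIntegrand_mul_pow hL hs]
    generalize 1 / 2 - Complex.exp L = y at *
    field_simp
  · filter_upwards [eventually_abs_im_lt, self_mem_nhdsWithin] with L hL hs
    have hy : (1 / 2 - Complex.exp L) ^ (m + 1) ≠ 0 := pow_ne_zero _ fun h =>
      hs (eq_saddleLog hL.le (sub_eq_zero.mp h).symm)
    simp only [Function.comp]
    exact mul_one_div_cancel hy

theorem circleIntegral_polar_of_lt (P : ℂ[X]) (m : ℕ) {r : ℝ} (hr0 : 0 ≤ r) (hr : r < 1 / 2) :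
    ∮ z in C(0, r), P.eval (1 / 2 - z) / (1 / 2 - z) ^ (m + 1) = 0 := by
  have hne : ∀ z ∈ Metric.closedBall (0 : ℂ) r, (1 / 2 - z) ^ (m + 1) ≠ 0 := by
    intro z hz
    refine pow_ne_zero _ fun h => ?_
    rw [mem_closedBall_zero_iff, ← sub_eq_zero.mp h] at hz
    norm_num at hz
    linarith
  have hd : ∀ z ∈ Metric.closedBall (0 : ℂ) r,
      DifferentiableAt ℂ (fun z => P.eval (1 / 2 - z) / (1 / 2 - z) ^ (m + 1)) z := by
    intro z hz
    refine DifferentiableAt.div ?_ (by fun_prop) (hne z hz)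
    exact P.differentiable.differentiableAt.comp z (by fun_prop)
  refine Complex.circleIntegral_eq_zero_of_differentiable_on_off_countable hr0 countable_empty
    (fun z hz => (hd z hz).continuousAt.continuousWithinAt)
    fun z hz => hd z (Metric.ball_subset_closedBall hz.1)

/-- Only the exponent `-1` survives; the sign comes from `1/2 - z` in place of `z - 1/2`. -/
theorem circleIntegral_polar_of_gt (P : ℂ[X]) (m : ℕ) {r : ℝ} (hr : 1 / 2 < r) :
    ∮ z in C(0, r), P.eval (1 / 2 - z) / (1 / 2 - z) ^ (m + 1) =
      -(2 * Real.pi * Complex.I) * P.coeff m := by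
  have hr0 : 0 ≤ r := by linarith
  have hs : ∀ z ∈ Metric.sphere (0 : ℂ) r, z - 1 / 2 ≠ 0 := by
    intro z hz h
    rw [mem_sphere_zero_iff_norm, sub_eq_zero.mp h] at hz
    norm_num at hz
    linarith
  set n : ℕ → ℤ := fun i => (i : ℤ) - (m + 1 : ℕ) with hn
  have h1 : ∮ z in C(0, r), P.eval (1 / 2 - z) / (1 / 2 - z) ^ (m + 1) =
      ∮ z in C(0, r), ∑ i ∈ Finset.range (P.natDegree + 1 + (m + 1)),
        P.coeff i * (-1) ^ n i * (z - 1 / 2) ^ n i := by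
    refine circleIntegral.integral_congr hr0 fun z hz => ?_
    have hz0 := hs z hz
    have hy : (1 / 2 - z : ℂ) = -1 * (z - 1 / 2) := by ring
    have hy0 : (1 / 2 - z : ℂ) ≠ 0 := by rw [hy]; exact mul_ne_zero (by norm_num) hz0
    rw [P.eval_eq_sum_range' (show P.natDegree < P.natDegree + 1 + (m + 1) by omega),
      Finset.sum_div]
    refine Finset.sum_congr rfl fun i _ => ?_
    rw [mul_assoc, ← mul_zpow, ← hy, hn, zpow_sub₀ hy0, zpow_natCast, zpow_natCast, mul_div_assoc]
  have hci : ∀ i, CircleIntegrable (fun z : ℂ => P.coeff i * (-1) ^ n i * (z - 1 / 2) ^ n i)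
      0 r := by
    intro i
    refine ContinuousOn.circleIntegrable hr0 (continuousOn_const.mul ?_)
    exact ContinuousOn.zpow₀ (by fun_prop) _ fun z hz => Or.inl (hs z hz)
  rw [h1, circleIntegral.integral_fun_sum fun i _ => hci i]
  have hi : ∀ i, ∮ z in C(0, r), P.coeff i * (-1) ^ n i * (z - 1 / 2) ^ n i =
      if i = m then -(2 * Real.pi * Complex.I) * P.coeff m else 0 := by
    intro i
    rw [circleIntegral.integral_const_mul]
    split_ifs with him
    · have hnm : n i = -1 := by rw [hn, him]; push_cast; ring
      rw [hnm, him]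
      simp only [zpow_neg_one]
      rw [circleIntegral.integral_sub_inv_of_mem_ball (by
        rw [mem_ball_zero_iff]; norm_num; linarith)]
      norm_num
      ring
    · have hnm : n i ≠ -1 := by
        intro h
        simp only [hn] at h
        push_cast at h
        omega
      rw [circleIntegral.integral_sub_zpow_of_ne hnm, mul_zero]
  simp only [hi]
  rw [Finset.sum_ite_eq', if_pos (Finset.mem_range.mpr (by omega))]

/-- A residue computation by subtraction of the polar part, which is single-valued in `z` and so
does not alter the jump across the cut. Its circle integral gives the residue outside the saddle
point and zero inside. -/
theorem cutIntegral_rootIntegrand (m : ℕ) : cutIntegral (rootIntegrand (m + 1)) =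
    -(2 * Real.pi * Complex.I) * (residueConst (m + 1) * ((coeffBeta (m + 1) : ℚ) : ℂ)) := by
  have hpi := Real.pi_pos
  obtain ⟨P, hP, hO⟩ := exists_polar_part m
  set K := residueConst (m + 1) with hK
  set F : ℂ → ℂ := fun z => P.eval (1 / 2 - z) / (1 / 2 - z) ^ (m + 1) with hF
  set f : ℂ → ℂ := fun L =>
    Complex.exp L * rootIntegrand (m + 1) L - K * (Complex.exp L * F (Complex.exp L)) with hf
  have hdf : ∀ L : ℂ, |L.im| ≤ Real.pi → L ≠ saddleLog → DifferentiableAt ℂ f L := by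
    intro L hL hs
    have hne : (1 / 2 - Complex.exp L) ^ (m + 1) ≠ 0 := pow_ne_zero _ fun h =>
      hs (eq_saddleLog hL (sub_eq_zero.mp h).symm)
    have h1 : DifferentiableAt ℂ (rootIntegrand (m + 1)) L :=
      DifferentiableAt.div (by fun_prop) ((differentiableAt_realRoot hL hs).pow _)
        (pow_ne_zero _ (realRoot_ne_zero hL hs))
    have h2 : DifferentiableAt ℂ (fun L => F (Complex.exp L)) L := by
      refine DifferentiableAt.div ?_ (by fun_prop) hne
      exact P.differentiable.differentiableAt.comp L (by fun_prop)
    exact (Complex.differentiableAt_exp.mul h1).sub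
      ((Complex.differentiableAt_exp.mul h2).const_mul K)
  have hlim : Tendsto f (𝓝[≠] saddleLog) (𝓝 (limUnder (𝓝[≠] saddleLog) f)) := by
    refine Complex.tendsto_limUnder_of_differentiable_on_punctured_nhds_of_bounded_under ?_ ?_
    · filter_upwards [eventually_abs_im_lt, self_mem_nhdsWithin] with L hL hs
      exact hdf L hL.le hs
    · have he : (fun L : ℂ => Complex.exp L) =O[𝓝[≠] saddleLog] fun _ => (1 : ℂ) :=
        ((Complex.continuous_exp.tendsto saddleLog).mono_left nhdsWithin_le_nhds).isBigO_one ℂ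
      have h1 : f =O[𝓝[≠] saddleLog] fun _ => (1 : ℂ) := by
        have := he.mul hO
        simp only [mul_one] at this
        exact this.congr_left fun L => by simp only [hf, hF]; ring
      have h2 : (fun L => f L - f saddleLog) =O[𝓝[≠] saddleLog] fun _ => (1 : ℂ) :=
        h1.sub (Asymptotics.isBigO_const_const _ one_ne_zero _)
      exact (Asymptotics.isBigO_one_iff ℂ).mp h2
  -- Without its polar part the integrand is bounded at the saddle point, so the singularity is
  -- removable and the updated function is continuous there.
  set φ : ℂ → ℂ := Function.update f saddleLog (limUnder (𝓝[≠] saddleLog) f) with hφ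
  have hφf : ∀ L : ℂ, L ≠ saddleLog → φ L = f L := fun L hL => Function.update_of_ne hL _ _
  have hφe : ∀ L : ℂ, L ≠ saddleLog → φ =ᶠ[𝓝 L] f := fun L hL => by
    filter_upwards [isOpen_ne.mem_nhds hL] with L' hL' using hφf L' hL'
  have hφc : ContinuousOn φ {L | |L.im| ≤ Real.pi} := by
    intro L hL
    by_cases hs : L = saddleLog
    · rw [hs]
      exact (continuousAt_update_same.mpr hlim).continuousWithinAt
    · exact ((hdf L hL hs).continuousAt.congr (hφe L hs).symm).continuousWithinAt
  have hvert : ∀ R : ℝ, Real.exp R ≠ 1 / 2 → vertIntegral φ R =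
      vertIntegral (fun L => Complex.exp L * rootIntegrand (m + 1) L) R -
        K * vertIntegral (fun L => Complex.exp L * F (Complex.exp L)) R := by
    intro R hR
    have hsad : ∀ y : ℝ, (R : ℂ) + y * Complex.I ≠ saddleLog := by
      intro y h
      have h1 := congrArg norm exp_saddleLog
      rw [← h, Complex.norm_exp] at h1
      norm_num at h1
      exact hR (by rw [h1])
    have hmap : MapsTo (fun y : ℝ => (R : ℂ) + y * Complex.I) (uIcc (-Real.pi) Real.pi)
        {L | |L.im| ≤ Real.pi ∧ L ≠ saddleLog} := by
      intro y hy
      rw [uIcc_of_le (by linarith)] at hy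
      exact ⟨by simpa using abs_le.mpr hy, hsad y⟩
    have hc1 : ContinuousOn (fun L => Complex.exp L * rootIntegrand (m + 1) L)
        {L | |L.im| ≤ Real.pi ∧ L ≠ saddleLog} := fun L hL => by
      have : DifferentiableAt ℂ (rootIntegrand (m + 1)) L :=
        DifferentiableAt.div (by fun_prop) ((differentiableAt_realRoot hL.1 hL.2).pow _)
          (pow_ne_zero _ (realRoot_ne_zero hL.1 hL.2))
      exact (Complex.differentiableAt_exp.mul this).continuousAt.continuousWithinAt
    have hc2 : ContinuousOn (fun L => Complex.exp L * rootIntegrand (m + 1) L - f L)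
        {L | |L.im| ≤ Real.pi ∧ L ≠ saddleLog} := fun L hL =>
      (hc1 L hL).sub (hdf L hL.1 hL.2).continuousAt.continuousWithinAt
    have hg : Continuous fun y : ℝ => (R : ℂ) + y * Complex.I := by fun_prop
    simp only [vertIntegral]
    rw [← intervalIntegral.integral_const_mul, ← intervalIntegral.integral_sub]
    · exact intervalIntegral.integral_congr fun y _ => hφf _ (hsad y)
    · exact (hc1.comp hg.continuousOn hmap).intervalIntegrable
    · refine ((hc2.comp hg.continuousOn hmap).congr fun y _ => ?_).intervalIntegrable
      simp only [Function.comp, hf]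
      ring
  have key := cutIntegral_eq_of_tendsto (φ := φ) (c := 2 * Real.pi * (K * P.coeff m)) (c' := 0)
    (cutIntegrable_rootIntegrand (j := m + 1) (by omega)) hφc
    (fun L hL hs => (hdf L hL.le hs).congr_of_eventuallyEq (hφe L hs)) (fun t => ?_) ?_ ?_
  · rw [key, ← hP]; ring
  · rw [hφf _ (ne_saddleLog_of_abs_im_eq_pi (by simp [abs_of_pos hpi])),
      hφf _ (ne_saddleLog_of_abs_im_eq_pi (by simp [abs_of_pos hpi]))]
    simp only [hf]
    rw [exp_add_pi_mul_I, exp_sub_pi_mul_I]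
    ring
  · obtain ⟨R₀, hR₀, hroot⟩ := exists_realRoot_eq_exp (show (0 : ℝ) < 1 / 3 by norm_num)
    have hz : Tendsto (vertIntegral fun L => Complex.exp L * rootIntegrand (m + 1) L) atTop
        (𝓝 0) := by
      rw [tendsto_zero_iff_norm_tendsto_zero]
      refine squeeze_zero' (Eventually.of_forall fun _ => norm_nonneg _) ?_
        (g := fun R => Real.exp (1 / 3 - R / 6) * (2 * Real.pi)) ?_
      · filter_upwards [eventually_ge_atTop R₀, eventually_ge_atTop 1] with R hR hR1
        refine norm_vertIntegral_le fun y hy => ?_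
        set L : ℂ := R + y * Complex.I with hL
        have hLre : L.re = R := by simp [hL]
        have hLim : |L.im| ≤ Real.pi := by simpa [hL] using hy
        obtain ⟨δ, hδ, hV⟩ := hroot L (by rw [hLre]; exact hR) hLim
        have hδre := abs_le.mp ((Complex.abs_re_le_norm δ).trans hδ)
        have hn : Real.exp (2 * R / 3 - 1 / 3) ≤ ‖realRoot L‖ := by
          rw [hV, Complex.norm_exp, Complex.add_re,
            show (2 * L / 3 : ℂ) = ((2 / 3 : ℝ) : ℂ) * L by push_cast; ring,
            Complex.re_ofReal_mul, hLre]
          exact Real.exp_le_exp.mpr (by linarith)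
        have hn1 : 1 ≤ ‖realRoot L‖ := (Real.one_le_exp (by linarith)).trans hn
        rw [rootIntegrand, ← mul_div_assoc, exp_mul_exp_neg_half, norm_div, norm_exp_half, hLre,
          norm_pow]
        calc _ ≤ Real.exp (R / 2) / Real.exp (2 * R / 3 - 1 / 3) := by
              gcongr
              exact hn.trans (le_self_pow₀ hn1 (by omega))
          _ = Real.exp (1 / 3 - R / 6) := by
              rw [← Real.exp_sub]; congr 1; ring
      · have h1 : Tendsto (fun R : ℝ => Real.exp (1 / 3 - R / 6)) atTop (𝓝 0) := by
          refine Real.tendsto_exp_atBot.comp ?_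
          refine tendsto_atBot_add_const_left atTop (1 / 3 : ℝ) (f := fun R : ℝ => -(R / 6)) ?_
          exact tendsto_neg_atTop_atBot.comp (tendsto_id.atTop_div_const (by norm_num))
        simpa using h1.mul_const (2 * Real.pi)
    have hpol : ∀ᶠ R : ℝ in atTop, vertIntegral (fun L => Complex.exp L * rootIntegrand (m + 1) L)
        R + 2 * Real.pi * (K * P.coeff m) = vertIntegral φ R := by
      -- For `R ≥ 0` the circle of radius `e^R` encloses the saddle point `1/2`.
      filter_upwards [eventually_ge_atTop 0] with R hR
      have hR1 : 1 ≤ Real.exp R := Real.one_le_exp hR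
      rw [hvert R (by linarith), vertIntegral_eq_circleIntegral F,
        circleIntegral_polar_of_gt P m (by linarith)]
      linear_combination (2 * Real.pi * K * P.coeff m) * Complex.I_sq
    have := (hz.add_const (2 * Real.pi * (K * P.coeff m))).congr' hpol
    simpa using this
  · obtain ⟨R₀, hR₀⟩ := exists_realRoot_mem_leftSector
    have hz : Tendsto (vertIntegral fun L => Complex.exp L * rootIntegrand (m + 1) L) atBot
        (𝓝 0) := by
      rw [tendsto_zero_iff_norm_tendsto_zero]
      refine squeeze_zero' (Eventually.of_forall fun _ => norm_nonneg _) ?_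
        (g := fun R => Real.exp (R / 2) * (2 * Real.pi)) ?_
      · filter_upwards [eventually_le_atBot R₀] with R hR
        refine norm_vertIntegral_le fun y hy => ?_
        set L : ℂ := R + y * Complex.I with hL
        have hLre : L.re = R := by simp [hL]
        have hLim : |L.im| ≤ Real.pi := by simpa [hL] using hy
        obtain ⟨-, -, h3⟩ := hR₀ L (by rw [hLre]; exact hR) hLim
        rw [rootIntegrand, ← mul_div_assoc, exp_mul_exp_neg_half, norm_div, norm_exp_half, hLre,
          norm_pow]
        exact div_le_self (Real.exp_pos _).le (one_le_pow₀ h3)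
      · have h1 : Tendsto (fun R : ℝ => Real.exp (R / 2)) atBot (𝓝 0) :=
          Real.tendsto_exp_atBot.comp (tendsto_id.atBot_div_const (by norm_num))
        simpa using h1.mul_const (2 * Real.pi)
    refine hz.congr' ?_
    filter_upwards [Real.tendsto_exp_atBot.eventually_lt_const (show (0 : ℝ) < 1 / 2 by norm_num)]
      with R hR
    rw [hvert R hR.ne, vertIntegral_eq_circleIntegral F,
      circleIntegral_polar_of_lt P m (Real.exp_pos R).le hR, mul_zero, mul_zero, sub_zero]

theorem coeffD_succ (m : ℕ) :
    coeffD (m + 1) = (((-1) ^ m * coeffBeta (m + 1) : ℚ) : ℂ) := by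
  have h1 : (4 / 3 : ℝ) ^ (((m + 1 : ℕ) : ℝ) / 3) * (3 / 4 : ℝ) ^ (((m + 1 : ℕ) : ℝ) / 3) = 1 := by
    rw [← Real.mul_rpow (by norm_num) (by norm_num)]; norm_num
  have h2 : (2 : ℝ) ^ (3 / 2 : ℝ) = 2 * (2 : ℝ) ^ (1 / 2 : ℝ) := by
    rw [show (3 / 2 : ℝ) = 1 + 1 / 2 by norm_num, Real.rpow_add (by norm_num), Real.rpow_one]
  have h1' : (((4 / 3 : ℝ) ^ (((m + 1 : ℕ) : ℝ) / 3) : ℝ) : ℂ) *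
      (((3 / 4 : ℝ) ^ (((m + 1 : ℕ) : ℝ) / 3) : ℝ) : ℂ) = 1 := by
    rw [← Complex.ofReal_mul, h1, Complex.ofReal_one]
  have h3 : (((2 : ℝ) ^ (1 / 2 : ℝ) : ℝ) : ℂ) ≠ 0 := by
    rw [Complex.ofReal_ne_zero]; positivity
  have hpi : (Real.pi : ℂ) ≠ 0 := by exact_mod_cast Real.pi_ne_zero
  rw [coeffD_eq, cutIntegral_rootIntegrand, residueConst, h2, Complex.ofReal_mul,
    Complex.ofReal_mul ((2 : ℝ) ^ (1 / 2 : ℝ))]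
  generalize (((4 / 3 : ℝ) ^ (((m + 1 : ℕ) : ℝ) / 3) : ℝ) : ℂ) = A at *
  generalize (((3 / 4 : ℝ) ^ (((m + 1 : ℕ) : ℝ) / 3) : ℝ) : ℂ) = B at *
  generalize (((2 : ℝ) ^ (1 / 2 : ℝ) : ℝ) : ℂ) = s at *
  have hI := Complex.I_ne_zero
  push_cast
  field_simp
  rw [pow_succ]
  linear_combination ((-1) ^ m * (coeffBeta (m + 1) : ℂ)) * h1'

/-! ### Assembly of the expansion and its error bound -/

/-- The coefficients `D_j` as rational numbers. -/
noncomputable def ratCoeff (j : ℕ) : ℚ := (-1) ^ (j - 1) * coeffBeta j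

/-- The terms of the expansion. -/
noncomputable def expansionTerm (N : ℝ) (j : ℕ) : ℝ :=
  (3 / 4 : ℝ) ^ ((j : ℝ) / 3) * (ratCoeff j : ℝ) * Real.sin (2 * Real.pi * j / 3) *
    (Real.Gamma ((j : ℝ) / 3) / N ^ ((j : ℝ) / 3))

theorem coeffD_eq_ratCoeff {j : ℕ} (hj : 1 ≤ j) : coeffD j = ((ratCoeff j : ℚ) : ℂ) := by
  obtain ⟨m, rfl⟩ := Nat.exists_eq_add_of_le' hj
  exact coeffD_succ m

theorem ratCoeff_eq_integral {j : ℕ} (hj : 1 ≤ j) :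
    (ratCoeff j : ℝ) = (-1) ^ (j - 1) / Real.Gamma ((j : ℝ) / 3) *
      ∫ s in Ioi (0 : ℝ), Real.exp (-s) * s ^ ((j : ℝ) / 3 - 1) * aeval s (recQ j) := by
  obtain ⟨m, rfl⟩ := Nat.exists_eq_add_of_le' hj
  have hG : Real.Gamma (((m + 1 : ℕ) : ℝ) / 3) ≠ 0 :=
    (Real.Gamma_pos_of_pos (by positivity)).ne'
  rw [integral_recQ, ratCoeff]
  push_cast at hG ⊢
  field_simp

/-- The factor `-4π√2/3` is independent of `j`; it becomes the common normalization that is divided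
out in the comparison with the Hermite integral. -/
theorem rayCoeff_mul_cutIntegral {N : ℝ} (hN : 0 < N) {j : ℕ} (hj : 1 ≤ j) :
    rayCoeff N j * cutIntegral (rootIntegrand j) =
      ((-(4 * Real.pi * (2 : ℝ) ^ (1 / 2 : ℝ) / 3) * expansionTerm N j : ℝ) : ℂ) := by
  obtain ⟨m, rfl⟩ := Nat.exists_eq_add_of_le' hj
  have hc : ((m : ℝ) + 1) = ((m + 1 : ℕ) : ℝ) := by push_cast; rfl
  rw [rayCoeff, Nat.add_sub_cancel, moment_eq hN, cutIntegral_rootIntegrand, residueConst,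
    expansionTerm, ratCoeff, Nat.add_sub_cancel, hc]
  generalize ((3 : ℝ) / 4) ^ (((m + 1 : ℕ) : ℝ) / 3) = A
  generalize (2 : ℝ) ^ (1 / 2 : ℝ) = B
  generalize N ^ (((m + 1 : ℕ) : ℝ) / 3) = M
  generalize Real.Gamma (((m + 1 : ℕ) : ℝ) / 3) = G
  generalize Real.sin (2 * Real.pi * ((m + 1 : ℕ) : ℝ) / 3) = S
  push_cast
  rw [pow_succ]
  simp only [div_eq_mul_inv, mul_inv]
  linear_combination (4 * S * G * 3⁻¹ * (M : ℂ)⁻¹ * Real.pi * (-1) ^ m * B * A *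
    coeffBeta (m + 1)) * Complex.I_sq

theorem abs_sum_expansionTerm_sub_le {n : ℕ} {N : ℝ} (hN : N = 2 * (n : ℝ) + 1) {p : ℕ}
    (hp : 1 ≤ p) :
    |hermiteH n √N / (2 ^ (n + 1) * (n.factorial : ℝ) * Real.exp (3 * N / 4) /
        (3 * Real.pi * N ^ ((n : ℝ) / 2))) -
      ∑ j ∈ Finset.Ico 1 (p + 3), expansionTerm N j| ≤
    1 / ((2 : ℝ) ^ (3 / 2 : ℝ) * Real.pi) * (constC (p + 3) *
      Real.Gamma (((p + 3 : ℕ) : ℝ) / 3) / N ^ (((p + 3 : ℕ) : ℝ) / 3)) := by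
  have hN0 : 0 < N := by rw [hN]; positivity
  have hpi := Real.pi_pos
  set c : ℝ := 4 * Real.pi * (2 : ℝ) ^ (1 / 2 : ℝ) / 3 with hc
  have hc0 : 0 < c := by positivity
  have h1 := (cutIntegral_rayTransform_expansion hN0 hp).2
  rw [cutIntegral_rayTransform hN0 (cutIntegral_rayTransform_expansion hN0 hp).1
    (vertIntegral_exp_phase n hN), Finset.sum_congr rfl fun j hj =>
    rayCoeff_mul_cutIntegral hN0 (Finset.mem_Ico.mp hj).1, ← Complex.ofReal_sum,
    ← Finset.mul_sum] at h1
  set S := ∑ j ∈ Finset.Ico 1 (p + 3), expansionTerm N j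
  set H : ℝ := Real.exp (-(3 * N / 4)) * 2 ^ (-(N / 2)) *
    (2 * Real.pi * √N ^ n * hermiteH n √N / n.factorial) with hH
  have h2 : 2 * Real.pi * H = c * (hermiteH n √N / (2 ^ (n + 1) * (n.factorial : ℝ) *
      Real.exp (3 * N / 4) / (3 * Real.pi * N ^ ((n : ℝ) / 2)))) := by
    have e1 : √N ^ n = N ^ ((n : ℝ) / 2) := by
      rw [Real.sqrt_eq_rpow, ← Real.rpow_natCast, ← Real.rpow_mul hN0.le]
      congr 1; ring
    -- Since `N/2 = n + 1/2`, the power of two coming from `f(1/2)` matches `2^(n+1)` up to `√2`.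
    have e2 : (2 : ℝ) ^ (-(N / 2)) * 2 ^ (n + 1) = (2 : ℝ) ^ (1 / 2 : ℝ) := by
      rw [← Real.rpow_natCast, ← Real.rpow_add (by norm_num), hN]
      congr 1; push_cast; ring
    have e3 : Real.exp (-(3 * N / 4)) * Real.exp (3 * N / 4) = 1 := by
      rw [← Real.exp_add, neg_add_cancel, Real.exp_zero]
    have e4 : 0 < N ^ ((n : ℝ) / 2) := by positivity
    have e5 := Real.exp_pos (3 * N / 4)
    have e6 : (0 : ℝ) < n.factorial := by positivity
    rw [hH, hc, e1, ← e2, Real.exp_neg]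
    field_simp
    ring
  set X := hermiteH n √N / (2 ^ (n + 1) * (n.factorial : ℝ) *
      Real.exp (3 * N / 4) / (3 * Real.pi * N ^ ((n : ℝ) / 2)))
  have h3 : -(2 * (Real.pi : ℂ)) * (H : ℂ) - ((-c * S : ℝ) : ℂ) = ((-(c * (X - S)) : ℝ) : ℂ) := by
    rw [show -(c * (X - S)) = -(2 * Real.pi * H) + c * S by rw [h2]; ring]
    push_cast
    ring
  rw [h3, Complex.norm_real, Real.norm_eq_abs, abs_neg, abs_mul, abs_of_pos hc0,
    moment_eq hN0, mul_comm c] at h1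
  refine ((le_div_iff₀ hc0).mpr h1).trans (le_of_eq ?_)
  have e7 : (2 : ℝ) ^ (3 / 2 : ℝ) = 2 * (2 : ℝ) ^ (1 / 2 : ℝ) := by
    rw [show (3 / 2 : ℝ) = 1 + 1 / 2 by norm_num, Real.rpow_add (by norm_num), Real.rpow_one]
  have e8 : (((p + 2 : ℕ) : ℝ) + 1) / 3 = ((p + 3 : ℕ) : ℝ) / 3 := by push_cast; ring
  have e9 : ((p + 3 : ℕ) : ℝ) / 3 - 1 = (p : ℝ) / 3 := by push_cast; ring
  have e10 : 4 * ((p + 3 : ℕ) : ℝ) - 15 = 4 * (p : ℝ) - 3 := by push_cast; ring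
  rw [constC, e7, e8, e9, e10, hc]
  generalize 2 / (Real.pi / 2) ^ ((p : ℝ) / 3) + 6 / (4 * (p : ℝ) - 3) = Y
  have e11 : 0 < N ^ (((p + 3 : ℕ) : ℝ) / 3) := by positivity
  have e12 : (0 : ℝ) < 2 ^ (1 / 2 : ℝ) := by positivity
  field_simp
  ring

theorem abs_expansionTerm {N : ℝ} (hN : 0 < N) {p : ℕ} (hp : 1 ≤ p) :
    |expansionTerm N p| = omittedTerm ratCoeff p / N ^ ((p : ℝ) / 3) := by
  have hG : 0 < Real.Gamma ((p : ℝ) / 3) :=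
    Real.Gamma_pos_of_pos (div_pos (by exact_mod_cast hp) (by norm_num))
  rw [expansionTerm, omittedTerm, abs_mul, abs_of_pos (a := _ / _) (by positivity), ← mul_div_assoc]

/-- The expansion is used with one more term than displayed; that term is moved into the error,
where it gives the leading constant, and the remainder is smaller by `N^(-1/3)`. -/
theorem exists_error_bound {n : ℕ} {N : ℝ} (hN : N = 2 * (n : ℝ) + 1) {p : ℕ} (hp : 3 ≤ p) :
    ∃ ε : ℝ, hermiteH n √N = 2 ^ (n + 1) * (n.factorial : ℝ) * Real.exp (3 * N / 4) /
        (3 * Real.pi * N ^ ((n : ℝ) / 2)) * (∑ j ∈ Finset.Ico 1 p, expansionTerm N j + ε) ∧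
      |ε| ≤ errorConst ratCoeff p N / N ^ ((p : ℝ) / 3) := by
  have hN0 : 0 < N := by rw [hN]; positivity
  have hpi := Real.pi_pos
  -- Here `q = p - 2` is the power of `1/|V|` left in the remainder; `p ≥ 3` is what makes it at
  -- least `1`, so that the integral along the cut converges.
  obtain ⟨q, rfl⟩ := Nat.exists_eq_add_of_le' (show 2 ≤ p by omega)
  have h1 := abs_sum_expansionTerm_sub_le hN (show 1 ≤ q by omega)
  set A := 2 ^ (n + 1) * (n.factorial : ℝ) * Real.exp (3 * N / 4) /
    (3 * Real.pi * N ^ ((n : ℝ) / 2)) with hA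
  have hA0 : A ≠ 0 := by positivity
  rw [show q + 3 = q + 2 + 1 by ring, Finset.sum_Ico_succ_top (show 1 ≤ q + 2 by omega)] at h1
  refine ⟨hermiteH n √N / A - ∑ j ∈ Finset.Ico 1 (q + 2), expansionTerm N j, ?_, ?_⟩
  · rw [add_sub_cancel, mul_div_cancel₀ _ hA0]
  · have h2 := abs_expansionTerm hN0 (show 1 ≤ q + 2 by omega)
    have h3 : N ^ (((q + 2 + 1 : ℕ) : ℝ) / 3) =
        N ^ (1 / 3 : ℝ) * N ^ (((q + 2 : ℕ) : ℝ) / 3) := by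
      rw [← Real.rpow_add hN0]; congr 1; push_cast; ring
    have h4 : ((q + 2 + 1 : ℕ) : ℝ) = ((q + 2 : ℕ) : ℝ) + 1 := by push_cast; ring
    rw [h3, h4] at h1
    rw [errorConst, add_div, ← h2]
    refine (sub_le_iff_le_add'.mp ((abs_sub_abs_le_abs_sub _ _).trans ?_))
    rw [sub_sub]
    refine h1.trans (le_of_eq ?_)
    rw [← div_div _ (N ^ (1 / 3 : ℝ)), ← mul_div_assoc]

theorem tendsto_errorConst (d : ℕ → ℚ) (p : ℕ) :
    Tendsto (fun n : ℕ => errorConst d p (2 * (n : ℝ) + 1)) atTop (𝓝 (omittedTerm d p)) := by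
  have h1 : Tendsto (fun n : ℕ => 2 * (n : ℝ) + 1) atTop atTop :=
    tendsto_atTop_add_const_right _ _ (tendsto_natCast_atTop_atTop.const_mul_atTop two_pos)
  have h2 := ((tendsto_rpow_atTop (show (0 : ℝ) < 1 / 3 by norm_num)).comp h1).const_div_atTop
    (constC (p + 1) * Real.Gamma (((p : ℝ) + 1) / 3))
  have h3 := (h2.const_mul (1 / ((2 : ℝ) ^ (3 / 2 : ℝ) * Real.pi))).const_add (omittedTerm d p)
  simpa [errorConst, Function.comp_def] using h3

end HermiteTurningPoint

theorem theorem3 :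
    ∃ d : ℕ → ℚ,
      -- the coefficients: convergent contour integrals, rational, given by the recurrence
      (∀ j : ℕ, 1 ≤ j →
        CutIntegrable (coeffIntegrand j) ∧
        coeffD j = ((d j : ℚ) : ℂ) ∧
        (d j : ℝ) = (-1) ^ (j - 1) / Real.Gamma ((j : ℝ) / 3) *
          ∫ s in Ioi (0 : ℝ), Real.exp (-s) * s ^ ((j : ℝ) / 3 - 1) * aeval s (recQ j)) ∧
      -- the expansion with the error bound
      (∀ (n : ℕ) (N : ℝ), N = 2 * (n : ℝ) + 1 → ∀ p : ℕ, 3 ≤ p →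
        ∃ ε : ℝ,
          hermiteH n (Real.sqrt N) =
            2 ^ (n + 1) * (n.factorial : ℝ) * Real.exp (3 * N / 4) /
                (3 * Real.pi * N ^ ((n : ℝ) / 2)) *
              ((∑ j ∈ Finset.Ico 1 p, (3 / 4 : ℝ) ^ ((j : ℝ) / 3) * (d j : ℝ) *
                  Real.sin (2 * Real.pi * j / 3) *
                  (Real.Gamma ((j : ℝ) / 3) / N ^ ((j : ℝ) / 3))) + ε) ∧
          |ε| ≤ errorConst d p N / N ^ ((p : ℝ) / 3)) ∧
      -- the limit of the constant of the bound
      (∀ p : ℕ, 3 ≤ p → ¬ 3 ∣ p →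
        Tendsto (fun n : ℕ => errorConst d p (2 * (n : ℝ) + 1)) atTop (𝓝 (omittedTerm d p))) := by
  exact ⟨ratCoeff, fun j hj => ⟨cutIntegrable_coeffIntegrand hj, coeffD_eq_ratCoeff hj,
    ratCoeff_eq_integral hj⟩, fun n N hN p hp => exists_error_bound hN hp,
    fun p _ _ => tendsto_errorConst ratCoeff p⟩
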